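/- **Definitions.** A concept class $\mathcal C \subseteq \{0,1\}^X$ (with $X$ finite and $\mathcal C$ nonempty) is given explicitly as the binary $|\mathcal C| \times |X|$ table of the values of its concepts; $n$ denotes the length of this input. $\mathrm{VC}(\mathcal C)$ is the size of a largest $S \subseteq X$ such that the restrictions of the concepts in $\mathcal C$ to $S$ are all of $\{0,1\}^S$. $\mathrm{Ldim}(\mathcal C)$ (Littlestone's Dimension) is the minimum, over all deterministic online prediction algorithms, of the maximum number of mistakes made on a sequence $(x_1,y_1),\dots,(x_T,y_T)$ with distinct $x_i$ that is realizable by $\mathcal C$ (the algorithm predicts $y_i$ from $x_i$ and the earlier labelled samples). For a constant $r \ge 1$, a (deterministic) algorithm approximates $\mathrm{VC}$ (resp. $\mathrm{Ldim}$) to within a factor $r$ if on every input $\mathcal C$ it outputs a natural number between $\mathrm{OPT}/r$ and $\mathrm{OPT}$, where $\mathrm{OPT} = \mathrm{VC}(\mathcal C)$ (resp. $\mathrm{OPT} = \mathrm{Ldim}(\mathcal C)$). $\mathcal G(N, 1/2)$ is the Erdős–Rényi random graph on $N$ vertices with edge probability $1/2$, and $\mathcal G(N, 1/2, \kappa)$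 is the distribution of a sample of $\mathcal G(N, 1/2)$ in which a uniformly random set of $\kappa$ vertices is made a clique. The *Strongish Planted Clique Hypothesis* states: there is $\delta \in (0,1)$ such that no randomized $N^{o(\log N)}$-time algorithm $\mathbb A$ satisfies, for all sufficiently large $N$, both $$\Pr_{G \sim \mathcal G(N, 1/2, \lceil N^\delta\rceil)}[\mathbb A(G) = 1] \ge 2/3 \quad\text{and}\quad \Pr_{G \sim \mathcal G(N, 1/2)}[\mathbb A(G) = 1] \le 1/3 ,$$ where the probabilities are over $G$ and the coins of $\mathbb A$. **Theorem.** Assume the Strongish Planted Clique Hypothesis. Then for every constant $r \ge 1$ there is no $n^{o(\log n)}$-time algorithm that approximates $\mathrm{VC}$ to within a factor $r$, and there is no $n^{o(\log n)}$-time algorithm that approximates $\mathrm{Ldim}$ to within a factor $r$. (Algorithms are multi-stack Turing machines, and time is the worst-case number of steps.) -/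

import Mathlib

open Filter Asymptotics MeasureTheory

noncomputable section

/-! ### Running times -/

/-- `T` is `n ^ o(log n)`: eventually `T n ≤ n ^ (g n)` for some function `g` with
`g n = o(log n)`. -/
def IsPowLittleOLog (T : ℕ → ℕ) : Prop :=
  ∃ g : ℕ → ℝ, g =o[atTop] (fun n : ℕ => Real.log n) ∧
    ∀ᶠ n : ℕ in atTop, (T n : ℝ) ≤ (n : ℝ) ^ g n

/-! ### Concept classes, VC dimension and Littlestone's dimension

A concept `c : X → {0, 1}` is identified with the set of points `x` with `c x = 1`, and a finite
concept class on `X` is a `Finset (Finset X)`. Its VC dimension is Mathlib's `Finset.vcDim`. -/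

section Online

variable {X : Type*}

/-- A deterministic online learning algorithm: from the labelled samples seen so far (oldest first)
and the current point it predicts a label. -/
abbrev OnlineAlgorithm (X : Type*) : Type _ := List (X × Bool) → X → Bool

/-- The number of wrong predictions of `A` on the remaining samples `s`, when the samples in `past`
have already been revealed. -/
def OnlineAlgorithm.mistakesFrom (A : OnlineAlgorithm X) :
    (past : List (X × Bool)) → (s : List (X × Bool)) → ℕ
  | _, [] => 0
  | past, (x, y) :: s =>
      (if A past x = y then 0 else 1) + OnlineAlgorithm.mistakesFrom A (past ++ [(x, y)]) s

/-- The number of mistakes of `A` on the sequence `s`. -/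
def OnlineAlgorithm.mistakes (A : OnlineAlgorithm X) (s : List (X × Bool)) : ℕ :=
  A.mistakesFrom [] s

/-- The sequence `s` of labelled samples is realizable by `𝒞`. -/
def Realizable (𝒞 : Finset (Finset X)) (s : List (X × Bool)) : Prop :=
  ∃ c ∈ 𝒞, ∀ p ∈ s, (p.2 = true ↔ p.1 ∈ c)

/-- `A` makes at most `k` mistakes on every sequence of distinct points that is realizable
by `𝒞`. -/
def OnlineAlgorithm.MistakeBoundLE (A : OnlineAlgorithm X) (𝒞 : Finset (Finset X)) (k : ℕ) :
    Prop :=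
  ∀ s : List (X × Bool), (s.map Prod.fst).Nodup → Realizable 𝒞 s → A.mistakes s ≤ k

/-- Littlestone's dimension: the least mistake bound for `𝒞` over all online algorithms. -/
def littlestoneDim (𝒞 : Finset (Finset X)) : ℕ :=
  sInf {k : ℕ | ∃ A : OnlineAlgorithm X, A.MistakeBoundLE 𝒞 k}

end Online

/-! ### Encodings of inputs -/

/-- A binary matrix written row by row; every row is terminated by the separator `none`. -/
def encodeMatrix {m d : ℕ} (E : Fin m → Fin d → Bool) : List (Option Bool) :=
  (List.ofFn fun i => (List.ofFn fun j => some (E i j)) ++ [none]).flatten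

/-- A nonempty finite concept class given explicitly by the table of the values of its (pairwise
distinct) concepts: `val i x` is the value of the `i`-th concept at the point `x`. -/
structure ConceptMatrix where
  numConcepts : ℕ
  numPoints : ℕ
  val : Fin numConcepts → Fin numPoints → Bool
  numConcepts_pos : 0 < numConcepts
  val_injective : Function.Injective val

namespace ConceptMatrix

/-- The concept class that is given by a table. -/
def toClass (C : ConceptMatrix) : Finset (Finset (Fin C.numPoints)) :=
  Finset.univ.image fun i => Finset.univ.filter fun x => C.val i x = true

/-- The table as an input string, of length `numConcepts * (numPoints + 1)`. -/
def encode (C : ConceptMatrix) : List (Option Bool) :=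
  encodeMatrix C.val

/-- The VC dimension of the class given by a table. -/
def vcDim (C : ConceptMatrix) : ℕ := C.toClass.vcDim

/-- Littlestone's dimension of the class given by a table. -/
def ldim (C : ConceptMatrix) : ℕ := littlestoneDim C.toClass

end ConceptMatrix

/-! ### Deterministic approximation algorithms -/

/-- There is a deterministic (multi-stack Turing machine) algorithm that, given the table of a
concept class as an input of length `n`, halts within `n ^ o(log n)` steps and outputs, in binary,
a number between `OPT / r` and `OPT`, where `OPT` is the value of `opt` at the input. -/
def ApproximableInPowLittleOLog (opt : ConceptMatrix → ℕ) (r : ℝ) : Prop :=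
  ∃ (f : ConceptMatrix → ℕ)
    (M : Turing.TM2ComputableInTime ConceptMatrix.encode Computability.encodeNat f),
    IsPowLittleOLog M.time ∧
      ∀ C : ConceptMatrix, (opt C : ℝ) / r ≤ (f C : ℝ) ∧ (f C : ℝ) ≤ (opt C : ℝ)

/-! ### Randomized decision algorithms -/

/-- A probabilistic multi-stack Turing machine with input alphabet `α`. It has two programs, `m`
and `mHeads`; in every step a fair coin decides which of the two is applied. It accepts or rejects
according to its internal state when it halts. (The output stack `k₁` plays no special role.) -/
structure ProbTM2 (α : Type) extends Turing.FinTM2 where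
  /-- the program that is applied when the coin shows heads -/
  mHeads : Λ → Turing.TM2.Stmt Γ Λ σ
  /-- the symbols on the input stack are those of `α` -/
  inputAlphabet : Γ k₀ ≃ α
  /-- the accepting internal states -/
  accepting : Set σ

namespace ProbTM2

variable {α : Type} (M : ProbTM2 α)

/-- One step with the given result of the coin toss; a halted configuration does not change. -/
def coinStep (c : M.toFinTM2.Cfg) (heads : Bool) : M.toFinTM2.Cfg :=
  (Turing.TM2.step (if heads then M.mHeads else M.m) c).getD c

/-- The configuration reached from the input `w` after one step for each toss in `coins`. -/
def run (w : List α) (coins : List Bool) : M.toFinTM2.Cfg :=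
  coins.foldl M.coinStep (Turing.initList M.toFinTM2 (w.map M.inputAlphabet.symm))

/-- On input `w` the machine has halted after `t` steps, whatever the coins show. -/
def HaltsWithin (w : List α) (t : ℕ) : Prop :=
  ∀ coins : Fin t → Bool, (M.run w (List.ofFn coins)).l = none

/-- The probability, over `t` independent fair coin tosses, that on input `w` the machine has
halted in an accepting state after `t` steps. -/
def acceptProb (w : List α) (t : ℕ) : ℝ :=
  (Nat.card {coins : Fin t → Bool //
    (M.run w (List.ofFn coins)).l = none ∧ (M.run w (List.ofFn coins)).var ∈ M.accepting} : ℝ)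
    / 2 ^ t

end ProbTM2

/-! ### Planted cliques -/

/-- The graph obtained from `G` by making `S` a clique. -/
def plantClique {V : Type*} (G : SimpleGraph V) (S : Finset V) : SimpleGraph V :=
  G ⊔ SimpleGraph.fromRel fun u v => u ∈ S ∧ v ∈ S

/-- The distribution `G(V, p, κ)`: a sample of the binomial (Erdős–Rényi) random graph `G(V, p)`
in which a uniformly random set of `κ` vertices is made a clique. -/
def plantedRandom (V : Type*) [Fintype V] (p : unitInterval) (κ : ℕ) :
    Measure (SimpleGraph V) :=
  ((Finset.powersetCard κ (Finset.univ : Finset V)).card : ENNReal)⁻¹ •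
    ∑ S ∈ Finset.powersetCard κ (Finset.univ : Finset V),
      (SimpleGraph.binomialRandom V p).map fun G => plantClique G S

/-- The edge probability `1 / 2`. -/
def edgeHalf : unitInterval := ⟨1 / 2, by norm_num, by norm_num⟩

open scoped Classical in
/-- A graph as an input string: its adjacency matrix. -/
def encodeGraph {N : ℕ} (G : SimpleGraph (Fin N)) : List (Option Bool) :=
  encodeMatrix fun u v => decide (G.Adj u v)

/-- The Strongish Planted Clique Hypothesis: for some `δ ∈ (0, 1)`, no randomized
`N ^ o(log N)`-time algorithm (`N` is the number of vertices) accepts for all large `N` a sample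
of `G(N, 1/2, ⌈N ^ δ⌉)` with probability at least `2/3` and a sample of `G(N, 1/2)` with
probability at most `1/3`. The probabilities are over the sample and the coins. -/
def StrongishPlantedCliqueHypothesis : Prop :=
  ∃ δ : ℝ, 0 < δ ∧ δ < 1 ∧
    ¬ ∃ (M : ProbTM2 (Option Bool)) (T : ℕ → ℕ),
      IsPowLittleOLog T ∧
      (∀ (N : ℕ) (G : SimpleGraph (Fin N)), M.HaltsWithin (encodeGraph G) (T N)) ∧
      ∀ᶠ N : ℕ in atTop,
        2 / 3 ≤ ∫ G, M.acceptProb (encodeGraph G) (T N)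
          ∂(plantedRandom (Fin N) edgeHalf ⌈(N : ℝ) ^ δ⌉₊) ∧
        ∫ G, M.acceptProb (encodeGraph G) (T N)
          ∂(SimpleGraph.binomialRandom (Fin N) edgeHalf) ≤ 1 / 3

end

open Filter Asymptotics MeasureTheory

noncomputable section

/-! A graph on `N` vertices is turned into one concept class whose VC dimension is large if a clique
has been planted and whose Littlestone dimension is small if the graph is random. As VC is at most
Ldim (`vcDim_le_littlestoneDim`), every parameter between the two sees this gap, so both halves of
the theorem are instances of `not_approximable_of_le_of_le`.

The class. Let `L = codeLength N`, which is of order log N, and let `l` be a constant. The adjacency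
matrix is masked: row `v` has block number `v % (l + 1)` and label `v / (l + 1)`, column `u` has
block number `u / L % (l + 1)` and bit position `u % L`. If the two blocks agree, the entry survives
only if the label has a one at that position; if they differ, the mask changes nothing. The concepts
are the intersections of `l + 1` masked rows, one for each tuple. An identity matrix on additional
points makes them distinct and does not spoil either bound.

Planted graphs. Let `m` be about (δ/2) log₂ N. Suppose that the clique contains, below `N / 2`, a
vertex for each block and each bit position less than `m`, and, from `N / 2` on, a vertex for each
block and each label modulo `2 ^ m`. Then `(l + 1) * m` of the low vertices are shattered: intersect
the rows of one high vertex per block, each of which prescribes the pattern on its own block and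
leaves the other blocks alone (`le_vcDim_reductionClass`). With `Q = (l + 1) * N ^ (δ / 2)` there
are at most `2 * Q` residue classes to meet, each of density at least `1 / (4 * Q)`, so few sets of
`⌈N ^ δ⌉₊` vertices miss one of them (`card_missingSets_le`).

Random graphs. Usually there are no two sets of `a = L + 2` vertices that are completely joined.
Then any `a` points lie in at most `a ^ (l + 1)` concepts. A learner that predicts `false` while
many concepts are consistent and with the majority afterwards makes at most `a + (l + 1) * Nat.clog
2 a` mistakes (`cautiousHalving_mistakeBoundLE`, `ldim_reductionClass_le`), eventually at most `2 *
L`.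

The gap. If `l` exceeds `32 * r / δ`, then `(l + 1) * m` exceeds `2 * L * r`
(`eventually_goodParameters`), and comparing the approximate value with `2 * L` separates the two
cases. Since `l` is constant, the table has length polynomial in `N`, so that an `n ^ o(log n)`
bound in its length is an `N ^ o(log N)` bound (`isPowLittleOLog_reductionTime`).

The machine. The reduction and the final comparison are written as structured stack programs,
verified by Hoare triples with time bounds (`Exec`), compiled (`Runs.getsTo`) and put before and
after the given machine (`getsTo_sandwich`). The result ignores its coins. -/

/-! ### Structured stack programs and their compilation to multi-stack machines -/

/-- Structured programs over stacks named by `K` with alphabet `A` and registers in `R`. -/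
inductive StackProg (K A R : Type) : Type
  | pop (k : K) (f : R → Option A → R) : StackProg K A R
  | push (k : K) (f : R → A) : StackProg K A R
  | load (f : R → R) : StackProg K A R
  | seq (p q : StackProg K A R) : StackProg K A R
  | ite (b : R → Bool) (p q : StackProg K A R) : StackProg K A R
  | loop (b : R → Bool) (p : StackProg K A R) : StackProg K A R

namespace StackProg

variable {K A R : Type}

/-- `Runs p r s r' s' t`: started with registers `r` and stacks `s`, the program `p` ends with
registers `r'` and stacks `s'` after at most `t` steps. -/
inductive Runs [DecidableEq K] :
    StackProg K A R → R → (K → List A) → R → (K → List A) → ℕ → Prop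
  | pop (k : K) (f : R → Option A → R) (r : R) (s : K → List A) :
      Runs (.pop k f) r s (f r (s k).head?) (Function.update s k (s k).tail) 1
  | push (k : K) (f : R → A) (r : R) (s : K → List A) :
      Runs (.push k f) r s r (Function.update s k (f r :: s k)) 1
  | load (f : R → R) (r : R) (s : K → List A) : Runs (.load f) r s (f r) s 1
  | seq {p q : StackProg K A R} {r₁ r₂ r₃ : R} {s₁ s₂ s₃ : K → List A} {t u : ℕ} :
      Runs p r₁ s₁ r₂ s₂ t → Runs q r₂ s₂ r₃ s₃ u → Runs (.seq p q) r₁ s₁ r₃ s₃ (t + u)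
  | ite {b : R → Bool} {p q : StackProg K A R} {r₁ r₂ : R} {s₁ s₂ : K → List A} {t : ℕ} :
      Runs (bif b r₁ then p else q) r₁ s₁ r₂ s₂ t → Runs (.ite b p q) r₁ s₁ r₂ s₂ (t + 1)
  | loopDone {b : R → Bool} {p : StackProg K A R} {r : R} {s : K → List A} :
      b r = false → Runs (.loop b p) r s r s 1
  | loopStep {b : R → Bool} {p : StackProg K A R} {r₁ r₂ r₃ : R} {s₁ s₂ s₃ : K → List A}
      {t u : ℕ} : b r₁ = true → Runs p r₁ s₁ r₂ s₂ t → Runs (.loop b p) r₂ s₂ r₃ s₃ u →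
      Runs (.loop b p) r₁ s₁ r₃ s₃ (t + u + 1)
  | mono {p : StackProg K A R} {r₁ r₂ : R} {s₁ s₂ : K → List A} {t u : ℕ} :
      Runs p r₁ s₁ r₂ s₂ t → t ≤ u → Runs p r₁ s₁ r₂ s₂ u

/-- The program points of a program. -/
def Label : StackProg K A R → Type
  | .pop _ _ => Unit
  | .push _ _ => Unit
  | .load _ => Unit
  | .seq p q => p.Label ⊕ q.Label
  | .ite _ p q => Option (p.Label ⊕ q.Label)
  | .loop _ p => Option p.Label

instance finite_label : (p : StackProg K A R) → Finite p.Label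
  | .pop _ _ => inferInstanceAs (Finite Unit)
  | .push _ _ => inferInstanceAs (Finite Unit)
  | .load _ => inferInstanceAs (Finite Unit)
  | .seq p q =>
    have := finite_label p
    have := finite_label q
    inferInstanceAs (Finite (p.Label ⊕ q.Label))
  | .ite _ p q =>
    have := finite_label p
    have := finite_label q
    inferInstanceAs (Finite (Option (p.Label ⊕ q.Label)))
  | .loop _ p =>
    have := finite_label p
    inferInstanceAs (Finite (Option p.Label))

/-- The program point at which a program starts. -/
def entry : (p : StackProg K A R) → p.Label
  | .pop _ _ => ()
  | .push _ _ => ()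
  | .load _ => ()
  | .seq p _ => Sum.inl p.entry
  | .ite _ _ _ => none
  | .loop _ _ => none

section Compile

variable {K' Λ σ : Type} {G : K' → Type}

/-- The alphabets of the stacks of a program together with further stacks. -/
abbrev JoinAlphabet (A : Type) (K : Type) (G : K' → Type) : K ⊕ K' → Type :=
  Sum.elim (fun _ => A) G

/-- The stacks of a program together with further stacks. -/
def joinStk (s : K → List A) (g : ∀ k, List (G k)) : ∀ k, List (JoinAlphabet A K G k)
  | .inl k => s k
  | .inr k => g k

@[simp]
theorem joinStk_inl (s : K → List A) (g : ∀ k, List (G k)) (k : K) :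
    joinStk s g (.inl k) = s k := rfl

@[simp]
theorem joinStk_inr (s : K → List A) (g : ∀ k, List (G k)) (k : K') :
    joinStk s g (.inr k) = g k := rfl

theorem update_joinStk_inl [DecidableEq K] [DecidableEq K'] (s : K → List A)
    (g : ∀ k, List (G k)) (k : K) (x : List A) :
    Function.update (joinStk s g) (.inl k) x = joinStk (Function.update s k x) g := by
  funext j
  rcases j with j | j
  · by_cases h : j = k
    · subst h
      exact (Function.update_self ..).trans (Function.update_self (β := fun _ => List A) ..).symm
    · exact (Function.update_of_ne (by simpa using h) ..).trans
        (Function.update_of_ne (β := fun _ => List A) h ..).symm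
  · exact Function.update_of_ne (by simp) ..

theorem update_joinStk_inr [DecidableEq K] [DecidableEq K'] (s : K → List A)
    (g : ∀ k, List (G k)) (k : K') (x : List (G k)) :
    Function.update (joinStk s g) (.inr k) x = joinStk s (Function.update g k x) := by
  funext j
  rcases j with j | j
  · exact Function.update_of_ne (by simp) ..
  · by_cases h : j = k
    · subst h
      exact (Function.update_self ..).trans
        (Function.update_self (β := fun k => List (G k)) ..).symm
    · exact (Function.update_of_ne (by simpa using h) ..).trans
        (Function.update_of_ne (β := fun k => List (G k)) h ..).symm

variable (G σ) in
/-- The machine code of a program, with labels embedded by `emb`, that continues at `exit`. -/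
def code : (p : StackProg K A R) → (emb : p.Label → Λ) → (exit : Λ) → p.Label →
    Turing.TM2.Stmt (JoinAlphabet A K G) Λ (R × σ)
  | .pop k f, _, exit, _ =>
      .pop (.inl k) (fun v x => (f v.1 x, v.2)) (.goto fun _ => exit)
  | .push k f, _, exit, _ => .push (.inl k) (fun v => f v.1) (.goto fun _ => exit)
  | .load f, _, exit, _ => .load (fun v => (f v.1, v.2)) (.goto fun _ => exit)
  | .seq p q, emb, exit, l => match l with
    | .inl l => p.code (fun l => emb (.inl l)) (emb (.inr q.entry)) l
    | .inr l => q.code (fun l => emb (.inr l)) exit l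
  | .ite b p q, emb, exit, l => match l with
    | none => .branch (fun v => b v.1) (.goto fun _ => emb (some (.inl p.entry)))
        (.goto fun _ => emb (some (.inr q.entry)))
    | some (.inl l) => p.code (fun l => emb (some (.inl l))) exit l
    | some (.inr l) => q.code (fun l => emb (some (.inr l))) exit l
  | .loop b p, emb, exit, l => match l with
    | none => .branch (fun v => b v.1) (.goto fun _ => emb (some p.entry)) (.goto fun _ => exit)
    | some l => p.code (fun l => emb (some l)) (emb none) l

end Compile

end StackProg

/-- One step of a multi-stack machine; a halted configuration does not change. -/
def Turing.TM2.stayStep {K : Type} [DecidableEq K] {Γ : K → Type} {Λ σ : Type}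
    (m : Λ → Turing.TM2.Stmt Γ Λ σ) (c : Turing.TM2.Cfg Γ Λ σ) : Turing.TM2.Cfg Γ Λ σ :=
  (Turing.TM2.step m c).getD c

/-- `m` gets from `c` to `c'` within `t` steps. -/
def Turing.TM2.GetsTo {K : Type} [DecidableEq K] {Γ : K → Type} {Λ σ : Type}
    (m : Λ → Turing.TM2.Stmt Γ Λ σ) (c c' : Turing.TM2.Cfg Γ Λ σ) (t : ℕ) : Prop :=
  ∃ n ≤ t, (Turing.TM2.stayStep m)^[n] c = c'

namespace Turing.TM2

variable {K : Type} [DecidableEq K] {Γ : K → Type} {Λ σ : Type}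
  {m : Λ → Turing.TM2.Stmt Γ Λ σ} {c c' c'' : Turing.TM2.Cfg Γ Λ σ} {t u : ℕ}

theorem GetsTo.trans (h : GetsTo m c c' t) (h' : GetsTo m c' c'' u) :
    GetsTo m c c'' (t + u) := by
  obtain ⟨n, hn, rfl⟩ := h
  obtain ⟨n', hn', rfl⟩ := h'
  exact ⟨n' + n, by omega, by rw [Function.iterate_add_apply]⟩

theorem GetsTo.mono (h : GetsTo m c c' t) (htu : t ≤ u) : GetsTo m c c' u := by
  obtain ⟨n, hn, rfl⟩ := h
  exact ⟨n, by omega, rfl⟩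

theorem GetsTo.single (h : stayStep m c = c') : GetsTo m c c' 1 := ⟨1, le_rfl, h⟩

theorem GetsTo.head (h : stayStep m c = c') (h' : GetsTo m c' c'' t) :
    GetsTo m c c'' (t + 1) := by
  rw [add_comm]; exact (GetsTo.single h).trans h'

theorem stayStep_iterate_halted (hc : c.l = none) (n : ℕ) : (stayStep m)^[n] c = c := by
  apply Function.iterate_fixed
  obtain ⟨l, v, s⟩ := c
  simp only at hc
  subst hc
  rfl

/-- A halted configuration is a fixed point, so an upper bound on the running time determines the
configuration after any larger number of steps. This is what permits running for exactly as many
steps as there are coins. -/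
theorem GetsTo.iterate_eq (h : GetsTo m c c' t) (hc : c'.l = none) (htu : t ≤ u) :
    (stayStep m)^[u] c = c' := by
  obtain ⟨n, hn, rfl⟩ := h
  obtain ⟨d, rfl⟩ := Nat.exists_eq_add_of_le (hn.trans htu)
  rw [add_comm, Function.iterate_add_apply, stayStep_iterate_halted hc]

@[simp]
theorem stayStep_some (l : Λ) (v : σ) (s : ∀ k, List (Γ k)) :
    stayStep m ⟨some l, v, s⟩ = stepAux (m l) v s := rfl

end Turing.TM2

namespace StackProg

open Turing.TM2

variable {K A R : Type} {K' Λ σ : Type} {G : K' → Type} [DecidableEq K] [DecidableEq K']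

/-- Correctness of the compiler, by induction on the run. The exit label varies because a subprogram
continues at its successor or at the loop head; the foreign state `v` and the foreign stacks `g` are
never touched. -/
theorem Runs.getsTo {p : StackProg K A R} {r r' : R} {s s' : K → List A} {t : ℕ}
    (h : Runs p r s r' s' t)
    {m : Λ → Turing.TM2.Stmt (JoinAlphabet A K G) Λ (R × σ)} {emb : p.Label → Λ} {exit : Λ}
    (hm : ∀ l, m (emb l) = code σ G p emb exit l) (v : σ) (g : ∀ k, List (G k)) :
    GetsTo m ⟨some (emb p.entry), (r, v), joinStk s g⟩ ⟨some exit, (r', v), joinStk s' g⟩ t := by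
  induction h generalizing exit with
  | pop k f r s =>
    apply GetsTo.single
    rw [stayStep_some, hm]
    simp only [code, stepAux, joinStk_inl]
    exact congrArg (Cfg.mk _ _) (update_joinStk_inl ..)
  | push k f r s =>
    apply GetsTo.single
    rw [stayStep_some, hm]
    simp only [code, stepAux, joinStk_inl]
    exact congrArg (Cfg.mk _ _) (update_joinStk_inl ..)
  | load f r s =>
    apply GetsTo.single
    rw [stayStep_some, hm]
    simp only [code, stepAux]
  | seq _ _ ih₁ ih₂ =>
    exact (ih₁ (emb := fun l => emb (.inl l)) fun l => hm (.inl l)).trans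
      (ih₂ (emb := fun l => emb (.inr l)) fun l => hm (.inr l))
  | @ite b p q r₁ r₂ s₁ s₂ t _ ih =>
    have h0 := hm none
    rcases hb : b r₁ with _ | _
    · rw [hb] at ih
      refine GetsTo.head (c' := ⟨some (emb (some (.inr q.entry))), (r₁, v), joinStk s₁ g⟩) ?_
        (ih (emb := fun l => emb (some (.inr l))) fun l => hm (some (.inr l)))
      change stayStep m ⟨some (emb none), _, _⟩ = _
      rw [stayStep_some, h0]
      simp [code, hb]
    · rw [hb] at ih
      refine GetsTo.head (c' := ⟨some (emb (some (.inl p.entry))), (r₁, v), joinStk s₁ g⟩) ?_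
        (ih (emb := fun l => emb (some (.inl l))) fun l => hm (some (.inl l)))
      change stayStep m ⟨some (emb none), _, _⟩ = _
      rw [stayStep_some, h0]
      simp [code, hb]
  | @loopDone b p r s hb =>
    have h0 := hm none
    apply GetsTo.single
    change stayStep m ⟨some (emb none), _, _⟩ = _
    rw [stayStep_some, h0]
    simp [code, hb]
  | @loopStep b p r₁ r₂ r₃ s₁ s₂ s₃ t u hb _ _ ih₁ ih₂ =>
    have h0 := hm none
    -- The body exits to the loop head `emb none`, which is the entry of the loop; there the
    -- induction hypothesis for the remaining iterations takes over.
    refine GetsTo.head (c' := ⟨some (emb (some p.entry)), (r₁, v), joinStk s₁ g⟩) ?_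
      ((ih₁ (emb := fun l => emb (some l)) (exit := emb none) fun l => hm (some l)).trans
        (ih₂ (emb := emb) hm))
    change stayStep m ⟨some (emb none), _, _⟩ = _
    rw [stayStep_some, h0]
    simp [code, hb]
  | mono _ htu ih => exact (ih hm).mono htu

end StackProg

/-! ### Running a given machine between two programs -/

/-- The registers of the programs below. -/
structure Registers (l : ℕ) where
  /-- the symbol that was popped last -/
  cur : Option (Option Bool)
  /-- a second symbol -/
  tmp : Option (Option Bool)
  /-- a counter for columns -/
  ju : Fin (l + 1)
  /-- a counter for rows -/
  jv : Fin (l + 1)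
  /-- a truth value -/
  flag : Bool

instance (l : ℕ) : Finite (Registers l) :=
  Finite.of_injective (fun r : Registers l => (r.cur, r.tmp, r.ju, r.jv, r.flag)) <| by
    rintro ⟨_, _, _, _, _⟩ ⟨_, _, _, _, _⟩ h
    simp_all

/-- The names of the stacks of the programs below. -/
inductive StackName
  | I | J | C | D | Z | B | T | R | S
  deriving DecidableEq

instance : Fintype StackName :=
  ⟨{.I, .J, .C, .D, .Z, .B, .T, .R, .S}, by intro k; cases k <;> decide⟩

/-- The contents of the stacks of the programs below. -/
structure Stacks where
  I : List (Option Bool)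
  J : List (Option Bool)
  C : List (Option Bool)
  D : List (Option Bool)
  Z : List (Option Bool)
  B : List (Option Bool)
  T : List (Option Bool)
  R : List (Option Bool)
  S : List (Option Bool)

namespace Stacks

/-- The content of a stack. -/
def get (s : Stacks) : StackName → List (Option Bool)
  | .I => s.I | .J => s.J | .C => s.C | .D => s.D | .Z => s.Z
  | .B => s.B | .T => s.T | .R => s.R | .S => s.S

/-- Replace the content of a stack. -/
def set (s : Stacks) (k : StackName) (x : List (Option Bool)) : Stacks :=
  match k with
  | .I => { s with I := x } | .J => { s with J := x } | .C => { s with C := x }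
  | .D => { s with D := x } | .Z => { s with Z := x } | .B => { s with B := x }
  | .T => { s with T := x } | .R => { s with R := x } | .S => { s with S := x }

theorem update_get (s : Stacks) (k : StackName) (x : List (Option Bool)) :
    Function.update s.get k x = (s.set k x).get := by
  funext j
  cases k <;> cases j <;> rfl

@[simp]
theorem get_set_self (s : Stacks) (k : StackName) (x : List (Option Bool)) :
    (s.set k x).get k = x := by
  cases k <;> rfl

theorem get_set_of_ne (s : Stacks) {j k : StackName} (h : j ≠ k) (x : List (Option Bool)) :
    (s.set k x).get j = s.get j := by
  cases k <;> cases j <;> first | rfl | exact absurd rfl h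

@[simp]
theorem set_set_self (s : Stacks) (k : StackName) (x y : List (Option Bool)) :
    (s.set k x).set k y = s.set k y := by
  cases k <;> rfl

theorem set_set_comm (s : Stacks) {j k : StackName} (h : j ≠ k) (x y : List (Option Bool)) :
    (s.set k x).set j y = (s.set j y).set k x := by
  cases k <;> cases j <;> first | rfl | exact absurd rfl h

theorem set_get_self (s : Stacks) (k : StackName) : s.set k (s.get k) = s := by
  cases k <;> rfl

end Stacks

/-- The programs below. -/
abbrev Prg (l : ℕ) : Type := StackProg StackName (Option Bool) (Registers l)

open StackProg Turing.TM2

namespace Turing.FinTM2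

variable {l : ℕ} (M : Turing.FinTM2) (P Q : Prg l)
  (toM : Option Bool → M.Γ M.k₀) (ofM : M.Γ M.k₁ → Option Bool)

/-- The labels of the machine `sandwich`. -/
abbrev SandwichLabel : Type := Fin 4 ⊕ P.Label ⊕ M.Λ ⊕ Q.Label

/-- The statement of `M` as a statement of `sandwich`, with halting replaced by a jump. -/
def liftStmt : Turing.TM2.Stmt M.Γ M.Λ M.σ →
    Turing.TM2.Stmt (JoinAlphabet (Option Bool) StackName M.Γ) (M.SandwichLabel P Q)
      (Registers l × M.σ)
  | .push k f q => .push (.inr k) (fun v => f v.2) (liftStmt q)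
  | .peek k f q => .peek (.inr k) (fun v x => (v.1, f v.2 x)) (liftStmt q)
  | .pop k f q => .pop (.inr k) (fun v x => (v.1, f v.2 x)) (liftStmt q)
  | .load f q => .load (fun v => (v.1, f v.2)) (liftStmt q)
  | .branch f q₁ q₂ => .branch (fun v => f v.2) (liftStmt q₁) (liftStmt q₂)
  | .goto f => .goto fun v => .inr (.inr (.inl (f v.2)))
  | .halt => .goto fun _ => .inl 2

/-- Unless the input is empty, run `P`, move the stack `J` to the input stack of `M`, run `M`,
move its output to the stack `J`, and run `Q`. -/
def sandwichCode : M.SandwichLabel P Q →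
    Turing.TM2.Stmt (JoinAlphabet (Option Bool) StackName M.Γ) (M.SandwichLabel P Q)
      (Registers l × M.σ)
  | .inl 0 => .peek (.inl .I) (fun v x => ({ v.1 with cur := x }, v.2))
      (.branch (fun v => v.1.cur.isSome) (.goto fun _ => .inr (.inl P.entry)) .halt)
  | .inl 1 => .pop (.inl .J) (fun v x => ({ v.1 with cur := x }, v.2))
      (.branch (fun v => v.1.cur.isSome)
        (.push (.inr M.k₀) (fun v => toM (v.1.cur.getD none)) (.goto fun _ => .inl 1))
        (.goto fun _ => .inr (.inr (.inl M.main))))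
  | .inl 2 => .pop (.inr M.k₁) (fun v x => ({ v.1 with cur := x.map ofM }, v.2))
      (.branch (fun v => v.1.cur.isSome)
        (.push (.inl .J) (fun v => v.1.cur.getD none) (.goto fun _ => .inl 2))
        (.goto fun _ => .inr (.inr (.inr Q.entry))))
  | .inl 3 => .halt
  | .inr (.inl l) => code M.σ M.Γ P (fun l => .inr (.inl l)) (.inl 1) l
  | .inr (.inr (.inl l)) => M.liftStmt P Q (M.m l)
  | .inr (.inr (.inr l)) => code M.σ M.Γ Q (fun l => .inr (.inr (.inr l))) (.inl 3) l

/-- The configuration of `M` as a configuration of the machine `sandwich`. -/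
def liftCfg (r : Registers l) (s : StackName → List (Option Bool))
    (c : Turing.TM2.Cfg M.Γ M.Λ M.σ) :
    Turing.TM2.Cfg (JoinAlphabet (Option Bool) StackName M.Γ) (M.SandwichLabel P Q)
      (Registers l × M.σ) :=
  ⟨some (match c.l with | some l => .inr (.inr (.inl l)) | none => .inl 2),
    (r, c.var), joinStk s c.stk⟩

/-- The simulation is step for step: halting becomes a jump to the label `.inl 2`, and this is the
label that `liftCfg` assigns to a halted configuration. -/
theorem stepAux_liftStmt (r : Registers l) (s : StackName → List (Option Bool))
    (q : Turing.TM2.Stmt M.Γ M.Λ M.σ) (v : M.σ) (g : ∀ k, List (M.Γ k)) :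
    stepAux (M.liftStmt P Q q) (r, v) (joinStk s g) =
      M.liftCfg P Q r s (stepAux q v g) := by
  induction q generalizing v g with
  | push k f q ih =>
    simp only [liftStmt, stepAux, joinStk_inr]
    rw [← ih]
    congr 1
    exact update_joinStk_inr ..
  | peek k f q ih => exact ih ..
  | pop k f q ih =>
    simp only [liftStmt, stepAux, joinStk_inr]
    rw [← ih]
    congr 1
    exact update_joinStk_inr ..
  | load f q ih =>
    simp only [liftStmt, stepAux]
    rw [← ih]
  | branch f q₁ q₂ ih₁ ih₂ =>
    simp only [liftStmt, stepAux]
    cases f v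
    · exact ih₂ ..
    · exact ih₁ ..
  | goto f => rfl
  | halt => rfl

theorem iterate_liftCfg (r : Registers l) (s : StackName → List (Option Bool)) (n : ℕ)
    (c c' : M.Cfg) (h : (flip Bind.bind M.step)^[n] (some c) = some c') :
    (stayStep (M.sandwichCode P Q toM ofM))^[n] (M.liftCfg P Q r s c) =
      M.liftCfg P Q r s c' := by
  induction n generalizing c with
  | zero =>
    simp only [Function.iterate_zero, id] at h ⊢
    rw [Option.some.inj h]
  | succ n ih =>
    rw [Function.iterate_succ_apply] at h ⊢
    obtain ⟨lab, v, g⟩ := c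
    rcases lab with _ | lab
    -- A step from a halted configuration gives `none`, which persists; as `h` ends in `some`, the
    -- machine cannot halt early.
    · exfalso
      have h0 : flip Bind.bind M.step (some (⟨none, v, g⟩ : M.Cfg)) = none := rfl
      rw [h0] at h
      have h1 : ∀ n, (flip Bind.bind M.step)^[n] none = (none : Option M.Cfg) := fun n =>
        Function.iterate_fixed rfl n
      rw [h1] at h
      cases h
    · rw [← ih (stepAux (M.m lab) v g) h, ← stepAux_liftStmt]
      rfl

theorem getsTo_of_evalsTo (r : Registers l) (s : StackName → List (Option Bool))
    {c c' : M.Cfg} {t : ℕ} (h : StateTransition.EvalsToInTime M.step c (some c') t) :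
    GetsTo (M.sandwichCode P Q toM ofM) (M.liftCfg P Q r s c) (M.liftCfg P Q r s c') t :=
  ⟨h.steps, h.steps_le_m, M.iterate_liftCfg P Q toM ofM r s _ _ _ h.evals_in_steps⟩

theorem initList_stk (x : List (M.Γ M.k₀)) :
    (Turing.initList M x).stk = Function.update (fun _ => []) M.k₀ x := by
  funext k
  by_cases h : k = M.k₀
  · subst h
    simp [Turing.initList]
  · simp [Turing.initList, h]

theorem haltList_stk (x : List (M.Γ M.k₁)) :
    (Turing.haltList M x).stk = Function.update (fun _ => []) M.k₁ x := by
  funext k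
  by_cases h : k = M.k₁
  · subst h
    simp [Turing.haltList]
  · simp [Turing.haltList, h]

/-- Moving a stack symbol by symbol reverses it. This is why the first program has to leave its
result reversed on `J`, and why the output of `M` arrives reversed there. -/
theorem getsTo_fill (r : Registers l) (v : M.σ) (x : List (Option Bool)) (s : Stacks)
    (hs : s.J = x) (y : List (M.Γ M.k₀)) :
    GetsTo (M.sandwichCode P Q toM ofM)
      ⟨some (.inl 1), (r, v), joinStk s.get (Function.update (fun _ => []) M.k₀ y)⟩
      ⟨some (.inr (.inr (.inl M.main))), ({ r with cur := none }, v),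
        joinStk (s.set .J []).get
          (Function.update (fun _ => []) M.k₀ ((x.map toM).reverse ++ y))⟩
      (x.length + 1) := by
  obtain ⟨I, J, C, D, Z, B, T, R, S⟩ := s
  simp only at hs
  subst hs
  induction J generalizing r y with
  | nil =>
    apply GetsTo.single
    refine congrArg (Cfg.mk _ _) ((update_joinStk_inl ..).trans ?_)
    exact congrArg (fun z => joinStk z _) (Stacks.update_get _ .J [])
  | cons a x ih =>
    refine (GetsTo.head ?_ (ih { r with cur := some a } (toM a :: y))).mono ?_ |>.trans
      (u := 0) ⟨0, le_rfl, ?_⟩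
    · refine congrArg (Cfg.mk _ _) ?_
      have h2 := update_joinStk_inl (Stacks.get ⟨I, a :: x, C, D, Z, B, T, R, S⟩)
        (Function.update (fun _ => []) M.k₀ y) .J x
      refine (congrArg (fun z => Function.update z (Sum.inr M.k₀)
        (toM a :: z (Sum.inr M.k₀))) h2).trans ?_
      refine (update_joinStk_inr ..).trans ?_
      rw [Stacks.update_get, joinStk_inr, Function.update_self, Function.update_idem]
      rfl
    · simp
    · simp [Stacks.set]

theorem getsTo_drain (r : Registers l) (v : M.σ) (x : List (M.Γ M.k₁)) (s : Stacks) :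
    GetsTo (M.sandwichCode P Q toM ofM)
      ⟨some (.inl 2), (r, v), joinStk s.get (Function.update (fun _ => []) M.k₁ x)⟩
      ⟨some (.inr (.inr (.inr Q.entry))), ({ r with cur := none }, v),
        joinStk (s.set .J ((x.map ofM).reverse ++ s.J)).get (fun _ => [])⟩
      (x.length + 1) := by
  induction x generalizing r s with
  | nil =>
    apply GetsTo.single
    have h1 : Function.update (fun _ => []) M.k₁ ([] : List (M.Γ M.k₁)) = fun _ => [] :=
      Function.update_eq_self ..
    rw [h1]
    refine congrArg (Cfg.mk _ _) ((update_joinStk_inr ..).trans ?_)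
    exact congrArg (joinStk _) h1
  | cons a x ih =>
    refine (GetsTo.head ?_ (ih { r with cur := some (ofM a) } (s.set .J (ofM a :: s.J)))).mono ?_
      |>.trans (u := 0) ⟨0, le_rfl, ?_⟩
    · have h1 : (Function.update (fun _ => []) M.k₁ (a :: x) : ∀ k, List (M.Γ k)) M.k₁ = a :: x :=
        Function.update_self ..
      generalize hg : (Function.update (fun _ => []) M.k₁ (a :: x) : ∀ k, List (M.Γ k)) = g at h1
      have h3 : Function.update g M.k₁ x = Function.update (fun _ => []) M.k₁ x := by
        rw [← hg, Function.update_idem]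
      have h2 := update_joinStk_inr s.get g M.k₁ x
      refine (stayStep_some ..).trans ?_
      have h4 : joinStk (A := Option Bool) s.get g (.inr M.k₁) = a :: x := h1
      simp only [sandwichCode, stepAux]
      rw [h4]
      refine congrArg (Cfg.mk _ _) ?_
      refine (congrArg (fun z => Function.update z (Sum.inl StackName.J)
        (ofM a :: z (Sum.inl StackName.J))) h2).trans ?_
      refine (update_joinStk_inl ..).trans ?_
      rw [Stacks.update_get, h3]
      rfl
    · simp
    · simp [Stacks.set]

instance : Fintype P.Label := Fintype.ofFinite _
instance (l : ℕ) : Fintype (Registers l) := Fintype.ofFinite _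

/-- The initial registers. -/
def Registers.init (l : ℕ) : Registers l := ⟨none, none, 0, 0, false⟩

/-- The initial stacks. -/
def Stacks.init (w : List (Option Bool)) : Stacks := ⟨w, [], [], [], [], [], [], [], []⟩

instance (M : FinTM2) : Fintype M.Λ := M.ΛFin
instance (M : FinTM2) : Fintype M.σ := M.σFin
instance (M : FinTM2) : Fintype M.K := M.kFin

/-- The machine with program `sandwichCode`, as a probabilistic machine that ignores its coins and
accepts if the register `flag` is set. -/
def sandwich : ProbTM2 (Option Bool) where
  K := StackName ⊕ M.K
  k₀ := .inl .I
  k₁ := .inl .J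
  Γ := JoinAlphabet (Option Bool) StackName M.Γ
  Λ := M.SandwichLabel P Q
  main := .inl 0
  σ := Registers l × M.σ
  initialState := (Registers.init l, M.initialState)
  Γk₀Fin := inferInstanceAs (Fintype (Option Bool))
  m := M.sandwichCode P Q toM ofM
  mHeads := M.sandwichCode P Q toM ofM
  inputAlphabet := Equiv.refl _
  accepting := {v | v.1.flag = true}

theorem sandwich_initList (w : List (Option Bool)) :
    Turing.initList (M.sandwich P Q toM ofM).toFinTM2
      (w.map (M.sandwich P Q toM ofM).inputAlphabet.symm) =
    ⟨some (.inl 0), (Registers.init l, M.initialState),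
      joinStk (Stacks.init w).get (fun _ => [])⟩ := by
  have hw : w.map (M.sandwich P Q toM ofM).inputAlphabet.symm = w := List.map_id w
  rw [hw]
  have : (Turing.initList (M.sandwich P Q toM ofM).toFinTM2 w).stk =
      joinStk (Stacks.init w).get (fun _ => []) := by
    refine (initList_stk _ _).trans ?_
    funext k
    rcases k with k | k
    · cases k <;> rfl
    · rfl
  exact congrArg (Cfg.mk _ _) this

/-- Both programs of the machine are the same, so only the number of coins matters. -/
theorem sandwich_run (w : List (Option Bool)) (coins : List Bool) :
    (M.sandwich P Q toM ofM).run w coins =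
      (stayStep (M.sandwichCode P Q toM ofM))^[coins.length]
        ⟨some (.inl 0), (Registers.init l, M.initialState),
          joinStk (Stacks.init w).get (fun _ => [])⟩ := by
  unfold ProbTM2.run
  rw [sandwich_initList]
  have key : ∀ c, coins.foldl (M.sandwich P Q toM ofM).coinStep c =
      (stayStep (M.sandwichCode P Q toM ofM))^[coins.length] c := by
    induction coins with
    | nil => exact fun _ => rfl
    | cons b coins ih =>
      intro c
      refine (ih _).trans ?_
      refine Eq.trans ?_ (Function.iterate_succ_apply ..).symm
      cases b <;> rfl
  exact key _

theorem getsTo_sandwich_nil :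
    ∃ c, c.l = none ∧ GetsTo (M.sandwichCode P Q toM ofM)
        ⟨some (.inl 0), (Registers.init l, M.initialState),
          joinStk (Stacks.init []).get (fun _ => [])⟩ c 1 :=
  ⟨_, by
    rw [stayStep_some]
    rfl, GetsTo.single rfl⟩

/-- The five phases are chained: first program, transfer, `M`, transfer, second program. The summand
`2` pays for the initial test of the input and the final halt. -/
theorem getsTo_sandwich {w : List (Option Bool)} (hw : w ≠ []) {r₁ r₂ : Registers l}
    {s₁ s₂ : Stacks} {x : List (Option Bool)} {y : List (M.Γ M.k₁)} {t₁ t₂ t₃ : ℕ}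
    (h₁ : Runs P { Registers.init l with cur := w.head? } (Stacks.init w).get r₁ s₁.get t₁)
    (hx : s₁.J = x.reverse)
    (h₂ : StateTransition.EvalsToInTime M.step (Turing.initList M (x.map toM))
      (some (Turing.haltList M y)) t₂)
    (h₃ : Runs Q { r₁ with cur := none } (s₁.set .J (y.map ofM).reverse).get r₂ s₂.get t₃) :
    GetsTo (M.sandwichCode P Q toM ofM)
        ⟨some (.inl 0), (Registers.init l, M.initialState),
          joinStk (Stacks.init w).get (fun _ => [])⟩
        ⟨none, (r₂, M.initialState), joinStk s₂.get (fun _ => [])⟩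
        (t₁ + (x.length + 1) + t₂ + (y.length + 1) + t₃ + 2) := by
  obtain ⟨a, w', rfl⟩ := List.exists_cons_of_ne_nil hw
  have e1 := h₁.getsTo (m := M.sandwichCode P Q toM ofM) (emb := fun l => .inr (.inl l))
    (exit := .inl 1) (fun _ => rfl) M.initialState (fun _ => [])
  have e2 := M.getsTo_fill P Q toM ofM r₁ M.initialState _ s₁ hx []
  have e3 := M.getsTo_of_evalsTo P Q toM ofM { r₁ with cur := none } (s₁.set .J []).get h₂
  have e4 := M.getsTo_drain P Q toM ofM { r₁ with cur := none } M.initialState y (s₁.set .J [])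
  have e5 := h₃.getsTo (m := M.sandwichCode P Q toM ofM)
    (emb := fun l => .inr (.inr (.inr l)))
    (exit := .inl 3) (fun _ => rfl) M.initialState (fun _ => [])
  unfold liftCfg at e3
  rw [initList_stk, haltList_stk] at e3
  have e6 : GetsTo (M.sandwichCode P Q toM ofM)
      ⟨some (.inl 3), (r₂, M.initialState), joinStk s₂.get (fun _ => [])⟩
      ⟨none, (r₂, M.initialState), joinStk s₂.get (fun _ => [])⟩ 1 := GetsTo.single rfl
  have e0 : GetsTo (M.sandwichCode P Q toM ofM)
      ⟨some (.inl 0), (Registers.init l, M.initialState),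
          joinStk (Stacks.init (a :: w')).get (fun _ => [])⟩
      ⟨some (.inr (.inl P.entry)), ({ Registers.init l with cur := some a }, M.initialState),
          joinStk (Stacks.init (a :: w')).get (fun _ => [])⟩ 1 := GetsTo.single rfl
  have hup : Function.update (fun _ => []) M.k₀ ([] : List (M.Γ M.k₀)) = fun _ => [] :=
    Function.update_eq_self ..
  rw [hup, List.append_nil, ← List.map_reverse, List.reverse_reverse] at e2
  have hJ : (s₁.set .J []).J = [] := rfl
  rw [hJ, List.append_nil, Stacks.set_set_self] at e4
  refine ((e0.trans <| e1.trans <| e2.trans <| e3.trans <| e4.trans <| e5.trans e6)).mono ?_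
  rw [List.length_reverse]
  omega

end Turing.FinTM2

/-! ### Basic programs -/

open StackProg

namespace StackProg

variable {l : ℕ}

/-- Started with registers `r` and stacks `s`, the program `p` ends within `t` steps in a state
that satisfies `Q`. -/
def Exec (p : Prg l) (r : Registers l) (s : Stacks) (t : ℕ)
    (Q : Registers l → Stacks → Prop) : Prop :=
  ∃ r' s', Runs p r s.get r' s'.get t ∧ Q r' s'

namespace Exec

variable {p q : Prg l} {r : Registers l} {s : Stacks} {t u : ℕ}
  {Q Q' : Registers l → Stacks → Prop}

theorem conseq (h : Exec p r s t Q) (htu : t ≤ u) (hQ : ∀ r s, Q r s → Q' r s) :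
    Exec p r s u Q' := by
  obtain ⟨r', s', h, hq⟩ := h
  exact ⟨r', s', h.mono htu, hQ _ _ hq⟩

theorem mono (h : Exec p r s t Q) (htu : t ≤ u) : Exec p r s u Q :=
  h.conseq htu fun _ _ h => h

theorem pop {k : StackName} {f : Registers l → Option (Option Bool) → Registers l}
    (h : Q (f r (s.get k).head?) (s.set k (s.get k).tail)) : Exec (.pop k f) r s 1 Q := by
  refine ⟨_, _, ?_, h⟩
  rw [← Stacks.update_get]
  exact Runs.pop k f r s.get

theorem push {k : StackName} {f : Registers l → Option Bool}
    (h : Q r (s.set k (f r :: s.get k))) : Exec (.push k f) r s 1 Q := by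
  refine ⟨_, _, ?_, h⟩
  rw [← Stacks.update_get]
  exact Runs.push k f r s.get

theorem load {f : Registers l → Registers l} (h : Q (f r) s) : Exec (.load f) r s 1 Q :=
  ⟨_, _, Runs.load f r s.get, h⟩

theorem seq (h : Exec p r s t Q') (h' : ∀ r s, Q' r s → Exec q r s u Q) :
    Exec (.seq p q) r s (t + u) Q := by
  obtain ⟨r', s', h, hq⟩ := h
  obtain ⟨r'', s'', h'', hq'⟩ := h' r' s' hq
  exact ⟨r'', s'', Runs.seq h h'', hq'⟩

theorem pop_seq {k : StackName} {f : Registers l → Option (Option Bool) → Registers l}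
    (h : Exec q (f r (s.get k).head?) (s.set k (s.get k).tail) u Q) :
    Exec (.seq (.pop k f) q) r s (1 + u) Q :=
  seq (Q' := fun r' s' => r' = f r (s.get k).head? ∧ s' = s.set k (s.get k).tail)
    (pop ⟨rfl, rfl⟩) (by rintro _ _ ⟨rfl, rfl⟩; exact h)

theorem push_seq {k : StackName} {f : Registers l → Option Bool}
    (h : Exec q r (s.set k (f r :: s.get k)) u Q) : Exec (.seq (.push k f) q) r s (1 + u) Q :=
  seq (Q' := fun r' s' => r' = r ∧ s' = s.set k (f r :: s.get k))
    (push ⟨rfl, rfl⟩) (by rintro _ _ ⟨rfl, rfl⟩; exact h)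

theorem load_seq {f : Registers l → Registers l} (h : Exec q (f r) s u Q) :
    Exec (.seq (.load f) q) r s (1 + u) Q :=
  seq (Q' := fun r' s' => r' = f r ∧ s' = s)
    (load ⟨rfl, rfl⟩) (by rintro _ _ ⟨rfl, rfl⟩; exact h)

theorem ite {b : Registers l → Bool} (h₁ : b r = true → Exec p r s t Q)
    (h₂ : b r = false → Exec q r s t Q) : Exec (.ite b p q) r s (t + 1) Q := by
  rcases hb : b r with _ | _
  · obtain ⟨r', s', h, hq⟩ := h₂ hb
    exact ⟨r', s', Runs.ite (by rw [hb]; exact h), hq⟩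
  · obtain ⟨r', s', h, hq⟩ := h₁ hb
    exact ⟨r', s', Runs.ite (by rw [hb]; exact h), hq⟩

theorem loopDone {b : Registers l → Bool} (hb : b r = false) (h : Q r s) :
    Exec (.loop b p) r s 1 Q :=
  ⟨r, s, Runs.loopDone hb, h⟩

theorem loopStep {b : Registers l → Bool} (hb : b r = true) (h : Exec p r s t Q')
    (h' : ∀ r s, Q' r s → Exec (.loop b p) r s u Q) : Exec (.loop b p) r s (t + u + 1) Q := by
  obtain ⟨r', s', h, hq⟩ := h
  obtain ⟨r'', s'', h'', hq'⟩ := h' r' s' hq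
  exact ⟨r'', s'', Runs.loopStep hb h h'', hq'⟩

end Exec

/-- Pop a symbol into the register `cur`. -/
def popCur (k : StackName) : Prg l := .pop k fun r x => { r with cur := x }

/-- Pop a symbol into the register `tmp`. -/
def popTmp (k : StackName) : Prg l := .pop k fun r x => { r with tmp := x }

/-- Do nothing. -/
def skip : Prg l := .load id

/-- Pop the symbols of `k` one after the other into the register `cur`, and run `body` for
each of them. -/
def forEach (k : StackName) (body : Prg l) : Prg l :=
  .seq (popCur k) (.loop (fun r => r.cur.isSome) (.seq body (popCur k)))

/-- The loop rule: `Inv d e` speaks of the symbols `d` already consumed and the symbols `e` still on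
the stack. Each round costs the body, one pop and one test. -/
theorem Exec.forEach {k : StackName} {body : Prg l} {r : Registers l} {s : Stacks} {t : ℕ}
    {Q : Registers l → Stacks → Prop}
    (Inv : List (Option Bool) → List (Option Bool) → Registers l → Stacks → Prop)
    (x : List (Option Bool)) (h0 : Inv [] x r s)
    (hget : ∀ d e r s, Inv d e r s → s.get k = e)
    (hbody : ∀ d a e r s, d ++ a :: e = x → Inv d (a :: e) r s →
      Exec body { r with cur := some a } (s.set k e) t (Inv (d ++ [a]) e))
    (hend : ∀ r s, Inv x [] r s → Q { r with cur := none } s) :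
    Exec (forEach k body) r s (x.length * (t + 2) + 2) Q := by
  -- At the loop head the next symbol has already been popped: `cur` holds the head of `e` and the
  -- stack its tail.
  have key : ∀ (e d : List (Option Bool)) (r : Registers l) (s : Stacks), d ++ e = x →
      Inv d e r s → Exec (.loop (fun r => r.cur.isSome) (.seq body (popCur k)))
        { r with cur := e.head? } (s.set k e.tail) (e.length * (t + 2) + 1) Q := by
    intro e
    induction e with
    | nil =>
      intro d r s hd hI
      rw [List.append_nil] at hd
      subst hd
      have hs := hget _ _ _ _ hI
      have h1 : s.set k ([] : List (Option Bool)).tail = s := by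
        rw [List.tail_nil, ← hs, Stacks.set_get_self]
      rw [h1]
      exact (Exec.loopDone rfl (hend _ _ hI)).mono (by simp)
    | cons a e ih =>
      intro d r s hd hI
      refine (Exec.loopStep (Q' := fun r s => ∃ r', r = { r' with cur := e.head? } ∧
        ∃ s', s = s'.set k e.tail ∧ Inv (d ++ [a]) e r' s') rfl
        (Exec.seq (hbody d a e r s hd hI) (u := 1) ?_)
        (u := e.length * (t + 2) + 1) ?_).mono ?_
      · intro r' s' hI'
        apply Exec.pop
        rw [hget _ _ _ _ hI']
        exact ⟨r', rfl, s', rfl, hI'⟩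
      · rintro _ _ ⟨r', rfl, s', rfl, hI'⟩
        exact ih (d ++ [a]) r' s' (by simpa using hd) hI'
      · rw [List.length_cons]
        nlinarith
  refine (Exec.pop_seq (u := x.length * (t + 2) + 1) ?_).mono (by omega)
  rw [hget _ _ _ _ h0]
  exact key x [] r s rfl h0

/-- Move the symbols of `a` to `b`, in reverse order and after an application of `f`. -/
def pourMap (a b : StackName) (f : Option Bool → Option Bool) : Prg l :=
  forEach a (.push b fun r => f (r.cur.getD none))

/-- Move the symbols of `a` to `b`, in reverse order. -/
def pour (a b : StackName) : Prg l := pourMap a b id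

theorem Exec.pourMap {a b : StackName} (hab : a ≠ b) {f : Option Bool → Option Bool}
    {r : Registers l} {s : Stacks} {Q : Registers l → Stacks → Prop} {t : ℕ}
    (ht : (s.get a).length ≤ t)
    (h : Q { r with cur := none }
      ((s.set a []).set b (((s.get a).map f).reverse ++ s.get b))) :
    Exec (pourMap a b f) r s (3 * t + 2) Q := by
  refine (Exec.forEach (t := 1) (fun d e r' s' => (∃ c, r' = { r with cur := c }) ∧
    s' = (s.set a e).set b ((d.map f).reverse ++ s.get b)) (s.get a) ?_ ?_ ?_ ?_).mono
    (u := 3 * t + 2) (by omega)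
  · exact ⟨⟨_, rfl⟩, by simp [Stacks.set_get_self]⟩
  · rintro d e r' s' ⟨-, rfl⟩
    rw [Stacks.get_set_of_ne _ hab, Stacks.get_set_self]
  · rintro d x e r' s' - ⟨⟨c, rfl⟩, rfl⟩
    apply Exec.push
    refine ⟨⟨_, rfl⟩, ?_⟩
    rw [Stacks.set_set_comm _ hab, Stacks.set_set_self, Stacks.set_set_self, Stacks.get_set_self]
    simp
  · rintro r' s' ⟨⟨c, rfl⟩, rfl⟩
    exact h

theorem Exec.pour {a b : StackName} (hab : a ≠ b) {r : Registers l} {s : Stacks}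
    {Q : Registers l → Stacks → Prop} {t : ℕ} (ht : (s.get a).length ≤ t)
    (h : Q { r with cur := none } ((s.set a []).set b ((s.get a).reverse ++ s.get b))) :
    Exec (pour a b) r s (3 * t + 2) Q :=
  Exec.pourMap hab ht (by simpa using h)

/-- Empty a stack. -/
def clear (k : StackName) : Prg l := forEach k skip

theorem Exec.clear {k : StackName} {r : Registers l} {s : Stacks}
    {Q : Registers l → Stacks → Prop} {t : ℕ} (ht : (s.get k).length ≤ t)
    (h : Q { r with cur := none } (s.set k [])) : Exec (clear k) r s (3 * t + 2) Q := by
  refine (Exec.forEach (t := 1) (fun d e r' s' => (∃ c, r' = { r with cur := c }) ∧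
    s' = s.set k e) (s.get k) ?_ ?_ ?_ ?_).mono (u := 3 * t + 2) (by omega)
  · exact ⟨⟨_, rfl⟩, (Stacks.set_get_self ..).symm⟩
  · rintro d e r' s' ⟨-, rfl⟩
    simp
  · rintro d x e r' s' - ⟨⟨c, rfl⟩, rfl⟩
    apply Exec.load
    exact ⟨⟨_, rfl⟩, by simp⟩
  · rintro r' s' ⟨⟨c, rfl⟩, rfl⟩
    exact h

end StackProg

/-! ### Binary counters -/

/-- The successor of a binary number (least significant bit first). -/
def binSucc : List Bool → List Bool
  | [] => [true]
  | false :: x => true :: x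
  | true :: x => false :: binSucc x

/-- The value of a binary number (least significant bit first). -/
def binVal : List Bool → ℕ
  | [] => 0
  | b :: x => b.toNat + 2 * binVal x

theorem binVal_binSucc (x : List Bool) : binVal (binSucc x) = binVal x + 1 := by
  induction x with
  | nil => rfl
  | cons b x ih => cases b <;> simp [binSucc, binVal, ih] <;> omega

/-- Carry propagation: the leading ones become zeros and the digit after them becomes a one. Taking
`z.tail` covers both a zero in that place and the end of the number. -/
theorem exists_binSucc_eq (x : List Bool) : ∃ (j : ℕ) (y : List Bool), j ≤ x.length ∧
    binSucc x = List.replicate j false ++ true :: y ∧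
    ((∃ z, x = List.replicate j true ++ z ∧ z.head? ≠ some true ∧ y = z.tail)) := by
  induction x with
  | nil => exact ⟨0, [], le_rfl, rfl, [], rfl, by simp, rfl⟩
  | cons b x ih =>
    cases b with
    | false => exact ⟨0, x, by simp, rfl, false :: x, rfl, by simp, rfl⟩
    | true =>
      obtain ⟨j, y, hj, h1, z, h2, h3, h4⟩ := ih
      refine ⟨j + 1, y, by simpa using hj, ?_, z, ?_, h3, h4⟩
      · simp [binSucc, h1, List.replicate_succ]
      · simp [h2, List.replicate_succ]

theorem length_binSucc_le (x : List Bool) : (binSucc x).length ≤ x.length + 1 := by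
  induction x with
  | nil => simp [binSucc]
  | cons b x ih => cases b <;> simp [binSucc]; omega

namespace StackProg

variable {l : ℕ}

/-- Add one to the binary number on the stack `c`, using the empty stack `d`. -/
def incr (c d : StackName) : Prg l :=
  .seq (popCur c) <|
  .seq (.loop (fun r => r.cur == some (some true))
    (.seq (.push d fun _ => some false) (popCur c))) <|
  .seq (.push c fun _ => some true) (pour d c)

/-- The loop turns the leading ones into zeros on `d`; after the new one has been pushed these are
poured back. With `j` ones the cost is `6 * j + 5`. -/
theorem Exec.incr {c d : StackName} (hcd : c ≠ d) {r : Registers l} {s : Stacks}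
    {Q : Registers l → Stacks → Prop} {x : List Bool} (hc : s.get c = x.map some)
    (hd : s.get d = []) {t : ℕ} (ht : x.length ≤ t)
    (h : Q { r with cur := none } (s.set c ((binSucc x).map some))) :
    Exec (incr c d) r s (6 * t + 5) Q := by
  obtain ⟨j, y, hj, hx, z, rfl, hz, rfl⟩ := exists_binSucc_eq x
  have key : ∀ (i : ℕ) (w : List (Option Bool)) (r' : Registers l),
      (∃ c', r' = { r with cur := c' }) →
      r'.cur = ((List.replicate i true ++ z).map some).head? →
      Exec (.loop (fun r => r.cur == some (some true))
        (.seq (.push d fun _ => some false) (popCur c))) r'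
        ((s.set c ((List.replicate i true ++ z).map some).tail).set d w) (3 * i + 1)
        (fun r' s' => (∃ c', r' = { r with cur := c' }) ∧
          s' = ((s.set c (z.map some).tail).set d (List.replicate i (some false) ++ w))) := by
    intro i
    induction i with
    | zero =>
      intro w r' hr' hcur
      apply Exec.loopDone
      · rcases z with _ | ⟨_ | _, z⟩ <;> simp_all
      · exact ⟨hr', rfl⟩
    | succ i ih =>
      rintro w r' ⟨c', rfl⟩ hcur
      rw [List.replicate_succ, List.cons_append, List.map_cons, List.head?_cons] at hcur
      simp only at hcur
      subst hcur
      refine (Exec.loopStep (t := 2) (u := 3 * i + 1) (Q' := fun r' s' =>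
        (∃ c', r' = { r with cur := c' }) ∧
          r'.cur = ((List.replicate i true ++ z).map some).head? ∧
          s' = (s.set c ((List.replicate i true ++ z).map some).tail).set d (some false :: w))
          ?_ (Exec.push_seq (Exec.pop ?_)) ?_).mono (by omega)
      · simp
      · have h1 : (((s.set c ((List.replicate (i + 1) true ++ z).map some).tail).set d w).set d
            (some false :: ((s.set c ((List.replicate (i + 1) true ++ z).map some).tail).set d
              w).get d)).get c = (List.replicate i true ++ z).map some := by
          rw [Stacks.get_set_of_ne _ hcd, Stacks.get_set_of_ne _ hcd, Stacks.get_set_self]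
          simp [List.replicate_succ]
        rw [h1]
        refine ⟨⟨_, rfl⟩, rfl, ?_⟩
        rw [Stacks.get_set_self, Stacks.set_set_self, Stacks.set_set_comm _ hcd,
          Stacks.set_set_self]
      · rintro r' s' ⟨hr', hcur, rfl⟩
        refine (ih _ r' hr' hcur).conseq le_rfl ?_
        rintro r' s' ⟨hr', rfl⟩
        refine ⟨hr', ?_⟩
        rw [List.replicate_succ']
        simp
  have hj' : j ≤ t := hj.trans ht
  refine (Exec.pop_seq (Exec.seq (t := 3 * j + 1) (Q' := fun r' s' =>
    (∃ c', r' = { r with cur := c' }) ∧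
      s' = ((s.set c (z.map some).tail).set d (List.replicate j (some false)))) ?_
      fun r' s' hr' => Exec.push_seq (Exec.pour (t := j) hcd.symm ?_ ?_))).mono (by omega)
  · rw [hc]
    have := key j [] { r with cur := ((List.replicate j true ++ z).map some).head? } ⟨_, rfl⟩ rfl
    rw [← hd, ← Stacks.get_set_of_ne s hcd.symm ((List.replicate j true ++ z).map some).tail,
      Stacks.set_get_self] at this
    refine this.conseq le_rfl ?_
    rintro r' s' ⟨hr', rfl⟩
    exact ⟨hr', by rw [Stacks.get_set_of_ne _ hcd.symm, hd, List.append_nil]⟩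
  · obtain ⟨-, rfl⟩ := hr'
    rw [Stacks.get_set_of_ne _ hcd.symm]
    simp
  · obtain ⟨⟨c', rfl⟩, rfl⟩ := hr'
    convert h using 1
    have h9 : ∀ x, (s.set c x).set d [] = s.set c x := fun x => by
      rw [← hd, ← Stacks.get_set_of_ne s hcd.symm x, Stacks.set_get_self]
    rw [Stacks.get_set_self, Stacks.set_set_comm _ hcd, Stacks.set_set_self,
      Stacks.set_set_comm _ hcd, Stacks.set_set_self, Stacks.set_set_comm _ hcd,
      Stacks.set_set_self, Stacks.set_set_self, Stacks.get_set_of_ne _ hcd,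
      Stacks.get_set_self, hx, h9]
    simp

end StackProg

/-! ### Programs that work on tables -/

/-- A table of bits as a string; every row is terminated by `none`. -/
def encodeRows (A : List (List Bool)) : List (Option Bool) :=
  A.flatMap fun x => x.map some ++ [none]

@[simp]
theorem encodeRows_nil : encodeRows [] = [] := rfl

@[simp]
theorem encodeRows_cons (x : List Bool) (A : List (List Bool)) :
    encodeRows (x :: A) = x.map some ++ none :: encodeRows A := by
  simp [encodeRows]

@[simp]
theorem encodeRows_append (A A' : List (List Bool)) :
    encodeRows (A ++ A') = encodeRows A ++ encodeRows A' := by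
  simp [encodeRows]

theorem length_encodeRows_of_forall {A : List (List Bool)} {n : ℕ}
    (h : ∀ x ∈ A, x.length = n) : (encodeRows A).length = A.length * (n + 1) := by
  induction A with
  | nil => simp
  | cons x A ih =>
    rw [encodeRows_cons, List.length_append, List.length_cons, ih fun y hy => h y (by simp [hy]),
      List.length_map, h x (by simp), List.length_cons]
    ring

theorem length_le_length_encodeRows (A : List (List Bool)) :
    A.length ≤ (encodeRows A).length := by
  induction A with
  | nil => simp
  | cons x A ih => simp; omega

theorem length_row_le_length_encodeRows {A : List (List Bool)} {x : List Bool} (hx : x ∈ A) :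
    x.length ≤ (encodeRows A).length := by
  induction A with
  | nil => simp at hx
  | cons y A ih =>
    rcases List.mem_cons.1 hx with rfl | hx
    · simp
    · have := ih hx
      simp; omega

namespace StackProg

variable {l : ℕ}

/-- Run `p` or `q` depending on whether the register `cur` holds a bit. -/
def ifBit (p q : Prg l) : Prg l := .ite (fun r => (r.cur.getD none).isSome) p q

theorem Exec.forEachRows {k : StackName} {p q : Prg l} {r : Registers l} {s : Stacks} {t : ℕ}
    {Q : Registers l → Stacks → Prop} (A : List (List Bool))
    (Inv : List (List Bool) → List Bool → List (Option Bool) → Registers l → Stacks → Prop)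
    (h0 : Inv [] [] (encodeRows A) r s)
    (hget : ∀ A x e r s, Inv A x e r s → s.get k = e)
    (hbit : ∀ A₁ x b y A₂ e r s, A = A₁ ++ (x ++ b :: y) :: A₂ → Inv A₁ x (some b :: e) r s →
      Exec p { r with cur := some (some b) } (s.set k e) t (Inv A₁ (x ++ [b]) e))
    (hsep : ∀ A₁ x A₂ e r s, A = A₁ ++ x :: A₂ → Inv A₁ x (none :: e) r s →
      Exec q { r with cur := some none } (s.set k e) t (Inv (A₁ ++ [x]) [] e))
    (hend : ∀ r s, Inv A [] [] r s → Q { r with cur := none } s) :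
    Exec (StackProg.forEach k (ifBit p q)) r s ((encodeRows A).length * (t + 3) + 2) Q := by
  -- The consumed string is parsed into complete rows `A₁` and a prefix `x` of the current row; the
  -- second alternative is the end of the table, where there is no current row.
  refine Exec.forEach (t := t + 1) (fun d e r s => ∃ A₁ x, d = encodeRows A₁ ++ x.map some ∧
    ((∃ y A₂, A = A₁ ++ (x ++ y) :: A₂) ∨ (A = A₁ ∧ x = [])) ∧ Inv A₁ x e r s) (encodeRows A)
    ?_ ?_ ?_ ?_
  · refine ⟨[], [], rfl, ?_, h0⟩
    cases A with
    | nil => exact Or.inr ⟨rfl, rfl⟩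
    | cons x A => exact Or.inl ⟨x, A, rfl⟩
  · rintro d e r s ⟨A₁, x, -, -, h⟩
    exact hget _ _ _ _ _ h
  · rintro d a e r s hd ⟨A₁, x, rfl, (⟨y, A₂, rfl⟩ | ⟨rfl, rfl⟩), hI⟩
    · simp only [encodeRows_append, encodeRows_cons, List.map_append, List.append_assoc,
        List.append_cancel_left_eq] at hd
      cases y with
      | nil =>
        simp only [List.map_nil, List.nil_append, List.cons.injEq] at hd
        obtain ⟨rfl, rfl⟩ := hd
        refine Exec.ite (fun h => by simp at h) fun _ => ?_
        refine (hsep A₁ x A₂ _ r s (by simp) hI).conseq le_rfl ?_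
        intro r' s' h'
        refine ⟨A₁ ++ [x], [], by simp, ?_, h'⟩
        cases A₂ with
        | nil => exact Or.inr ⟨by simp, rfl⟩
        | cons z A₂ => exact Or.inl ⟨z, A₂, by simp⟩
      | cons b y =>
        simp only [List.map_cons, List.cons_append, List.cons.injEq] at hd
        obtain ⟨rfl, rfl⟩ := hd
        refine Exec.ite (fun _ => ?_) fun h => by simp at h
        refine (hbit A₁ x b y A₂ _ r s rfl hI).conseq le_rfl ?_
        intro r' s' h'
        exact ⟨A₁, x ++ [b], by simp, Or.inl ⟨y, A₂, by simp⟩, h'⟩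
    · simp at hd
  · rintro r s ⟨A₁, x, hd, (⟨y, A₂, rfl⟩ | ⟨rfl, rfl⟩), hI⟩
    · have := congrArg List.length hd
      simp only [encodeRows_append, encodeRows_cons, List.length_append, List.length_map,
        List.length_cons] at this
      omega
    · exact hend _ _ hI

/-- Store the length of the input in binary, with its digits replaced by zeros, on the stacks `C`
and `Z`. -/
def countProg : Prg l :=
  .seq (forEach .I (.seq (.push .J fun r => r.cur.getD none) (incr .C .D))) <|
  .seq (pourMap .C .Z fun _ => some false) <|
  .seq (pour .J .I) <|
  .seq (forEach .Z (.seq (.push .C fun _ => some false) (.push .R fun _ => some false)))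
    (pour .R .Z)

theorem length_iterate_binSucc_le (n : ℕ) (x : List Bool) :
    (binSucc^[n] x).length ≤ n + x.length := by
  induction n with
  | zero => simp
  | succ n ih =>
    rw [Function.iterate_succ_apply']
    have := length_binSucc_le (binSucc^[n] x)
    omega

/-- The number of binary digits of `n`. -/
def binLength (n : ℕ) : ℕ := (binSucc^[n] []).length

theorem binLength_le (n : ℕ) : binLength n ≤ n := length_iterate_binSucc_le n []

/-- A counter is incremented once per input symbol, but only its number of digits is kept. The zeros
on `C` are the label of the first vertices; those on `Z` are saved for the threshold of the final
comparison. -/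
theorem Exec.countProg {r : Registers l} {w : List (Option Bool)}
    {Q : Registers l → Stacks → Prop}
    (h : Q { r with cur := none } ⟨w, [], List.replicate (binLength w.length) (some false), [],
      List.replicate (binLength w.length) (some false), [], [], [], []⟩) :
    Exec countProg r (Turing.FinTM2.Stacks.init w)
      (6 * w.length ^ 2 + 21 * w.length + 10) Q := by
  have hL := binLength_le w.length
  refine (Exec.seq (t := w.length * (6 * w.length + 6 + 2) + 2)
    (u := (3 * w.length + 2) + ((3 * w.length + 2) + ((w.length * 4 + 2) + (3 * w.length + 2))))
    (Q' := fun r' s' => r' = { r with cur := none } ∧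
      s' = ⟨[], w.reverse, (binSucc^[w.length] []).map some, [], [], [], [], [], []⟩)
    (Exec.forEach (fun d e r' s' => (∃ c, r' = { r with cur := c }) ∧
      s' = ⟨e, d.reverse, (binSucc^[d.length] []).map some, [], [], [], [], [], []⟩)
      w ?_ ?_ ?_ ?_) ?_).mono ?_
  · exact ⟨⟨_, rfl⟩, rfl⟩
  · rintro d e r' s' ⟨-, rfl⟩
    rfl
  · rintro d a e r' s' hd ⟨⟨c, rfl⟩, rfl⟩
    refine (Exec.push_seq (Exec.incr (x := binSucc^[d.length] []) (t := w.length)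
      (by decide) rfl rfl ?_ ?_)).mono (by omega)
    · have h1 := length_iterate_binSucc_le d.length []
      have h2 := congrArg List.length hd
      simp only [List.length_append, List.length_cons, List.length_nil] at h1 h2
      omega
    · refine ⟨⟨_, rfl⟩, ?_⟩
      rw [List.length_append, List.length_singleton, Function.iterate_succ_apply']
      simp [Stacks.set, Stacks.get]
  · rintro r' s' ⟨⟨c, rfl⟩, rfl⟩
    exact ⟨rfl, rfl⟩
  · rintro _ _ ⟨rfl, rfl⟩
    refine Exec.seq (Q' := fun r' s' => r' = { r with cur := none } ∧
      s' = ⟨[], w.reverse, [], [], List.replicate (binLength w.length) (some false),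
        [], [], [], []⟩) (Exec.pourMap (by decide) ?_ ⟨rfl, ?_⟩) ?_
    · simp only [Stacks.get, List.length_map]
      exact hL
    · simp [Stacks.set, Stacks.get, Function.comp_def, List.map_const', binLength]
    rintro _ _ ⟨rfl, rfl⟩
    refine Exec.seq (Q' := fun r' s' => r' = { r with cur := none } ∧
      s' = ⟨w, [], [], [], List.replicate (binLength w.length) (some false),
        [], [], [], []⟩) (Exec.pour (by decide) (by simp [Stacks.get])
          ⟨rfl, by simp [Stacks.set, Stacks.get]⟩) ?_
    rintro _ _ ⟨rfl, rfl⟩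
    refine Exec.seq (t := w.length * 4 + 2) (Q' := fun r' s' => r' = { r with cur := none } ∧
      s' = ⟨w, [], List.replicate (binLength w.length) (some false), [], [],
        [], [], List.replicate (binLength w.length) (some false), []⟩)
        (Exec.mono (t := binLength w.length * 4 + 2) ?_ (by omega)) ?_
    · have := Exec.forEach (k := .Z) (l := l) (t := 2) (r := { r with cur := none })
        (s := ⟨w, [], [], [], List.replicate (binLength w.length) (some false), [], [], [], []⟩)
        (body := .seq (.push .C fun _ => some false) (.push .R fun _ => some false))
        (Q := fun r' s' => r' = { r with cur := none } ∧
          s' = ⟨w, [], List.replicate (binLength w.length) (some false), [], [],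
            [], [], List.replicate (binLength w.length) (some false), []⟩)
        (fun d e r' s' => (∃ c, r' = { r with cur := c }) ∧
          s' = ⟨w, [], List.replicate d.length (some false), [], e, [], [],
            List.replicate d.length (some false), []⟩)
        (List.replicate (binLength w.length) (some false)) ⟨⟨_, rfl⟩, rfl⟩
        (by rintro d e r' s' ⟨-, rfl⟩; rfl)
        (by
          rintro d a e r' s' - ⟨⟨c, rfl⟩, rfl⟩
          refine Exec.push_seq (Exec.push ⟨⟨_, rfl⟩, ?_⟩)
          simp [Stacks.set, Stacks.get, List.replicate_succ])
        (by
          rintro r' s' ⟨⟨c, rfl⟩, rfl⟩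
          simp)
      rwa [List.length_replicate] at this
    rintro _ _ ⟨rfl, rfl⟩
    refine Exec.pour (by decide) (by simpa [Stacks.get] using hL) ?_
    simpa [Stacks.set, Stacks.get] using h
  · nlinarith

end StackProg

/-! ### Masking an adjacency matrix -/

theorem length_le_length_binSucc (x : List Bool) : x.length ≤ (binSucc x).length := by
  induction x with
  | nil => simp
  | cons b x ih => cases b <;> simp [binSucc]; omega

theorem le_length_iterate_binSucc (n : ℕ) (x : List Bool) :
    x.length ≤ (binSucc^[n] x).length := by
  induction n with
  | zero => simp
  | succ n ih =>
    rw [Function.iterate_succ_apply']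
    exact ih.trans (length_le_length_binSucc _)

/-- The label of the vertex `v`, with `L` binary digits: `v / (l + 1)` in binary. -/
def vertexLabel (l L v : ℕ) : List Bool := binSucc^[v / (l + 1)] (List.replicate L false)

/-- The mask at row `v` and column `u`. -/
def maskBit (l L v u : ℕ) : Bool :=
  decide (u / (vertexLabel l L v).length % (l + 1) ≠ v % (l + 1)) ||
    (vertexLabel l L v).getD (u % (vertexLabel l L v).length) false

/-- Apply the mask to the row with index `v`. -/
def maskRow (l L v : ℕ) (x : List Bool) : List Bool :=
  x.mapIdx fun u b => b && maskBit l L v u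

/-- Apply the mask to a table. -/
def maskRows (l L : ℕ) (A : List (List Bool)) : List (List Bool) :=
  A.mapIdx fun v x => maskRow l L v x

theorem maskRow_concat (l L v : ℕ) (x : List Bool) (b : Bool) :
    maskRow l L v (x ++ [b]) = maskRow l L v x ++ [b && maskBit l L v x.length] :=
  List.mapIdx_concat

theorem maskRows_concat (l L : ℕ) (A : List (List Bool)) (x : List Bool) :
    maskRows l L (A ++ [x]) = maskRows l L A ++ [maskRow l L A.length x] :=
  List.mapIdx_concat

/-- The recursion followed by the machine: its row counter wraps around to `0` exactly when the
label has to be incremented. -/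
theorem vertexLabel_succ (l L v : ℕ) : vertexLabel l L (v + 1) =
    if (v + 1) % (l + 1) = 0 then binSucc (vertexLabel l L v) else vertexLabel l L v := by
  unfold vertexLabel
  rw [Nat.succ_div]
  simp only [Nat.dvd_iff_mod_eq_zero]
  split_ifs
  · rw [Function.iterate_succ_apply']
  · rfl

theorem Fin.val_add_one_eq_mod {l : ℕ} (i : Fin (l + 1)) (n : ℕ) (h : i.val = n % (l + 1)) :
    (i + 1).val = (n + 1) % (l + 1) := by
  rw [Fin.val_add, h, Fin.val_one', Nat.mod_add_mod, Nat.add_mod_mod]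

namespace StackProg

variable {l : ℕ}

/-- Compute the masked table, reversed, on the stack `J`. -/
def maskProg : Prg l :=
  forEach .I <| ifBit
    (.seq (.load fun r => { r with flag := r.cur == some (some true) }) <|
      .seq (popTmp .C) <|
      .seq (.ite (fun r => r.tmp.isNone)
        (.seq (pour .D .C) <| .seq (.load fun r => { r with ju := r.ju + 1 }) (popTmp .C))
        skip) <|
      .seq (.push .D fun r => r.tmp.getD none)
        (.push .J fun r => some (r.flag && (r.ju != r.jv || r.tmp == some (some true)))))
    (.seq (.push .J fun _ => none) <|
      .seq (pour .D .C) <|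
      .seq (.load fun r => { r with ju := 0, jv := r.jv + 1 })
        (.ite (fun r => r.jv == 0) (incr .C .D) skip))

/-- No division is carried out. The digits of the label are read cyclically, `C` holding the unread
and `D` the read ones; when `C` is exhausted it is refilled and the block counter `ju` advances.
Thus `q` full passes and `D` together record the column. -/
theorem Exec.maskProg {r : Registers l} {A : List (List Bool)} {L n : ℕ}
    {z : List (Option Bool)} {Q : Registers l → Stacks → Prop} (hA : (encodeRows A).length ≤ n)
    (hL : 0 < L) (hLn : L ≤ n) (hr : r.ju = 0 ∧ r.jv = 0)
    (h : ∀ r C, Q r ⟨[], (encodeRows (maskRows l L A)).reverse, C, [], z, [], [], [], []⟩) :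
    Exec maskProg r ⟨encodeRows A, [], List.replicate L (some false), [], z, [], [], [], []⟩
      (n * (20 * n + 20) + 2) Q := by
  refine (Exec.forEachRows (t := 18 * n + 13) A (fun A₁ x e r s =>
    r.jv.val = A₁.length % (l + 1) ∧ ∃ (C D : List Bool) (q : ℕ), D.length + q * (vertexLabel l L A₁.length).length
      = x.length ∧ r.ju.val = q % (l + 1) ∧
      D.reverse ++ C = (vertexLabel l L A₁.length) ∧
      s = ⟨e, (encodeRows (maskRows l L A₁) ++ (maskRow l L A₁.length x).map some).reverse,
        C.map some, D.map some, z, [], [], [], []⟩) ?_ ?_ ?_ ?_ ?_).mono ?_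
  · refine ⟨by simp [hr.2], List.replicate L false, [], 0, by simp, by simp [hr.1], ?_, ?_⟩
    · simp [vertexLabel]
    · simp [maskRows, maskRow]
  · rintro A₁ x e r s ⟨-, C, D, q, -, -, -, rfl⟩
    rfl
  · rintro A₁ x b y A₂ e r s hA' ⟨hjv, C, D, q, hq, hju, hCD, rfl⟩
    -- A label starts with `L` digits and gains at most one per increment. This crude bound avoids a
    -- discussion of overflow here.
    have hlen : (vertexLabel l L A₁.length).length ≤ 2 * n := by
      have h1 : (vertexLabel l L A₁.length).length ≤ _ := length_iterate_binSucc_le _ _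
      rw [List.length_replicate] at h1
      have h2 := length_le_length_encodeRows A
      have h3 : A₁.length ≤ A.length := by rw [hA']; simp
      have h4 := Nat.div_le_self A₁.length (l + 1)
      omega
    have hlen0 : L ≤ (vertexLabel l L A₁.length).length := by
      have := le_length_iterate_binSucc (A₁.length / (l + 1)) (List.replicate L false)
      simpa [vertexLabel] using this
    set c := vertexLabel l L A₁.length with hc
    -- The column index is `D'.length + i * c.length` with `D'.length < c.length`, so its quotient
    -- and remainder by the label length are `i` and `D'.length`.
    have hout : ∀ (i : ℕ) (m : Bool) (D' : List Bool) (C' : List Bool),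
        D'.reverse ++ m :: C' = c → D'.length + i * c.length = x.length →
        maskBit l L A₁.length x.length = (decide (i % (l + 1) ≠ A₁.length % (l + 1)) || m) := by
      intro i m D' C' hD' hi
      have h1 : D'.length < c.length := by
        rw [← hD']; simp
      have h2 : x.length / c.length = i := by
        rw [← hi, Nat.add_mul_div_right _ _ (by omega), Nat.div_eq_of_lt h1, zero_add]
      have h3 : x.length % c.length = D'.length := by
        rw [← hi, Nat.add_mul_mod_self_right, Nat.mod_eq_of_lt h1]
      unfold maskBit
      rw [← hc, h2, h3]
      congr 1
      have : c.getD D'.length false = (D'.reverse ++ m :: C').getD D'.length false := by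
        rw [hD']
      rw [this, List.getD_append_right _ _ _ _ (by simp)]
      simp
    have hfin : ∀ (ju : Fin (l + 1)) (m : Bool) (i : ℕ), ju.val = i % (l + 1) →
        (b && (ju != r.jv || m)) =
          (b && (decide (i % (l + 1) ≠ A₁.length % (l + 1)) || m)) := by
      intro ju m i hju
      congr 2
      rw [← hju, ← hjv]
      by_cases hj : ju = r.jv
      · simp [hj]
      · simp [hj, Fin.val_ne_of_ne hj]
    refine Exec.mono (t := 1 + (1 + ((3 * (2 * n) + 2 + (1 + 1) + 1) + (1 + 1)))) ?_ (by omega)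
    refine Exec.load_seq (Exec.pop_seq (Exec.seq (Q' := fun r' s' => ∃ (ju : Fin (l + 1)) (m : Bool) (C' D' : List Bool) (i : ℕ),
      r' = { r with cur := r'.cur, tmp := some (some m), ju := ju, flag := b } ∧
      ju.val = i % (l + 1) ∧ D'.reverse ++ m :: C' = c ∧ D'.length + i * c.length = x.length ∧
      s' = ⟨e, (encodeRows (maskRows l L A₁) ++ (maskRow l L A₁.length x).map some).reverse,
        C'.map some, D'.map some, z, [], [], [], []⟩) (Exec.ite ?_ ?_) ?_))
    · intro hnone
      have hC : C = [] := by
        cases C with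
        | nil => rfl
        | cons m C => simp [Stacks.get, Stacks.set] at hnone
      subst hC
      rw [List.append_nil] at hCD
      obtain ⟨m, C', hmC⟩ : ∃ m C', c = m :: C' := by
        cases hcc : c with
        | nil => rw [hcc] at hlen0; simp at hlen0; omega
        | cons m C' => exact ⟨m, C', rfl⟩
      have hDl : D.length = c.length := by rw [← hCD, List.length_reverse]
      refine Exec.seq (t := 3 * (2 * n) + 2) (u := 1 + 1)
        (Q' := fun r' s' => r' = { r with cur := none, tmp := none, flag := b } ∧
        s' = ⟨e, (encodeRows (maskRows l L A₁) ++ (maskRow l L A₁.length x).map some).reverse,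
          c.map some, [], z, [], [], [], []⟩) (Exec.pour (by decide) ?_ ⟨?_, ?_⟩) ?_
      · simp only [Stacks.set, Stacks.get, List.length_map]
        omega
      · simp [Stacks.get, Stacks.set]
      · simp [Stacks.get, Stacks.set, ← hCD]
      rintro _ _ ⟨rfl, rfl⟩
      refine Exec.load_seq (Exec.pop ?_)
      refine ⟨r.ju + 1, m, C', [], q + 1, ?_, Fin.val_add_one_eq_mod _ _ hju, hmC.symm, ?_, ?_⟩
      · simp [Stacks.get, hmC]
      · rw [← hq, hDl]
        simp only [List.length_nil]
        ring
      · simp [Stacks.get, Stacks.set, hmC]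
    · intro hsome
      cases C with
      | nil => simp [Stacks.get, Stacks.set] at hsome
      | cons m C =>
        refine Exec.mono (t := 1) (Exec.load ?_) (by omega)
        refine ⟨r.ju, m, C, D, q, ?_, hju, hCD, hq, rfl⟩
        simp [Stacks.get, Stacks.set]
    · rintro r' _ ⟨ju, m, C', D', i, hr', hju', hD', hi, rfl⟩
      rw [hr']
      refine Exec.push_seq (Exec.push ⟨hjv, C', m :: D', i, ?_, hju', ?_, ?_⟩)
      · simp only [List.length_cons, List.length_append, List.length_nil]
        omega
      · simpa using hD'
      · have h5 := hout i m D' C' hD' hi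
        have h6 := hfin ju m i hju'
        rw [maskRow_concat, h5, ← h6]
        simp [Stacks.get, Stacks.set]
  · rintro A₁ x A₂ e r s hA' ⟨hjv, C, D, q, hq, hju, hCD, rfl⟩
    have hlen : (vertexLabel l L A₁.length).length ≤ 2 * n := by
      have h1 : (vertexLabel l L A₁.length).length ≤ _ := length_iterate_binSucc_le _ _
      rw [List.length_replicate] at h1
      have h2 := length_le_length_encodeRows A
      have h3 : A₁.length ≤ A.length := by rw [hA']; simp
      have h4 := Nat.div_le_self A₁.length (l + 1)
      omega
    have hDl : D.length ≤ (vertexLabel l L A₁.length).length := by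
      rw [← hCD]; simp
    refine Exec.mono (t := 1 + ((3 * (2 * n) + 2) + (1 + (6 * (2 * n) + 5 + 1)))) ?_ (by omega)
    refine Exec.push_seq (Exec.seq (Q' := fun r' s' => r'.jv = r.jv ∧
      s' = ⟨e, (encodeRows (maskRows l L (A₁ ++ [x]))).reverse,
        (vertexLabel l L A₁.length).map some, [], z, [], [], [], []⟩)
      (Exec.pour (by decide) ?_ ⟨rfl, ?_⟩) ?_)
    · simp only [Stacks.set, Stacks.get, List.length_map]
      omega
    · rw [maskRows_concat, ← hCD]
      simp [Stacks.set, Stacks.get]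
    rintro r' _ ⟨hr', rfl⟩
    have hjv' : (r'.jv + 1).val = (A₁.length + 1) % (l + 1) :=
      Fin.val_add_one_eq_mod _ _ (by rw [hr', hjv])
    refine Exec.load_seq (Exec.ite ?_ ?_)
    · intro h0
      simp only [beq_iff_eq, Fin.ext_iff, Fin.val_zero] at h0
      rw [hjv'] at h0
      refine Exec.incr (by decide) rfl rfl hlen ?_
      refine ⟨by simpa using hjv', vertexLabel l L (A₁ ++ [x]).length, [], 0, by simp, by simp,
        by simp, ?_⟩
      rw [List.length_append, List.length_singleton, vertexLabel_succ, if_pos h0]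
      simp [Stacks.set, maskRow]
    · intro h0
      simp only [beq_eq_false_iff_ne, ne_eq, Fin.ext_iff, Fin.val_zero] at h0
      rw [hjv'] at h0
      refine Exec.mono (t := 1) (Exec.load ?_) (by omega)
      refine ⟨by simpa using hjv', vertexLabel l L (A₁ ++ [x]).length, [], 0, by simp, by simp,
        by simp, ?_⟩
      rw [List.length_append, List.length_singleton, vertexLabel_succ, if_neg h0]
      simp [maskRow]
  · rintro r s ⟨-, C, D, q, hq, -, hCD, rfl⟩
    have hD : D = [] := List.eq_nil_of_length_eq_zero (Nat.add_eq_zero_iff.1 hq).1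
    subst hD
    simpa [maskRow] using h _ _
  · exact Nat.add_le_add_right (Nat.mul_le_mul hA (by omega)) 2

end StackProg

/-! ### Products of tables -/

/-- The bitwise conjunctions of `x` with all rows of `A`. -/
def andRow (A : List (List Bool)) (x : List Bool) : List (List Bool) :=
  A.map fun a => List.zipWith and x a

/-- The bitwise conjunctions of all rows of `T` with all rows of `A`. -/
def andRows (A T : List (List Bool)) : List (List Bool) := T.flatMap (andRow A)

/-- The row `i` of the identity matrix with `n` rows, for `i < n`. -/
def unitRow (n : ℕ) : ℕ → List Bool
  | 0 => true :: List.replicate (n - 1) false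
  | i + 1 => false :: (unitRow n i).dropLast

/-- Append the identity matrix to a table. -/
def appendUnitRows (n : ℕ) (T : List (List Bool)) : List (List Bool) :=
  T.mapIdx fun i x => x ++ unitRow n i

theorem length_unitRow {n : ℕ} (hn : 0 < n) (i : ℕ) : (unitRow n i).length = n := by
  induction i with
  | zero => simp [unitRow]; omega
  | succ i ih => simp [unitRow, ih]; omega

theorem appendUnitRows_concat (n : ℕ) (T : List (List Bool)) (x : List Bool) :
    appendUnitRows n (T ++ [x]) = appendUnitRows n T ++ [x ++ unitRow n T.length] :=
  List.mapIdx_concat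

namespace StackProg

variable {l : ℕ}

/-- Move the reverse of the stack `J` to the stacks `B` and `T`. -/
def dupProg : Prg l :=
  forEach .J (.seq (.push .B fun r => r.cur.getD none) (.push .T fun r => r.cur.getD none))

theorem Exec.dupProg {r : Registers l} {s : Stacks} {x : List (Option Bool)} {n : ℕ}
    {Q : Registers l → Stacks → Prop} (hs : s.J = x.reverse) (hB : s.B = []) (hT : s.T = [])
    (hx : x.length ≤ n)
    (h : Q { r with cur := none } { s with J := [], B := x, T := x }) :
    Exec dupProg r s (4 * n + 2) Q := by
  refine (Exec.forEach (t := 2) (fun d e r' s' => (∃ c, r' = { r with cur := c }) ∧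
    s' = { s with J := e, B := d.reverse, T := d.reverse }) x.reverse ?_ ?_ ?_ ?_).mono ?_
  · refine ⟨⟨_, rfl⟩, ?_⟩
    cases s
    simp_all
  · rintro d e r' s' ⟨-, rfl⟩
    rfl
  · rintro d a e r' s' - ⟨⟨c, rfl⟩, rfl⟩
    refine Exec.push_seq (Exec.push ⟨⟨_, rfl⟩, ?_⟩)
    simp [Stacks.set, Stacks.get]
  · rintro r' s' ⟨⟨c, rfl⟩, rfl⟩
    rw [List.reverse_reverse]
    exact h
  · rw [List.length_reverse]
    omega

/-- Push the conjunctions of the row on the stack `S` with the rows of the table on the stack `B`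
to the stack `J`. The table is moved, reversed, to the stack `I`. -/
def andRowProg : Prg l :=
  forEach .B <| ifBit
    (.seq (.push .I fun r => r.cur.getD none) <| .seq (popTmp .S) <|
      .seq (.push .R fun r => r.tmp.getD none)
        (.push .J fun r => some (r.tmp == some (some true) && r.cur == some (some true))))
    (.seq (.push .I fun _ => none) <| .seq (.push .J fun _ => none) (pour .R .S))

/-- The row `x` is split into the part `x₁` already used, kept on `R`, and the rest `x₂` on `S`; at
the end of each row of `A` it is restored on `S` for the next one. -/
theorem Exec.andRowProg {r : Registers l} {s : Stacks} {A : List (List Bool)} {x : List Bool}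
    {n : ℕ} {Q : Registers l → Stacks → Prop} (hB : s.B = encodeRows A) (hS : s.S = x.map some)
    (hI : s.I = []) (hR : s.R = []) (hA : ∀ a ∈ A, a.length = x.length)
    (hAn : (encodeRows A).length ≤ n) (hxn : x.length ≤ n)
    (h : ∀ r, Q r { s with
      B := [], I := (encodeRows A).reverse, J := (encodeRows (andRow A x)).reverse ++ s.J }) :
    Exec andRowProg r s (n * (3 * n + 7) + 2) Q := by
  refine (Exec.forEachRows (t := 3 * n + 4) A (fun A₁ a e r' s' => ∃ x₁ x₂, x = x₁ ++ x₂ ∧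
    x₁.length = a.length ∧ s' = { s with
      B := e, I := (encodeRows A₁ ++ a.map some).reverse, R := (x₁.map some).reverse,
      S := x₂.map some,
      J := (encodeRows (andRow A₁ x) ++ (List.zipWith and x₁ a).map some).reverse ++ s.J })
    ?_ ?_ ?_ ?_ ?_).mono ?_
  · refine ⟨[], x, rfl, rfl, ?_⟩
    cases s
    simp_all [andRow]
  · rintro A₁ a e r' s' ⟨x₁, x₂, -, -, rfl⟩
    rfl
  · rintro A₁ a b y A₂ e r' s' hA' ⟨x₁, x₂, hx, hlen, rfl⟩
    have h1 := hA (a ++ b :: y) (by simp [hA'])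
    obtain ⟨m, x₂, rfl⟩ : ∃ m x₃, x₂ = m :: x₃ := by
      cases x₂ with
      | nil =>
        rw [hx] at h1
        simp at h1
        omega
      | cons m x₃ => exact ⟨m, x₃, rfl⟩
    refine Exec.mono (t := 1 + (1 + (1 + 1))) ?_ (by omega)
    refine Exec.push_seq (Exec.pop_seq (Exec.push_seq (Exec.push
      ⟨x₁ ++ [m], x₂, by simp [hx], by simp [hlen], ?_⟩)))
    rw [List.zipWith_append hlen]
    simp [Stacks.set, Stacks.get]
  · rintro A₁ a A₂ e r' s' hA' ⟨x₁, x₂, hx, hlen, rfl⟩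
    have h1 := hA a (by simp [hA'])
    have h2 : x₂ = [] := by
      refine List.eq_nil_of_length_eq_zero ?_
      have := congrArg List.length hx
      rw [List.length_append] at this
      omega
    subst h2
    rw [List.append_nil] at hx
    subst hx
    refine Exec.mono (t := 1 + (1 + (3 * n + 2))) ?_ (by omega)
    refine Exec.push_seq (Exec.push_seq (Exec.pour (by decide) ?_ ⟨[], x, rfl, rfl, ?_⟩))
    · simpa [Stacks.set, Stacks.get] using hxn
    · simp [Stacks.set, Stacks.get, andRow]
  · rintro r' s' ⟨x₁, x₂, hx, hlen, rfl⟩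
    have h2 := List.eq_nil_of_length_eq_zero hlen
    subst h2
    rw [List.nil_append] at hx
    subst hx
    have := h { r' with cur := none }
    cases s
    simp_all
  · exact Nat.add_le_add_right (Nat.mul_le_mul hAn (by omega)) 2

/-- Multiply the table on the stack `T` with the table on the stack `B`. -/
def andRowsProg : Prg l :=
  .seq (forEach .T <| ifBit (.push .R fun r => r.cur.getD none)
    (.seq (pour .R .S) <| .seq andRowProg <| .seq (clear .S) (pour .I .B)))
    (pour .J .T)

theorem Exec.andRowsProg {r : Registers l} {s : Stacks} {A T : List (List Bool)} {m n : ℕ}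
    {Q : Registers l → Stacks → Prop} (hB : s.B = encodeRows A) (hT : s.T = encodeRows T)
    (hS : s.S = []) (hI : s.I = []) (hR : s.R = []) (hJ : s.J = [])
    (hA : ∀ a ∈ A, a.length = m) (hTm : ∀ x ∈ T, x.length = m)
    (hAn : (encodeRows A).length ≤ n) (hTn : (encodeRows T).length ≤ n)
    (hATn : (encodeRows (andRows A T)).length ≤ n)
    (h : ∀ r, Q r { s with T := encodeRows (andRows A T) }) :
    Exec andRowsProg r s (n * (3 * n ^ 2 + 16 * n + 11) + 3 * n + 4) Q := by
  refine (Exec.seq (t := (encodeRows T).length * ((3 * n ^ 2 + 16 * n + 8) + 3) + 2)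
    (u := 3 * n + 2) (Q' := fun r' s' =>
      s' = { s with T := [], J := (encodeRows (andRows A T)).reverse })
    (Exec.forEachRows T (fun T₁ x e r' s' => s' = { s with
      T := e, R := (x.map some).reverse, J := (encodeRows (andRows A T₁)).reverse })
      ?_ ?_ ?_ ?_ ?_) ?_).mono ?_
  · cases s
    simp_all [andRows]
  · rintro T₁ x e r' s' rfl
    rfl
  · rintro T₁ x b y T₂ e r' s' hT' rfl
    refine Exec.mono (t := 1) (Exec.push ?_) (by omega)
    simp [Stacks.set, Stacks.get]
  · rintro T₁ x T₂ e r' s' hT' rfl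
    have hx : x ∈ T := by simp [hT']
    have hxn : x.length ≤ n := (length_row_le_length_encodeRows hx).trans hTn
    refine Exec.mono (t := (3 * n + 2) + ((n * (3 * n + 7) + 2) + ((3 * n + 2) + (3 * n + 2))))
      ?_ (by nlinarith)
    refine Exec.seq (Q' := fun r' s' => s' = { s with
      T := e, S := x.map some, J := (encodeRows (andRows A T₁)).reverse })
      (Exec.pour (by decide) ?_ ?_) ?_
    · simpa [Stacks.set, Stacks.get] using hxn
    · simp [Stacks.set, Stacks.get, hR, hS]
    rintro r' _ rfl
    refine Exec.seq (Q' := fun r' s' => s' = { s with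
      T := e, S := x.map some, I := (encodeRows A).reverse, B := []
      J := (encodeRows (andRows A (T₁ ++ [x]))).reverse })
      (Exec.andRowProg hB rfl hI hR (fun a ha => by rw [hA a ha, hTm x hx]) hAn hxn ?_) ?_
    · simp [andRows]
    rintro r' _ rfl
    refine Exec.seq (Q' := fun r' s' => s' = { s with
      T := e, S := [], I := (encodeRows A).reverse, B := []
      J := (encodeRows (andRows A (T₁ ++ [x]))).reverse })
      (Exec.clear (by simpa [Stacks.get] using hxn) ?_) ?_
    · simp [Stacks.set]
    rintro r' _ rfl
    refine Exec.pour (by decide) (by simpa [Stacks.get] using hAn) ?_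
    simp [Stacks.set, Stacks.get, hR, hS, hI, hB]
  · rintro r' s' rfl
    simp [hR]
  · rintro r' _ rfl
    refine Exec.pour (by decide) (by simpa [Stacks.get] using hATn) ?_
    have := h { r' with cur := none }
    simpa [Stacks.set, Stacks.get, hJ] using this
  · have := Nat.mul_le_mul_right (3 * n ^ 2 + 16 * n + 11) hTn
    linarith

/-- Append the identity matrix to the table on the stack `T`, and move the resulting table,
reversed, to the stack `J`. -/
def appendUnitRowsProg : Prg l :=
  .seq (forEach .T <| ifBit (.push .J fun r => r.cur.getD none)
    (.seq (.push .J fun _ => none) (.push .R fun _ => some false))) <|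
  .seq (pour .J .T) <|
  .seq (popCur .R) <|
  .seq (.push .R fun _ => some true) <|
  forEach .T <| ifBit (.push .J fun r => r.cur.getD none)
    (.seq (forEach .R (.seq (.push .S fun r => r.cur.getD none)
        (.push .J fun r => r.cur.getD none))) <|
      .seq (popCur .S) <|
      .seq (pour .S .R) <|
      .seq (.push .R fun _ => some false) (.push .J fun _ => none))

/-- The first pass creates one zero for each row of the table, and the first zero is then replaced
by a one. The second pass appends this row and shifts it right by one place after every use. -/
theorem Exec.appendUnitRowsProg {r : Registers l} {s : Stacks} {T : List (List Bool)} {n : ℕ}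
    {Q : Registers l → Stacks → Prop} (hT : s.T = encodeRows T)
    (hS : s.S = []) (hR : s.R = []) (hJ : s.J = []) (hTn : (encodeRows T).length ≤ n)
    (hT0 : 0 < T.length)
    (h : ∀ r R, Q r { s with
      T := [], R := R, J := (encodeRows (appendUnitRows T.length T)).reverse }) :
    Exec appendUnitRowsProg r s (7 * n ^ 2 + 20 * n + 10) Q := by
  have hTl := length_le_length_encodeRows T
  refine (Exec.seq (t := (encodeRows T).length * (2 + 3) + 2)
    (u := (3 * n + 2) + (1 + (1 + ((encodeRows T).length * ((7 * n + 7) + 3) + 2))))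
    (Q' := fun r' s' => s' = { s with
      T := [], J := (encodeRows T).reverse, R := List.replicate T.length (some false) })
    (Exec.forEachRows T (fun T₁ x e r' s' => s' = { s with
      T := e, R := List.replicate T₁.length (some false),
      J := (encodeRows T₁ ++ x.map some).reverse })
      ?_ ?_ ?_ ?_ ?_) ?_).mono ?_
  · cases s
    simp_all
  · rintro T₁ x e r' s' rfl
    rfl
  · rintro T₁ x b y T₂ e r' s' - rfl
    refine Exec.mono (t := 1) (Exec.push ?_) (by omega)
    simp [Stacks.set, Stacks.get]
  · rintro T₁ x T₂ e r' s' - rfl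
    refine Exec.push_seq (Exec.push ?_)
    simp [Stacks.set, Stacks.get, List.replicate_succ]
  · rintro r' s' rfl
    simp
  · rintro r' _ rfl
    refine Exec.seq (Q' := fun r' s' => s' = { s with
      T := encodeRows T, J := [], R := List.replicate T.length (some false) })
      (Exec.pour (by decide) (by simpa [Stacks.get] using hTn) ?_) ?_
    · simp [Stacks.set, Stacks.get]
    rintro r' _ rfl
    refine Exec.pop_seq (Exec.push_seq (Exec.forEachRows T (fun T₁ x e r' s' => s' = { s with
      T := e, R := (unitRow T.length T₁.length).map some,
      J := (encodeRows (appendUnitRows T.length T₁) ++ x.map some).reverse })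
      ?_ ?_ ?_ ?_ ?_))
    · simp [Stacks.set, Stacks.get, unitRow, appendUnitRows]
    · rintro T₁ x e r' s' rfl
      rfl
    · rintro T₁ x b y T₂ e r' s' - rfl
      refine Exec.mono (t := 1) (Exec.push ?_) (by omega)
      simp [Stacks.set, Stacks.get]
    · rintro T₁ x T₂ e r' s' hT' rfl
      have hl := length_unitRow hT0 T₁.length
      refine Exec.mono (t := (n * (2 + 2) + 2) + (1 + ((3 * n + 2) + (1 + 1)))) ?_ (by omega)
      refine Exec.seq (Q' := fun r' s' => s' = { s with
        T := e, R := [], S := ((unitRow T.length T₁.length).map some).reverse,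
        J := (encodeRows (appendUnitRows T.length T₁) ++ x.map some ++
          (unitRow T.length T₁.length).map some).reverse }) (Exec.mono (Exec.forEach (t := 2)
          (fun d e' r' s' => s' = { s with
            T := e, R := e', S := d.reverse
            J := (encodeRows (appendUnitRows T.length T₁) ++ x.map some ++ d).reverse })
          ((unitRow T.length T₁.length).map some) ?_ ?_ ?_ ?_) ?_) ?_
      · simp [Stacks.set, hS]
      · rintro d e' r' s' rfl
        rfl
      · rintro d a e' r' s' - rfl
        refine Exec.push_seq (Exec.push ?_)
        simp [Stacks.set, Stacks.get]
      · rintro r' s' rfl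
        rfl
      · rw [List.length_map, hl]
        have := Nat.mul_le_mul_right (2 + 2) (hTl.trans hTn)
        omega
      rintro r' _ rfl
      refine Exec.pop_seq (Exec.seq (Q' := fun r' s' => s' = { s with
        T := e, R := (unitRow T.length T₁.length).dropLast.map some, S := [],
        J := (encodeRows (appendUnitRows T.length T₁) ++ x.map some ++
          (unitRow T.length T₁.length).map some).reverse }) (Exec.pour (by decide) ?_ ?_) ?_)
      · simp [Stacks.get, Stacks.set, hl]
        omega
      · simp [Stacks.get, Stacks.set, List.tail_reverse, ← List.map_dropLast]
      rintro r' _ rfl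
      refine Exec.push_seq (Exec.push ?_)
      simp [Stacks.get, Stacks.set, unitRow, appendUnitRows_concat, hS]
    · rintro r' s' rfl
      simpa using h { r' with cur := none } _
  · have := Nat.mul_le_mul_right (7 * n + 7 + 3) hTn
    nlinarith

end StackProg

/-! ### Comparison of binary numbers -/

/-- Whether `x` is greater than `g`; if they are equal, the answer is `b`. -/
def binGt : Bool → List Bool → List Bool → Bool
  | b, [], g => b && g.all not
  | b, c :: x, g => binGt (if c = g.headD false then b else c) x g.tail

theorem binVal_eq_zero_iff (g : List Bool) : binVal g = 0 ↔ g.all not = true := by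
  induction g with
  | nil => simp [binVal]
  | cons c g ih => cases c <;> simp [binVal] at ih ⊢; exact ih

/-- With the least significant digits first, the last difference decides, so `b` is the verdict on
the digits read so far. The shorter `g` is padded with zeros, while excess digits of `g` spoil the
verdict if one of them is a one. -/
theorem binGt_eq (b : Bool) (x g : List Bool) :
    binGt b x g = decide (binVal g < binVal x ∨ (binVal x = binVal g ∧ b = true)) := by
  induction x generalizing b g with
  | nil =>
    have := binVal_eq_zero_iff g
    rw [binGt, binVal, Bool.eq_iff_iff, Bool.and_eq_true, ← this, decide_eq_true_iff]
    constructor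
    · rintro ⟨h1, h2⟩
      exact Or.inr ⟨h2.symm, h1⟩
    · rintro (h1 | ⟨h1, h2⟩)
      · omega
      · exact ⟨h2, h1.symm⟩
  | cons c x ih =>
    rw [binGt, ih, decide_eq_decide]
    cases g with
    | nil => cases c <;> cases b <;> simp [binVal] <;> omega
    | cons d g => cases c <;> cases d <;> cases b <;> simp [binVal] <;> omega

theorem binVal_iterate_binSucc (n : ℕ) : binVal (binSucc^[n] []) = n := by
  induction n with
  | zero => rfl
  | succ n ih => rw [Function.iterate_succ_apply', binVal_binSucc, ih]

namespace StackProg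

variable {l : ℕ}

/-- Set the register `flag` if the binary number whose reverse is on the stack `J` is greater than
twice the length of the stack `Z`. -/
def compareProg : Prg l :=
  .seq (pour .J .I) <|
  .seq (forEach .Z (incr .T .D)) <|
  .seq (.push .T fun _ => some false) <|
  .seq (.load fun r => { r with flag := false }) <|
  .seq (forEach .I (.seq (popTmp .T) (.load fun r => { r with
    flag := if (r.cur == some (some true)) = (r.tmp == some (some true)) then r.flag
      else r.cur == some (some true) })))
  (forEach .T (.load fun r => { r with flag := r.flag && !(r.cur == some (some true)) }))

theorem Exec.compareProg {r : Registers l} {s : Stacks} {y : List Bool} {L n : ℕ}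
    {Q : Registers l → Stacks → Prop} (hJ : s.J = (y.map some).reverse) (hI : s.I = [])
    (hT : s.T = []) (hD : s.D = []) (hZ : s.Z = List.replicate L (some false))
    (hy : y.length ≤ n) (hL : L ≤ n)
    (h : ∀ r s, r.flag = decide (2 * L < binVal y) → Q r s) :
    Exec compareProg r s (6 * n ^ 2 + 20 * n + 20) Q := by
  refine Exec.mono (t := (3 * n + 2) + ((n * (6 * n + 5 + 2) + 2) + (1 + (1 + ((n * (2 + 2) + 2) +
    ((n + 1) * (1 + 2) + 2)))))) ?_ (by nlinarith)
  refine Exec.seq (Q' := fun r' s' => s' = { s with J := [], I := y.map some })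
    (Exec.pour (by decide) (by simpa [Stacks.get, hJ] using hy) ?_) ?_
  · simp [Stacks.set, Stacks.get, hI, hJ]
  rintro r' _ rfl
  refine Exec.seq (Q' := fun r' s' => s' = { s with
    J := [], I := y.map some, Z := [], T := (binSucc^[L] []).map some })
    (Exec.mono (t := L * (6 * n + 5 + 2) + 2) ?_
      (Nat.add_le_add_right (Nat.mul_le_mul_right _ hL) _)) ?_
  · have := Exec.forEach (l := l) (k := .Z) (body := StackProg.incr .T .D) (t := 6 * n + 5) (r := r')
      (s := { s with J := [], I := y.map some })
      (Q := fun r' s' => s' = { s with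
        J := [], I := y.map some, Z := [], T := (binSucc^[L] []).map some })
      (fun d e r' s' => s' = { s with
        J := [], I := y.map some, Z := e, T := (binSucc^[d.length] []).map some })
      (List.replicate L (some false)) ?_ ?_ ?_ ?_
    · rwa [List.length_replicate] at this
    · cases s
      simp_all
    · rintro d e r' s' rfl
      rfl
    · rintro d a e r' s' hd rfl
      have h2 := congrArg List.length hd
      rw [List.length_append, List.length_cons, List.length_replicate] at h2
      refine Exec.incr (x := binSucc^[d.length] []) (by decide) rfl (by exact hD)
        ((length_iterate_binSucc_le _ _).trans ?_) ?_
      · rw [List.length_nil]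
        omega
      · simp [Stacks.set, Function.iterate_succ_apply']
    · rintro r' s' rfl
      simp
  rintro r' _ rfl
  -- A zero pushed at the least significant end doubles the number, which gives the factor `2` of
  -- the threshold.
  have hg : binVal (false :: binSucc^[L] []) = 2 * L := by
    simp [binVal, binVal_iterate_binSucc]
  have hgl : (false :: binSucc^[L] []).length ≤ n + 1 := by
    have := length_iterate_binSucc_le L []
    simp at this ⊢
    omega
  refine Exec.push_seq (Exec.load_seq (Exec.seq (Q' := fun r' s' => ∃ g : List Bool,
    g.length ≤ n + 1 ∧
    s' = { s with J := [], I := [], Z := [], T := g.map some } ∧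
    (r'.flag && g.all not) = decide (2 * L < binVal y)) (Exec.mono (Exec.forEach (t := 2)
      (fun d e r' s' => ∃ g x : List Bool, g.length ≤ n + 1 ∧ e = x.map some ∧
        s' = { s with J := [], I := e, Z := [], T := g.map some } ∧
        binGt r'.flag x g = decide (2 * L < binVal y)) (y.map some) ?_ ?_ ?_ ?_) ?_) ?_))
  · refine ⟨false :: binSucc^[L] [], y, hgl, rfl, ?_, ?_⟩
    · simp [Stacks.set, Stacks.get]
    · rw [binGt_eq, hg]
      simp
  · rintro d e r' s' ⟨g, x, -, -, rfl, -⟩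
    rfl
  · rintro d a e r' s' - ⟨g, x, hgn, hx, rfl, hgt⟩
    cases x with
    | nil => simp at hx
    | cons c x =>
      rw [List.map_cons, List.cons.injEq] at hx
      obtain ⟨rfl, rfl⟩ := hx
      refine Exec.pop_seq (Exec.load ⟨g.tail, x, ?_, rfl, ?_, ?_⟩)
      · rw [List.length_tail]
        omega
      · simp [Stacks.set, Stacks.get]
      · rw [← hgt, binGt]
        congr 1
        cases g with
        | nil => cases c <;> simp [Stacks.get, Stacks.set]
        | cons b g => cases c <;> cases b <;> simp [Stacks.get, Stacks.set]
  · rintro r' s' ⟨g, x, hgn, hx, rfl, hgt⟩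
    have : x = [] := by simpa using hx.symm
    subst this
    exact ⟨g, hgn, rfl, hgt⟩
  · rw [List.length_map]
    exact Nat.add_le_add_right (Nat.mul_le_mul_right _ hy) _
  rintro r' _ ⟨g, hgn, rfl, hgt⟩
  refine (Exec.forEach (t := 1)
      (fun d e r' s' => ∃ g : List Bool, e = g.map some ∧ s'.T = e ∧
        (r'.flag && g.all not) = decide (2 * L < binVal y)) (g.map some) ⟨g, rfl, rfl, hgt⟩
        ?_ ?_ ?_).mono ?_
  · rintro d e r' s' ⟨g, -, h1, -⟩
    exact h1
  · rintro d a e r' s' - ⟨g, hg', hT', hgt⟩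
    cases g with
    | nil => simp at hg'
    | cons c g =>
      rw [List.map_cons, List.cons.injEq] at hg'
      obtain ⟨rfl, rfl⟩ := hg'
      refine Exec.load ⟨g, rfl, rfl, ?_⟩
      rw [← hgt]
      cases c <;> simp
  · rintro r' s' ⟨g, hg', hT', hgt⟩
    have : g = [] := by simpa using hg'.symm
    subst this
    exact h _ _ (by simpa using hgt)
  · rw [List.length_map]
    exact Nat.add_le_add_right (Nat.mul_le_mul_right _ hgn) _

end StackProg

open StackProg

/-! ### The reduction as a machine -/

theorem length_maskRows (l L : ℕ) (A : List (List Bool)) : (maskRows l L A).length = A.length :=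
  List.length_mapIdx

theorem length_of_mem_maskRows {l L m : ℕ} {A : List (List Bool)} (hA : ∀ a ∈ A, a.length = m) :
    ∀ a ∈ maskRows l L A, a.length = m := by
  intro a ha
  obtain ⟨i, hi, rfl⟩ := List.mem_mapIdx.1 ha
  rw [maskRow, List.length_mapIdx]
  exact hA _ (List.getElem_mem hi)

theorem length_andRows (A T : List (List Bool)) :
    (andRows A T).length = T.length * A.length := by
  simp [andRows, andRow, List.length_flatMap]

theorem mem_andRows {A T : List (List Bool)} {y : List Bool} :
    y ∈ andRows A T ↔ ∃ x ∈ T, ∃ a ∈ A, List.zipWith and x a = y := by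
  simp [andRows, andRow]

theorem length_of_mem_andRows {m : ℕ} {A T : List (List Bool)} (hA : ∀ a ∈ A, a.length = m)
    (hT : ∀ x ∈ T, x.length = m) : ∀ y ∈ andRows A T, y.length = m := by
  intro y hy
  obtain ⟨x, hx, a, ha, rfl⟩ := mem_andRows.1 hy
  simp [hT x hx, hA a ha]

/-- The rows that are conjunctions of `l + 1` rows of `A`. -/
def andPower (l : ℕ) (A : List (List Bool)) : List (List Bool) := (andRows A)^[l] A

theorem andPower_succ (l : ℕ) (A : List (List Bool)) :
    andPower (l + 1) A = andRows A (andPower l A) :=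
  Function.iterate_succ_apply' ..

theorem length_andPower (l : ℕ) (A : List (List Bool)) :
    (andPower l A).length = A.length ^ (l + 1) := by
  induction l with
  | zero => simp [andPower]
  | succ l ih => rw [andPower_succ, length_andRows, ih, pow_succ _ (l + 1)]

theorem length_of_mem_andPower {m : ℕ} {A : List (List Bool)} (hA : ∀ a ∈ A, a.length = m)
    (l : ℕ) : ∀ y ∈ andPower l A, y.length = m := by
  induction l with
  | zero => exact hA
  | succ l ih =>
    rw [andPower_succ]
    exact length_of_mem_andRows hA ih

/-- The table of the concept class that is computed from the adjacency matrix `A`. -/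
def reductionRows (l : ℕ) (A : List (List Bool)) : List (List Bool) :=
  appendUnitRows (A.length ^ (l + 1))
    (andPower l (maskRows l (binLength (encodeRows A).length) A))

namespace StackProg

variable {l : ℕ}

/-- Run a program a fixed number of times. -/
def repeatProg (p : Prg l) : ℕ → Prg l
  | 0 => skip
  | k + 1 => .seq (repeatProg p k) p

/-- Compute the reversed table of the reduction on the stack `J`. -/
def buildProg : Prg l :=
  .seq countProg <| .seq maskProg <| .seq dupProg <| .seq (repeatProg andRowsProg l)
    appendUnitRowsProg

theorem Exec.buildProg {r : Registers l} {A : List (List Bool)} {N n : ℕ}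
    {Q : Registers l → Stacks → Prop} (hN : 0 < N) (hA : A.length = N)
    (hAN : ∀ a ∈ A, a.length = N) (hr : r.ju = 0 ∧ r.jv = 0)
    (hn : N ^ (l + 1) * (N + 1) ≤ n)
    (h : ∀ r s, s.J = (encodeRows (reductionRows l A)).reverse → s.I = [] → s.T = [] →
      s.D = [] → s.Z = List.replicate (binLength (encodeRows A).length) (some false) → Q r s) :
    Exec buildProg r (Turing.FinTM2.Stacks.init (encodeRows A)) (100 * (l + 1) * (n + 1) ^ 3)
      Q := by
  have hAe : (encodeRows A).length = N * (N + 1) := by rw [length_encodeRows_of_forall hAN, hA]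
  have hpow : ∀ i ≤ l, N ^ (i + 1) * (N + 1) ≤ n := fun i hi =>
    (Nat.mul_le_mul_right _ (Nat.pow_le_pow_right hN (by omega))).trans hn
  have hAn : (encodeRows A).length ≤ n := by
    rw [hAe]
    simpa using hpow 0 (Nat.zero_le l)
  -- The cyclic reading of labels needs at least one digit; this is where `0 < N` enters.
  have hL : 0 < binLength (encodeRows A).length := by
    rw [hAe]
    obtain ⟨k, hk⟩ : ∃ k, N * (N + 1) = k + 1 := Nat.exists_eq_add_one.2 (by positivity)
    have h1 : binVal (binSucc^[k + 1] []) = k + 1 := binVal_iterate_binSucc _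
    rw [binLength, hk]
    by_contra h0
    rw [List.eq_nil_of_length_eq_zero (Nat.eq_zero_of_not_pos h0)] at h1
    simp [binVal] at h1
  have hLn := (binLength_le (encodeRows A).length).trans hAn
  set L := binLength (encodeRows A).length with hLdef
  set A' := maskRows l L A with hA'
  have hA'N : ∀ a ∈ A', a.length = N := length_of_mem_maskRows hAN
  have hA'l : A'.length = N := by rw [hA', length_maskRows, hA]
  have hA'e : (encodeRows A').length = N * (N + 1) := by
    rw [length_encodeRows_of_forall hA'N, hA'l]
  have hA'n : (encodeRows A').length ≤ n := by rw [hA'e, ← hAe]; exact hAn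
  have hTe : ∀ i, (encodeRows (andPower i A')).length = N ^ (i + 1) * (N + 1) := fun i => by
    rw [length_encodeRows_of_forall (length_of_mem_andPower hA'N i), length_andPower, hA'l]
  refine Exec.mono (t := (6 * n ^ 2 + 21 * n + 10) + ((n * (20 * n + 20) + 2) + ((4 * n + 2) +
    ((l * (n * (3 * n ^ 2 + 16 * n + 11) + 3 * n + 4) + 1) + (7 * n ^ 2 + 20 * n + 10))))) ?_ ?_
  · refine Exec.seq (Q' := fun r' s' => r'.ju = 0 ∧ r'.jv = 0 ∧ s' =
      ⟨encodeRows A, [], List.replicate L (some false), [], List.replicate L (some false),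
        [], [], [], []⟩)
      (Exec.mono (Exec.countProg ⟨hr.1, hr.2, rfl⟩) (by gcongr)) ?_
    rintro r' _ ⟨hju, hjv, rfl⟩
    refine Exec.seq (Q' := fun r' s' => ∃ C, s' =
      ⟨[], (encodeRows A').reverse, C, [], List.replicate L (some false), [], [], [], []⟩)
      (Exec.maskProg hAn hL hLn ⟨hju, hjv⟩ fun r C => ⟨C, rfl⟩) ?_
    rintro r' _ ⟨C, rfl⟩
    refine Exec.seq (Q' := fun r' s' => s' = ⟨[], [], C, [], List.replicate L (some false),
      encodeRows A', encodeRows (andPower 0 A'), [], []⟩)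
      (Exec.dupProg rfl rfl rfl hA'n rfl) ?_
    rintro r' _ rfl
    have key : ∀ i ≤ l, Exec (repeatProg (l := l) StackProg.andRowsProg i) r'
        ⟨[], [], C, [], List.replicate L (some false),
          encodeRows A', encodeRows (andPower 0 A'), [], []⟩
        (i * (n * (3 * n ^ 2 + 16 * n + 11) + 3 * n + 4) + 1)
        (fun _ s' => s' = ⟨[], [], C, [], List.replicate L (some false),
          encodeRows A', encodeRows (andPower i A'), [], []⟩) := by
      intro i
      induction i with
      | zero => exact fun _ => (Exec.load rfl).mono (by omega)
      | succ i ih =>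
        intro hi
        refine Exec.mono (Exec.seq (ih (by omega))
          (u := n * (3 * n ^ 2 + 16 * n + 11) + 3 * n + 4) ?_) (by ring_nf; omega)
        rintro r'' _ rfl
        refine Exec.andRowsProg rfl rfl rfl rfl rfl rfl hA'N (length_of_mem_andPower hA'N i)
          hA'n ?_ ?_ ?_
        · rw [hTe]
          exact hpow i (by omega)
        · rw [← andPower_succ, hTe]
          exact hpow (i + 1) hi
        · intro r
          rw [andPower_succ]
    refine Exec.seq (key l le_rfl) ?_
    rintro r'' _ rfl
    refine Exec.appendUnitRowsProg rfl rfl rfl rfl ?_ ?_ ?_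
    · rw [hTe]
      exact hpow l le_rfl
    · rw [length_andPower, hA'l]
      positivity
    · intro r''' R
      refine h _ _ ?_ rfl rfl rfl rfl
      simp only
      rw [length_andPower, hA'l, reductionRows, hA]
  · have h1 : n * (3 * n ^ 2 + 16 * n + 11) + 3 * n + 4 ≤ 16 * (n + 1) ^ 3 := by ring_nf; nlinarith
    have h2 := Nat.mul_le_mul_left l h1
    have h3 : 6 * n ^ 2 + 21 * n + 10 + (n * (20 * n + 20) + 2 + (4 * n + 2 +
        (1 + (7 * n ^ 2 + 20 * n + 10)))) ≤ 84 * (n + 1) ^ 3 := by ring_nf; nlinarith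
    nlinarith

end StackProg

theorem binVal_encodeNat (n : ℕ) : binVal (Computability.encodeNat n) = n := by
  have h1 : ∀ p : PosNum, binVal (Computability.encodePosNum p) = (p : ℕ) := by
    intro p
    induction p with
    | one => rfl
    | bit1 p ih => simp [Computability.encodePosNum, binVal, ih]; omega
    | bit0 p ih => simp [Computability.encodePosNum, binVal, ih]; omega
  have h2 : ∀ p : Num, binVal (Computability.encodeNum p) = (p : ℕ) := by
    intro p
    cases p with
    | zero => rfl
    | pos p => exact h1 p
  rw [Computability.encodeNat, h2]
  simp

theorem length_encodeNat_le (n : ℕ) : (Computability.encodeNat n).length ≤ n := by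
  have h1 : ∀ p : PosNum, (Computability.encodePosNum p).length ≤ (p : ℕ) := by
    intro p
    induction p with
    | one => exact le_rfl
    | bit1 p ih => simp [Computability.encodePosNum]; omega
    | bit0 p ih =>
      have := PosNum.cast_pos (α := ℕ) p
      simp [Computability.encodePosNum]; omega
  have h2 : ∀ p : Num, (Computability.encodeNum p).length ≤ (p : ℕ) := by
    intro p
    cases p with
    | zero => exact le_rfl
    | pos p => exact h1 p
  have := h2 (n : Num)
  rw [Computability.encodeNat]
  simpa using this

namespace Turing.FinTM2

open Turing.TM2 StackProg

variable (l : ℕ) (M : Turing.FinTM2) (eIn : M.Γ M.k₀ ≃ Option Bool) (eOut : M.Γ M.k₁ ≃ Bool)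

/-- The machine that decides whether the output of `M` on the table of the reduction is large. -/
def reductionMachine : ProbTM2 (Option Bool) :=
  M.sandwich (buildProg (l := l)) compareProg eIn.symm fun x => some (eOut x)

/-- A bound on the running time of `reductionMachine` for matrices with `N` rows if `M` runs for
`t` steps. -/
def reductionTime (N t : ℕ) : ℕ :=
  200 * (l + 1) * ((N + 1) ^ (2 * l + 4) + 1) ^ 3 + t

theorem reductionMachine_run_nil {t : ℕ} (ht : 1 ≤ t) (coins : List Bool)
    (hc : coins.length = t) : ((reductionMachine l M eIn eOut).run [] coins).l = none := by
  unfold reductionMachine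
  rw [sandwich_run]
  obtain ⟨c, hc', h⟩ := M.getsTo_sandwich_nil (buildProg (l := l)) compareProg eIn.symm
    (fun x => some (eOut x))
  rw [h.iterate_eq hc' (u := coins.length) (by omega)]
  exact hc'

theorem reductionMachine_run {A : List (List Bool)} {N f t u : ℕ} (hN : 0 < N)
    (hA : A.length = N) (hAN : ∀ a ∈ A, a.length = N)
    (hM : StateTransition.EvalsToInTime M.step
      (Turing.initList M ((encodeRows (reductionRows l A)).map eIn.invFun))
      (some (Turing.haltList M ((Computability.encodeNat f).map eOut.invFun))) t)
    (hf : f ≤ N + N ^ (l + 1)) (hu : reductionTime l N t ≤ u) (coins : List Bool)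
    (hc : coins.length = u) :
    ((reductionMachine l M eIn eOut).run (encodeRows A) coins).l = none ∧
    (((reductionMachine l M eIn eOut).run (encodeRows A) coins).var ∈
      (reductionMachine l M eIn eOut).accepting ↔ 2 * binLength (N * (N + 1)) < f) := by
  have hAe : (encodeRows A).length = N * (N + 1) := by rw [length_encodeRows_of_forall hAN, hA]
  -- A single bound for the input, the intermediate products, the final table and the output.
  set n := (N + 1) ^ (2 * l + 4) with hn
  have hn1 : N ^ (l + 1) * (N + 1) ≤ n := by
    calc N ^ (l + 1) * (N + 1) ≤ (N + 1) ^ (l + 1) * (N + 1) := by gcongr; omega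
      _ = (N + 1) ^ (l + 2) := by rw [← pow_succ]
      _ ≤ n := Nat.pow_le_pow_right (by omega) (by omega)
  have hn2 : N * (N + 1) ≤ n := by
    calc N * (N + 1) ≤ (N + 1) * (N + 1) := by gcongr; omega
      _ = (N + 1) ^ 2 := by ring
      _ ≤ n := Nat.pow_le_pow_right (by omega) (by omega)
  have hn3 : N + N ^ (l + 1) ≤ n := by
    calc N + N ^ (l + 1) ≤ N ^ (l + 1) * N + N ^ (l + 1) := by
          gcongr
          exact Nat.le_mul_of_pos_left N (by positivity)
      _ = N ^ (l + 1) * (N + 1) := by ring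
      _ ≤ n := hn1
  have hn4 : (encodeRows (reductionRows l A)).length ≤ n := by
    have h1 : ∀ y ∈ reductionRows l A, y.length = N + N ^ (l + 1) := by
      intro y hy
      obtain ⟨i, hi, rfl⟩ := List.mem_mapIdx.1 hy
      rw [List.length_append, hA, length_unitRow (by positivity),
        length_of_mem_andPower (length_of_mem_maskRows hAN) l _ (List.getElem_mem hi)]
    rw [length_encodeRows_of_forall h1, reductionRows, appendUnitRows, List.length_mapIdx,
      length_andPower, length_maskRows, hA]
    have h2 : N ^ (l + 1) ≤ (N + 1) ^ (l + 1) := Nat.pow_le_pow_left (by omega) _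
    have h3 : N + N ^ (l + 1) + 1 ≤ (N + 1) ^ (l + 2) := by
      have h4 : 1 ≤ (N + 1) ^ (l + 1) := Nat.one_le_pow _ _ (by omega)
      have h5 : N ^ (l + 1) < (N + 1) ^ (l + 1) := Nat.pow_lt_pow_left (by omega) (by omega)
      rw [show l + 2 = (l + 1) + 1 from rfl, pow_succ (N + 1) (l + 1)]
      nlinarith
    calc N ^ (l + 1) * (N + N ^ (l + 1) + 1) ≤ (N + 1) ^ (l + 1) * (N + 1) ^ (l + 2) := by gcongr
      _ = (N + 1) ^ (2 * l + 3) := by rw [← pow_add]; congr 1; ring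
      _ ≤ n := Nat.pow_le_pow_right (by omega) (by omega)
  have hw : encodeRows A ≠ [] := by
    intro h0
    rw [h0] at hAe
    have : 0 < N * (N + 1) := by positivity
    simp at hAe
    omega
  obtain ⟨r₁, s₁, h₁, hJ, hI, hT, hD, hZ⟩ := Exec.buildProg
    (r := { Registers.init l with cur := (encodeRows A).head? }) hN hA hAN ⟨rfl, rfl⟩ hn1
    (Q := fun r s => s.J = (encodeRows (reductionRows l A)).reverse ∧ s.I = [] ∧ s.T = [] ∧
      s.D = [] ∧ s.Z = List.replicate (binLength (encodeRows A).length) (some false))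
    (fun r s h1 h2 h3 h4 h5 => ⟨h1, h2, h3, h4, h5⟩)
  obtain ⟨r₂, s₂, h₂, hflag⟩ := Exec.compareProg (n := n) (r := { r₁ with cur := none })
    (s := s₁.set .J (((Computability.encodeNat f).map eOut.invFun).map
      fun x => some (eOut x)).reverse)
    (y := Computability.encodeNat f)
    (Q := fun r s => r.flag = decide (2 * binLength (encodeRows A).length <
      binVal (Computability.encodeNat f))) (by
        simp [Stacks.set, Function.comp_def]) hI hT hD hZ
    ((length_encodeNat_le f).trans (hf.trans hn3))
    ((binLength_le _).trans (by rw [hAe]; exact hn2)) (fun r s h => h)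
  have hrun := M.getsTo_sandwich (buildProg (l := l)) compareProg eIn.symm
    (fun x => some (eOut x)) hw h₁ hJ hM h₂
  unfold reductionMachine
  rw [sandwich_run]
  rw [hrun.iterate_eq rfl (u := coins.length)]
  · refine ⟨rfl, ?_⟩
    change r₂.flag = true ↔ _
    rw [hflag, decide_eq_true_iff, binVal_encodeNat, hAe]
  · rw [hc]
    refine le_trans ?_ hu
    unfold reductionTime
    rw [← hn, List.length_map]
    have hy := (length_encodeNat_le f).trans (hf.trans hn3)
    -- The comparison and the two transfers fit into the second half of the constant `200`; the
    -- first half pays for the construction of the table.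
    have h5 : 6 * n ^ 2 + 22 * n + 24 ≤ 100 * 1 * (n + 1) ^ 3 := by ring_nf; nlinarith
    have h6 : 100 * 1 * (n + 1) ^ 3 ≤ 100 * (l + 1) * (n + 1) ^ 3 := by gcongr; omega
    have h7 : 200 * (l + 1) * (n + 1) ^ 3 =
      100 * (l + 1) * (n + 1) ^ 3 + 100 * (l + 1) * (n + 1) ^ 3 := by ring
    omega

end Turing.FinTM2

/-! ### Bounds on Littlestone's dimension -/

section Online

variable {X : Type*}

theorem OnlineAlgorithm.mistakesFrom_le_length (A : OnlineAlgorithm X) (s past : List (X × Bool)) :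
    A.mistakesFrom past s ≤ s.length := by
  induction s generalizing past with
  | nil => exact le_rfl
  | cons p s ih =>
    obtain ⟨x, y⟩ := p
    have := ih (past ++ [(x, y)])
    rw [mistakesFrom, List.length_cons]
    split_ifs <;> omega

theorem littlestoneDim_le_of_mistakeBoundLE {𝒞 : Finset (Finset X)} {A : OnlineAlgorithm X} {k : ℕ}
    (h : A.MistakeBoundLE 𝒞 k) : littlestoneDim 𝒞 ≤ k :=
  Nat.sInf_le ⟨A, h⟩

theorem littlestoneDim_le_card [Fintype X] (𝒞 : Finset (Finset X)) :
    littlestoneDim 𝒞 ≤ Fintype.card X :=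
  littlestoneDim_le_of_mistakeBoundLE (A := fun _ _ => false) fun s hs _ =>
    (OnlineAlgorithm.mistakesFrom_le_length _ _ _).trans <| by
      simpa using hs.length_le_card

/-- The labels opposite to the predictions of `A`. -/
def OnlineAlgorithm.adversary (A : OnlineAlgorithm X) :
    (past : List (X × Bool)) → List X → List (X × Bool)
  | _, [] => []
  | past, x :: xs => (x, !(A past x)) :: A.adversary (past ++ [(x, !(A past x))]) xs

theorem OnlineAlgorithm.mistakesFrom_adversary (A : OnlineAlgorithm X) (past : List (X × Bool))
    (xs : List X) : A.mistakesFrom past (A.adversary past xs) = xs.length := by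
  induction xs generalizing past with
  | nil => rfl
  | cons x xs ih =>
    rw [adversary, mistakesFrom, ih, List.length_cons, if_neg (by simp), add_comm]

theorem OnlineAlgorithm.map_fst_adversary (A : OnlineAlgorithm X) (past : List (X × Bool))
    (xs : List X) : (A.adversary past xs).map Prod.fst = xs := by
  induction xs generalizing past with
  | nil => rfl
  | cons x xs ih => rw [adversary, List.map_cons, ih]

/-- The adversary presents the points of a shattered set and contradicts every prediction;
shattering makes the resulting labels realizable. -/
theorem vcDim_le_littlestoneDim [Fintype X] [DecidableEq X] (𝒞 : Finset (Finset X)) :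
    𝒞.vcDim ≤ littlestoneDim 𝒞 := by
  refine Finset.sup_le fun S hS => ?_
  rw [Finset.mem_shatterer] at hS
  -- A lower bound on the infimum needs some mistake bound to exist: a constant predictor errs at
  -- most once per point.
  refine le_csInf ⟨Fintype.card X, fun _ _ => false, fun s hs _ =>
    (OnlineAlgorithm.mistakesFrom_le_length _ _ _).trans (by simpa using hs.length_le_card)⟩ ?_
  rintro k ⟨A, hA⟩
  have hfst := A.map_fst_adversary [] S.toList
  have hnd : ((A.adversary [] S.toList).map Prod.fst).Nodup := by
    rw [hfst]
    exact S.nodup_toList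
  have := hA (A.adversary [] S.toList) hnd ?_
  · rw [OnlineAlgorithm.mistakes, OnlineAlgorithm.mistakesFrom_adversary, Finset.length_toList]
      at this
    exact this
  · obtain ⟨c, hc, hcS⟩ := hS (Finset.filter_subset
      (fun x => (x, true) ∈ A.adversary [] S.toList) S)
    refine ⟨c, hc, ?_⟩
    rintro ⟨x, y⟩ hxy
    have hxS : x ∈ S := by
      rw [← Finset.mem_toList, ← hfst]
      exact List.mem_map_of_mem hxy
    have h1 : x ∈ c ↔ (x, true) ∈ A.adversary [] S.toList := by
      have := Finset.ext_iff.1 hcS x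
      simpa [hxS] using this
    rw [h1]
    constructor
    · rintro rfl
      exact hxy
    · intro h2
      have := List.inj_on_of_nodup_map hnd hxy h2 rfl
      exact congrArg Prod.snd this

variable [DecidableEq X]

/-- The concepts of `𝒞` that are consistent with a list of labelled samples. -/
def consistentConcepts (𝒞 : Finset (Finset X)) (past : List (X × Bool)) : Finset (Finset X) :=
  𝒞.filter fun c => ∀ p ∈ past, (p.2 = true ↔ p.1 ∈ c)

theorem consistentConcepts_concat (𝒞 : Finset (Finset X)) (past : List (X × Bool)) (x : X)
    (y : Bool) : consistentConcepts 𝒞 (past ++ [(x, y)]) =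
      (consistentConcepts 𝒞 past).filter fun c => (y = true ↔ x ∈ c) := by
  ext c
  simp only [consistentConcepts, Finset.mem_filter, List.mem_append, List.mem_singleton]
  constructor
  · rintro ⟨h1, h2⟩
    exact ⟨⟨h1, fun p hp => h2 p (Or.inl hp)⟩, h2 (x, y) (Or.inr rfl)⟩
  · rintro ⟨⟨h1, h2⟩, h3⟩
    refine ⟨h1, ?_⟩
    rintro p (hp | rfl)
    · exact h2 p hp
    · exact h3

/-- Predict `false` as long as more than `2 ^ h` concepts are consistent with the past, and then
predict with the majority of these concepts. -/
def cautiousHalving (𝒞 : Finset (Finset X)) (h : ℕ) : OnlineAlgorithm X := fun past x =>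
  decide ((consistentConcepts 𝒞 past).card ≤ 2 ^ h ∧
    (consistentConcepts 𝒞 past).card < 2 * ((consistentConcepts 𝒞 past).filter (x ∈ ·)).card)

/-- The halving argument: in the majority phase every mistake at least halves the set of consistent
concepts, and realizability keeps it nonempty. -/
theorem cautiousHalving_mistakesFrom_le_of_small (𝒞 : Finset (Finset X)) (h : ℕ)
    (s past : List (X × Bool)) (k : ℕ) (hkh : k ≤ h)
    (hk : (consistentConcepts 𝒞 past).card ≤ 2 ^ k) (hs : Realizable 𝒞 (past ++ s)) :
    (cautiousHalving 𝒞 h).mistakesFrom past s ≤ k := by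
  induction s generalizing past k with
  | nil => exact Nat.zero_le k
  | cons p s ih =>
    obtain ⟨x, y⟩ := p
    have hs' : Realizable 𝒞 ((past ++ [(x, y)]) ++ s) := by simpa using hs
    rw [OnlineAlgorithm.mistakesFrom]
    split_ifs with hy
    · rw [zero_add]
      refine ih _ k hkh ?_ hs'
      rw [consistentConcepts_concat]
      exact (Finset.card_filter_le _ _).trans hk
    · have hpos : 0 < (consistentConcepts 𝒞 (past ++ [(x, y)])).card := by
        obtain ⟨c, hc, hcs⟩ := hs'
        exact Finset.card_pos.2 ⟨c, Finset.mem_filter.2 ⟨hc, fun p hp =>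
          hcs p (List.mem_append_left _ hp)⟩⟩
      have hhalf : 2 * (consistentConcepts 𝒞 (past ++ [(x, y)])).card ≤
          (consistentConcepts 𝒞 past).card := by
        rw [consistentConcepts_concat]
        have hsplit := Finset.card_filter_add_card_filter_not (s := consistentConcepts 𝒞 past)
          (fun c => x ∈ c)
        have hle : (consistentConcepts 𝒞 past).card ≤ 2 ^ h :=
          hk.trans (Nat.pow_le_pow_right two_pos hkh)
        unfold cautiousHalving at hy
        cases y
        · simp only [Bool.false_eq_true, false_iff, decide_eq_false_iff_not, not_not, hle,
            true_and] at hy ⊢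
          omega
        · simp only [true_iff, decide_eq_true_iff, hle, true_and] at hy ⊢
          omega
      obtain ⟨k, rfl⟩ : ∃ k', k = k' + 1 := by
        refine Nat.exists_eq_add_one.2 (Nat.pos_of_ne_zero ?_)
        rintro rfl
        rw [pow_zero] at hk
        omega
      have := ih (past ++ [(x, y)]) k (by omega) (by rw [pow_succ] at hk; omega) hs'
      omega

/-- In the cautious phase the prediction is `false`, so each mistake reveals a new point of the
target concept. After `a` of them only concepts containing these `a` points are left, at most `2 ^
h` by hypothesis, and halving costs at most `h` further mistakes. -/
theorem cautiousHalving_mistakeBoundLE {𝒞 : Finset (Finset X)} {a h : ℕ}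
    (h𝒞 : ∀ D : Finset X, D.card = a → (𝒞.filter (D ⊆ ·)).card ≤ 2 ^ h) :
    (cautiousHalving 𝒞 h).MistakeBoundLE 𝒞 (a + h) := by
  -- `D` collects the points of the mistakes made so far in the cautious phase; `j` more can be
  -- afforded.
  have key : ∀ (s past : List (X × Bool)) (D : Finset X) (j : ℕ), D.card + j = a →
      (∀ x ∈ D, (x, true) ∈ past) → ((past ++ s).map Prod.fst).Nodup →
      Realizable 𝒞 (past ++ s) → (cautiousHalving 𝒞 h).mistakesFrom past s ≤ j + h := by
    intro s
    induction s with
    | nil => exact fun _ _ _ _ _ _ _ => Nat.zero_le _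
    | cons p s ih =>
      intro past D j hDj hD hnd hs
      by_cases hsmall : (consistentConcepts 𝒞 past).card ≤ 2 ^ h
      · exact (cautiousHalving_mistakesFrom_le_of_small 𝒞 h _ past h le_rfl hsmall hs).trans
          (Nat.le_add_left h j)
      have hj : 0 < j := by
        refine Nat.pos_of_ne_zero ?_
        rintro rfl
        refine hsmall (le_trans (Finset.card_le_card fun c hc => ?_) (h𝒞 D hDj))
        rw [consistentConcepts, Finset.mem_filter] at hc
        refine Finset.mem_filter.2 ⟨hc.1, fun x hx => ?_⟩
        exact (hc.2 _ (hD x hx)).1 rfl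
      obtain ⟨x, y⟩ := p
      have hnd' : (((past ++ [(x, y)]) ++ s).map Prod.fst).Nodup := by simpa using hnd
      have hs' : Realizable 𝒞 ((past ++ [(x, y)]) ++ s) := by simpa using hs
      have hA : cautiousHalving 𝒞 h past x = false := by
        simp [cautiousHalving, hsmall]
      rw [OnlineAlgorithm.mistakesFrom, hA]
      cases y with
      | false =>
        rw [if_pos rfl, zero_add]
        exact ih _ D j hDj (fun x hx => List.mem_append_left _ (hD x hx)) hnd' hs'
      | true =>
        rw [if_neg (by simp)]
        -- The points of the sequence are distinct, so every mistake enlarges `D`.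
        have hxD : x ∉ D := by
          intro hx
          have h1 := hD x hx
          rw [List.map_append, List.map_cons] at hnd
          have h2 := (List.nodup_append.1 hnd).2.2
          exact h2 x (List.mem_map_of_mem (f := Prod.fst) h1) x (by simp) rfl
        have := ih (past ++ [(x, true)]) (insert x D) (j - 1)
          (by rw [Finset.card_insert_of_notMem hxD]; omega)
          (by
            intro z hz
            rcases Finset.mem_insert.1 hz with rfl | hz
            · simp
            · exact List.mem_append_left _ (hD z hz)) hnd' hs'
        omega
  intro s hnd hs
  exact key s [] ∅ a (by simp) (by simp) (by simpa using hnd) (by simpa using hs)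

theorem littlestoneDim_le_add {𝒞 : Finset (Finset X)} {a h : ℕ}
    (h𝒞 : ∀ D : Finset X, D.card = a → (𝒞.filter (D ⊆ ·)).card ≤ 2 ^ h) :
    littlestoneDim 𝒞 ≤ a + h :=
  littlestoneDim_le_of_mistakeBoundLE (cautiousHalving_mistakeBoundLE h𝒞)

end Online

open StackProg

/-! ### The concept class of the reduction -/

theorem getD_unitRow {n i j : ℕ} (hi : i < n) (hj : j < n) :
    (unitRow n i).getD j false = decide (i = j) := by
  -- The shift drops the last digit, which is a zero as long as the one has not reached the end;
  -- hence the restriction to `i < n`.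
  have h1 : ∀ i < n, unitRow n i =
      List.replicate i false ++ true :: List.replicate (n - 1 - i) false := by
    intro i
    induction i with
    | zero => exact fun _ => by simp [unitRow]
    | succ i ih =>
      intro hi
      rw [unitRow, ih (by omega), List.dropLast_append_of_ne_nil (by simp)]
      obtain ⟨k, hk⟩ : ∃ k, n - 1 - i = k + 1 := ⟨n - 1 - (i + 1), by omega⟩
      have hk' : n - 1 - (i + 1) = k := by omega
      rw [hk, hk', List.replicate_succ, List.dropLast_cons_cons, List.replicate_succ,
        ← List.replicate_succ (n := k), List.dropLast_replicate]
      simp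
  rw [h1 i hi]
  rcases lt_trichotomy j i with h | h | h
  · rw [List.getD_append _ _ _ _ (by simpa using h)]
    rw [List.getD_eq_getElem _ _ (by simpa using h)]
    simp [h.ne']
  · subst h
    rw [List.getD_append_right _ _ _ _ (by simp)]
    simp
  · rw [List.getD_append_right _ _ _ _ (by simpa using h.le)]
    obtain ⟨k, rfl⟩ : ∃ k, j = i + (k + 1) := ⟨j - i - 1, by omega⟩
    simp only [List.length_replicate, Nat.add_sub_cancel_left, List.getD_cons_succ]
    rw [List.getD_eq_getElem _ _ (by simp; omega)]
    simp

theorem getD_zipWith_and (x a : List Bool) (u : ℕ) :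
    (List.zipWith and x a).getD u false = (x.getD u false && a.getD u false) := by
  simp only [List.getD_eq_getElem?_getD, List.getElem?_zipWith]
  rcases x[u]? with _ | b <;> rcases a[u]? with _ | c <;> simp

theorem card_filter_getElem {α : Type*} (x : List α) (p : α → Prop) [DecidablePred p] :
    (Finset.univ.filter fun i : Fin x.length => p x[i]).card = x.countP (fun a => decide (p a)) := by
  rw [Finset.card_filter]
  refine (Fin.sum_univ_fun_getElem x fun a => if p a then 1 else 0).trans ?_
  induction x with
  | nil => simp
  | cons a x ih => simp [List.countP_cons, ih, add_comm]

/-- The test "all ones on `D`" holds for a conjunction iff it holds for both factors, so the number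
of rows passing it is multiplicative. -/
theorem countP_andPower (l : ℕ) (A : List (List Bool)) (D : Set ℕ) (p : List Bool → Bool)
    (hp : ∀ x, p x = true ↔ ∀ u ∈ D, x.getD u false = true) :
    (andPower l A).countP p = A.countP p ^ (l + 1) := by
  have h1 : ∀ x a, p (List.zipWith and x a) = (p x && p a) := by
    intro x a
    rw [Bool.eq_iff_iff, Bool.and_eq_true, hp, hp, hp]
    simp only [getD_zipWith_and, Bool.and_eq_true]
    exact forall₂_and
  have h2 : ∀ x, (andRow A x).countP p = if p x then A.countP p else 0 := by
    intro x
    rw [andRow, List.countP_map]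
    have : p ∘ (fun a => List.zipWith and x a) = fun a => p x && p a := funext fun a => h1 x a
    rw [this]
    cases p x <;> simp
  have h3 : ∀ T, (andRows A T).countP p = T.countP p * A.countP p := by
    intro T
    induction T with
    | nil => simp [andRows]
    | cons x T ih =>
      have : andRows A (x :: T) = andRow A x ++ andRows A T := by simp [andRows]
      rw [this, List.countP_append, ih, h2, List.countP_cons]
      split_ifs <;> ring
  induction l with
  | zero => simp [andPower]
  | succ l ih => rw [andPower_succ, h3, ih, pow_succ _ (l + 1)]

theorem getD_maskRow (l L v u : ℕ) (x : List Bool) :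
    (maskRow l L v x).getD u false = (x.getD u false && maskBit l L v u) := by
  simp only [maskRow, List.getD_eq_getElem?_getD, List.getElem?_mapIdx]
  rcases x[u]? with _ | b <;> simp

open scoped Classical in
/-- The rows of the adjacency matrix of a graph. -/
def adjacencyRows {N : ℕ} (G : SimpleGraph (Fin N)) : List (List Bool) :=
  List.ofFn fun v => List.ofFn fun u => decide (G.Adj v u)

variable {N : ℕ} (G : SimpleGraph (Fin N))

theorem length_adjacencyRows : (adjacencyRows G).length = N := List.length_ofFn

theorem length_of_mem_adjacencyRows : ∀ x ∈ adjacencyRows G, x.length = N := by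
  intro x hx
  obtain ⟨v, rfl⟩ := (List.mem_ofFn' ..).1 hx
  exact List.length_ofFn

theorem encodeGraph_eq_encodeRows : encodeGraph G = encodeRows (adjacencyRows G) := by
  rw [encodeGraph, encodeMatrix, encodeRows, adjacencyRows, List.flatMap, List.map_ofFn]
  simp [Function.comp_def, List.map_ofFn]

/-- The binary digits `L` of the number of entries of the encoding of a graph. -/
abbrev codeLength (N : ℕ) : ℕ := binLength (N * (N + 1))

/-- The masked adjacency matrix. -/
def maskedRows (l : ℕ) : List (List Bool) := maskRows l (codeLength N) (adjacencyRows G)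

theorem length_maskedRows (l : ℕ) : (maskedRows G l).length = N := by
  rw [maskedRows, length_maskRows, length_adjacencyRows]

theorem length_of_mem_maskedRows (l : ℕ) : ∀ x ∈ maskedRows G l, x.length = N :=
  length_of_mem_maskRows (length_of_mem_adjacencyRows G)

theorem getD_maskedRows (l : ℕ) (v u : Fin N) :
    ((maskedRows G l)[v.val]'(by rw [length_maskedRows]; exact v.2)).getD u false = true ↔
      G.Adj v u ∧ maskBit l (codeLength N) v u = true := by
  simp only [maskedRows, maskRows, List.getElem_mapIdx]
  rw [getD_maskRow, Bool.and_eq_true]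
  simp [adjacencyRows, List.getD_eq_getElem?_getD]

theorem reductionRows_adjacencyRows (l : ℕ) : reductionRows l (adjacencyRows G) =
    appendUnitRows (N ^ (l + 1)) (andPower l (maskedRows G l)) := by
  rw [reductionRows, length_adjacencyRows, maskedRows,
    length_encodeRows_of_forall (length_of_mem_adjacencyRows G), length_adjacencyRows]

theorem length_reductionRows (l : ℕ) :
    (reductionRows l (adjacencyRows G)).length = N ^ (l + 1) := by
  rw [reductionRows_adjacencyRows, appendUnitRows, List.length_mapIdx, length_andPower,
    length_maskedRows]

theorem getElem_reductionRows (l : ℕ) {i : ℕ} (hi : i < N ^ (l + 1)) :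
    (reductionRows l (adjacencyRows G))[i]'(by rwa [length_reductionRows]) =
      (andPower l (maskedRows G l))[i]'(by rwa [length_andPower, length_maskedRows]) ++
        unitRow (N ^ (l + 1)) i := by
  simp [reductionRows_adjacencyRows, appendUnitRows]

theorem length_getElem_andPower (l : ℕ) {i : ℕ} (hi : i < (andPower l (maskedRows G l)).length) :
    (andPower l (maskedRows G l))[i].length = N :=
  length_of_mem_andPower (length_of_mem_maskedRows G l) l _ (List.getElem_mem hi)

/-- The values of the concepts of the reduction. -/
def reductionVal (l : ℕ) (i : Fin (N ^ (l + 1))) (x : Fin (N + N ^ (l + 1))) : Bool :=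
  ((reductionRows l (adjacencyRows G))[i.val]'(by rw [length_reductionRows]; exact i.2)).getD x
    false

theorem reductionVal_of_lt (l : ℕ) (i : Fin (N ^ (l + 1))) {x : Fin (N + N ^ (l + 1))}
    (hx : x.val < N) : reductionVal G l i x =
      ((andPower l (maskedRows G l))[i.val]'(by
        rw [length_andPower, length_maskedRows]; exact i.2)).getD x false := by
  rw [reductionVal, getElem_reductionRows G l i.2,
    List.getD_append _ _ _ _ (by rwa [length_getElem_andPower])]

theorem reductionVal_of_le (l : ℕ) (i : Fin (N ^ (l + 1))) {x : Fin (N + N ^ (l + 1))}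
    (hx : N ≤ x.val) : reductionVal G l i x = decide (i.val = x.val - N) := by
  rw [reductionVal, getElem_reductionRows G l i.2,
    List.getD_append_right _ _ _ _ (by rwa [length_getElem_andPower]), length_getElem_andPower,
    getD_unitRow i.2 (by omega)]

/-- The identity block separates the concepts even if several tuples give the same conjunction. -/
theorem reductionVal_injective (l : ℕ) : Function.Injective (reductionVal G l) := by
  intro i j hij
  have hx : N + i.val < N + N ^ (l + 1) := by omega
  have h1 := congrFun hij ⟨N + i.val, hx⟩
  rw [reductionVal_of_le G l i (by simp), reductionVal_of_le G l j (by simp),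
    Nat.add_sub_cancel_left, decide_eq_decide] at h1
  exact Fin.ext ((h1.1 rfl).symm)

variable {G}

/-- The concept class of the reduction. -/
def reductionClass (l : ℕ) (hN : 0 < N) (G : SimpleGraph (Fin N)) : ConceptMatrix where
  numConcepts := N ^ (l + 1)
  numPoints := N + N ^ (l + 1)
  val := reductionVal G l
  numConcepts_pos := by positivity
  val_injective := reductionVal_injective G l

theorem encode_reductionClass (l : ℕ) (hN : 0 < N) (G : SimpleGraph (Fin N)) :
    (reductionClass l hN G).encode = encodeRows (reductionRows l (adjacencyRows G)) := by
  rw [ConceptMatrix.encode, encodeMatrix, encodeRows, List.flatMap]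
  congr 1
  refine List.ext_getElem ?_ fun i hi hi' => ?_
  · simp only [List.length_ofFn, List.length_map]
    exact (length_reductionRows G l).symm
  · rw [List.getElem_ofFn, List.getElem_map]
    congr 1
    have hi2 : i < N ^ (l + 1) := by simpa [reductionClass] using hi
    have hlen : ((reductionRows l (adjacencyRows G))[i]'(by
        rwa [length_reductionRows])).length = N + N ^ (l + 1) := by
      rw [getElem_reductionRows G l hi2, List.length_append, length_getElem_andPower,
        length_unitRow (by omega)]
    refine List.ext_getElem ?_ fun j hj hj' => ?_
    · rw [List.length_ofFn, List.length_map, hlen]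
      rfl
    · rw [List.getElem_ofFn, List.getElem_map]
      congr 1
      simp only [reductionClass, reductionVal]
      exact List.getD_eq_getElem _ _ (by simpa using hj')

theorem mem_toClass_reductionClass {l : ℕ} {hN : 0 < N} {c : Finset (Fin (N + N ^ (l + 1)))} :
    c ∈ (reductionClass l hN G).toClass ↔
      ∃ i, Finset.univ.filter (fun x => reductionVal G l i x = true) = c := by
  constructor
  · intro h
    obtain ⟨i, -, hi⟩ := Finset.mem_image.1 h
    exact ⟨i, hi⟩
  · rintro ⟨i, hi⟩
    exact Finset.mem_image.2 ⟨i, Finset.mem_univ _, hi⟩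

open scoped Classical in
/-- A bound on the number of concepts that contain a given set of points. -/
theorem card_filter_toClass_le {l a b : ℕ} {hN : 0 < N} (hb : 1 ≤ b)
    (hG : ∀ D : Finset (Fin N), D.card = a →
      (Finset.univ.filter fun v : Fin N => ∀ u ∈ D, G.Adj v u).card ≤ b)
    (D : Finset (Fin (N + N ^ (l + 1)))) (hD : D.card = a) :
    ((reductionClass l hN G).toClass.filter (D ⊆ ·)).card ≤ b ^ (l + 1) := by
  classical
  have h1 : ((reductionClass l hN G).toClass.filter (D ⊆ ·)).card ≤
      (Finset.univ.filter fun i => ∀ x ∈ D, reductionVal G l i x = true).card := by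
    refine le_trans (Finset.card_le_card ?_) (Finset.card_image_le
      (f := fun i => Finset.univ.filter (fun x => reductionVal G l i x = true)))
    intro c hc
    obtain ⟨hc, hDc⟩ := Finset.mem_filter.1 hc
    obtain ⟨i, rfl⟩ := mem_toClass_reductionClass.1 hc
    refine Finset.mem_image.2 ⟨i, Finset.mem_filter.2 ⟨Finset.mem_univ _, fun x hx => ?_⟩, rfl⟩
    exact (Finset.mem_filter.1 (hDc hx)).2
  refine h1.trans ?_
  -- A point of the identity block lies in a single concept. If there is none in `D`, then `D`
  -- consists of vertices and the number of concepts is a power of the number of masked rows that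
  -- contain `D`; masking only removes entries, so `hG` bounds the latter.
  by_cases hx : ∃ x ∈ D, N ≤ x.val
  · obtain ⟨x, hxD, hx⟩ := hx
    refine le_trans (Finset.card_le_one.2 fun i hi j hj => ?_) (Nat.one_le_pow _ _ hb)
    have hi' := (Finset.mem_filter.1 hi).2 x hxD
    have hj' := (Finset.mem_filter.1 hj).2 x hxD
    rw [reductionVal_of_le G l _ hx, decide_eq_true_iff] at hi' hj'
    exact Fin.ext (hi'.trans hj'.symm)
  · push Not at hx
    have hlen : (andPower l (maskedRows G l)).length = N ^ (l + 1) := by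
      rw [length_andPower, length_maskedRows]
    have h2 : (Finset.univ.filter fun i => ∀ x ∈ D, reductionVal G l i x = true).card =
        (andPower l (maskedRows G l)).countP
          (fun y => decide (∀ x ∈ D, y.getD x.val false = true)) := by
      rw [← card_filter_getElem]
      refine Finset.card_bij (fun i _ => i.cast hlen.symm) ?_ ?_ ?_
      · intro i hi
        refine Finset.mem_filter.2 ⟨Finset.mem_univ _, fun x hxD => ?_⟩
        have := (Finset.mem_filter.1 hi).2 x hxD
        rwa [reductionVal_of_lt G l i (hx x hxD)] at this
      · intro i _ j _ hij
        simpa [Fin.ext_iff] using hij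
      · intro i hi
        refine ⟨i.cast hlen, Finset.mem_filter.2 ⟨Finset.mem_univ _, fun x hxD => ?_⟩, rfl⟩
        rw [reductionVal_of_lt G l _ (hx x hxD)]
        exact (Finset.mem_filter.1 hi).2 x hxD
    rw [h2, countP_andPower l _ {u | ∃ x ∈ D, x.val = u} _ (by
      intro y
      rw [decide_eq_true_iff]
      constructor
      · rintro h u ⟨x, hxD, rfl⟩
        exact h x hxD
      · exact fun h x hxD => h _ ⟨x, hxD, rfl⟩), ← card_filter_getElem]
    refine Nat.pow_le_pow_left ?_ _
    refine le_trans ?_ (hG (D.attach.image fun x => ⟨x.1.val, hx x.1 x.2⟩) ?_)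
    · refine Finset.card_le_card_of_injOn
        (fun i : Fin (maskedRows G l).length => i.cast (length_maskedRows G l)) ?_ ?_
      · intro i hi
        refine Finset.mem_coe.2 (Finset.mem_filter.2 ⟨Finset.mem_univ _, fun u hu => ?_⟩)
        obtain ⟨x, -, rfl⟩ := Finset.mem_image.1 hu
        have := (Finset.mem_filter.1 hi).2 x.1 x.2
        exact ((getD_maskedRows G l (i.cast (length_maskedRows G l))
          ⟨x.1.val, hx x.1 x.2⟩).1 this).1
      · intro i _ j _ hij
        simpa [Fin.ext_iff] using hij
    · rw [Finset.card_image_of_injective, Finset.card_attach, hD]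
      intro x y hxy
      exact Subtype.ext (Fin.ext (Fin.mk.inj hxy))

/-! ### Binary labels and shattering by cliques -/

theorem getD_eq_testBit_binVal (x : List Bool) (b : ℕ) :
    x.getD b false = (binVal x).testBit b := by
  induction x generalizing b with
  | nil => simp [binVal]
  | cons c x ih =>
    cases b with
    | zero => cases c <;> simp [binVal, Nat.testBit_zero]
    | succ b =>
      rw [List.getD_cons_succ, ih, Nat.testBit_succ]
      congr 1
      cases c <;> simp [binVal]; omega

theorem length_binSucc {x : List Bool} (h : binVal x + 1 < 2 ^ x.length) :
    (binSucc x).length = x.length := by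
  induction x with
  | nil => simp [binVal] at h
  | cons c x ih =>
    cases c with
    | false => rfl
    | true =>
      rw [binSucc, List.length_cons, List.length_cons, ih]
      rw [List.length_cons, pow_succ, binVal] at h
      simp at h
      omega

theorem binVal_replicate_false (L : ℕ) : binVal (List.replicate L false) = 0 := by
  induction L with
  | zero => rfl
  | succ L ih => simp [List.replicate_succ, binVal, ih]

theorem binVal_vertexLabel (l L v : ℕ) : binVal (vertexLabel l L v) = v / (l + 1) := by
  unfold vertexLabel
  generalize v / (l + 1) = k
  induction k with
  | zero => exact binVal_replicate_false L
  | succ k ih => rw [Function.iterate_succ_apply', binVal_binSucc, ih]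

theorem length_vertexLabel {l L v : ℕ} (hv : v < 2 ^ L) : (vertexLabel l L v).length = L := by
  have hk : v / (l + 1) < 2 ^ L := (Nat.div_le_self _ _).trans_lt hv
  have key : ∀ k < 2 ^ L, (binSucc^[k] (List.replicate L false)).length = L ∧
      binVal (binSucc^[k] (List.replicate L false)) = k := by
    intro k
    induction k with
    | zero => exact fun _ => ⟨by simp, binVal_replicate_false L⟩
    | succ k ih =>
      intro hk
      obtain ⟨h1, h2⟩ := ih (by omega)
      rw [Function.iterate_succ_apply']
      refine ⟨?_, by rw [binVal_binSucc, h2]⟩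
      rw [length_binSucc (by rw [h1, h2]; exact hk), h1]
  exact (key _ hk).1

/-- Below `2 ^ L` the label never outgrows its `L` digits, so the cyclic reading of the machine
becomes division by the fixed number `L`. -/
theorem maskBit_eq {l L v u : ℕ} (hv : v < 2 ^ L) : maskBit l L v u =
    (decide (u / L % (l + 1) ≠ v % (l + 1)) || (v / (l + 1)).testBit (u % L)) := by
  rw [maskBit, length_vertexLabel hv, getD_eq_testBit_binVal, binVal_vertexLabel]

theorem binVal_lt_two_pow (x : List Bool) : binVal x < 2 ^ x.length := by
  induction x with
  | nil => simp [binVal]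
  | cons c x ih =>
    rw [binVal, List.length_cons, pow_succ]
    cases c <;> simp <;> omega

theorem lt_two_pow_binLength (n : ℕ) : n < 2 ^ binLength n := by
  have := binVal_lt_two_pow (binSucc^[n] [])
  rwa [binVal_iterate_binSucc] at this

theorem exists_mem_andPower (A : List (List Bool)) (f : ℕ → List Bool) (l : ℕ)
    (hf : ∀ j ≤ l, f j ∈ A) : ∃ y ∈ andPower l A, ∀ u,
      (y.getD u false = true ↔ ∀ j ≤ l, (f j).getD u false = true) := by
  induction l with
  | zero => exact ⟨f 0, hf 0 le_rfl, fun u => by simp⟩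
  | succ l ih =>
    obtain ⟨y, hy, hyu⟩ := ih fun j hj => hf j (by omega)
    refine ⟨List.zipWith and y (f (l + 1)), ?_, fun u => ?_⟩
    · rw [andPower_succ, mem_andRows]
      exact ⟨y, hy, f (l + 1), hf _ le_rfl, rfl⟩
    · rw [getD_zipWith_and, Bool.and_eq_true, hyu]
      constructor
      · rintro ⟨h1, h2⟩ j hj
        rcases Nat.le_succ_iff.1 hj with hj | rfl
        · exact h1 j hj
        · exact h2
      · exact fun h => ⟨fun j hj => h j (by omega), h _ le_rfl⟩

/-- A clique that meets sufficiently many residue classes yields a large shattered set. -/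
theorem le_vcDim_reductionClass {l m : ℕ} {hN : 0 < N} (K : Finset (Fin N))
    (hK : ∀ u ∈ K, ∀ v ∈ K, u ≠ v → G.Adj u v)
    (hU : ∀ j < l + 1, ∀ b < m, ∃ u ∈ K, u.val < N / 2 ∧
      u.val / codeLength N % (l + 1) = j ∧ u.val % codeLength N = b)
    (hV : ∀ j < l + 1, ∀ k < 2 ^ m, ∃ v ∈ K, N / 2 ≤ v.val ∧
      v.val % (l + 1) = j ∧ v.val / (l + 1) % 2 ^ m = k) :
    (l + 1) * m ≤ (reductionClass l hN G).vcDim := by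
  classical
  set L := codeLength N with hL
  have : Nonempty (Fin N) := ⟨⟨0, hN⟩⟩
  choose! pt hptK hptN hptj hptb using hU
  choose! vt hvtK hvtN hvtj hvtk using hV
  have hNL : ∀ v : Fin N, v.val < 2 ^ L := fun v => by
    have h1 := lt_two_pow_binLength (N * (N + 1))
    have h2 : N ≤ N * (N + 1) := Nat.le_mul_of_pos_right N (by omega)
    exact v.2.trans_le (h2.trans h1.le)
  let e : Fin (l + 1) × Fin m → Fin (N + N ^ (l + 1)) := fun p =>
    (pt p.1 p.2).castAdd _
  have he : Function.Injective e := by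
    rintro ⟨j, b⟩ ⟨j', b'⟩ h
    have h1 : pt j b = pt j' b' := Fin.castAdd_injective _ _ h
    have h2 := hptj j j.2 b b.2
    have h3 := hptb j j.2 b b.2
    rw [h1, hptj j' j'.2 b' b'.2] at h2
    rw [h1, hptb j' j'.2 b' b'.2] at h3
    simp [Fin.ext_iff, h2, h3]
  have hcard : (Finset.univ.image e).card = (l + 1) * m := by
    rw [Finset.card_image_of_injective _ he]
    simp
  rw [← hcard]
  refine Finset.Shatters.card_le_vcDim fun t ht => ?_
  -- The bits of `lab j` are the pattern of `t` on block `j`; below, `w j` is a clique vertex of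
  -- block `j` whose label ends in these bits.
  let lab : ℕ → ℕ := fun j => Nat.ofBits fun b : Fin m =>
    decide (∃ h : j < l + 1, e (⟨j, h⟩, b) ∈ t)
  have hlab : ∀ j, lab j < 2 ^ m := fun j => Nat.ofBits_lt_two_pow _
  let w : ℕ → Fin N := fun j => vt j (lab j)
  obtain ⟨y, hy, hyu⟩ := exists_mem_andPower (maskedRows G l)
    (fun j => (maskedRows G l)[(w j).val]'(by rw [length_maskedRows]; exact (w j).2)) l
    (fun j _ => List.getElem_mem _)
  obtain ⟨i, hi, rfl⟩ := List.getElem_of_mem hy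
  have hi' : i < N ^ (l + 1) := by rwa [length_andPower, length_maskedRows] at hi
  refine ⟨_, mem_toClass_reductionClass.2 ⟨⟨i, hi'⟩, rfl⟩, ?_⟩
  have hval : ∀ p, reductionVal G l ⟨i, hi'⟩ (e p) = true ↔ e p ∈ t := by
    rintro ⟨j, b⟩
    rw [reductionVal_of_lt G l _ (by simp [e])]
    have h1 := hyu (pt j b).val
    rw [show ((e (j, b)).val : ℕ) = (pt j b).val from rfl, h1]
    -- The row of block `j'` imposes no condition on points of other blocks, so the conjunction of
    -- all rows realizes `t` on every block at once.
    have h2 : ∀ j' ≤ l, (((maskedRows G l)[(w j').val]'(by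
        rw [length_maskedRows]; exact (w j').2)).getD (pt j b).val false = true ↔
        (j.val ≠ j' ∨ e (j, b) ∈ t)) := by
      intro j' hj'
      have hj'' : j' < l + 1 := by omega
      rw [getD_maskedRows, maskBit_eq (hNL _), hptj j j.2 b b.2, hptb j j.2 b b.2,
        hvtj j' hj'' _ (hlab j')]
      -- Points and rows come from different halves of the vertices. They are therefore distinct,
      -- and the clique makes them adjacent.
      have hadj : G.Adj (w j') (pt j b) := by
        refine hK _ (hvtK j' hj'' _ (hlab j')) _ (hptK j j.2 b b.2) fun h => ?_
        have h3 := hvtN j' hj'' _ (hlab j')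
        have h4 := hptN j j.2 b b.2
        rw [h] at h3
        omega
      have hbit : ((w j').val / (l + 1)).testBit b.val = decide (e (⟨j', hj''⟩, b) ∈ t) := by
        have h3 := Nat.testBit_mod_two_pow ((w j').val / (l + 1)) m b.val
        rw [hvtk j' hj'' _ (hlab j')] at h3
        simp only [b.2, decide_true, Bool.true_and] at h3
        rw [← h3]
        simp only [lab, Nat.testBit_ofBits_lt _ _ b.2]
        simp [hj'']
      simp only [hadj, true_and, Bool.or_eq_true, decide_eq_true_iff]
      rw [hbit, decide_eq_true_iff]
      by_cases hjj : j.val = j'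
      · subst hjj
        simp
      · simp [hjj]
    constructor
    · intro h
      have := (h2 j.val (by omega)).1 (h j.val (by omega))
      simpa using this
    · exact fun h j' hj' => (h2 j' hj').2 (Or.inr h)
  refine Finset.ext fun x => ⟨fun hx => ?_, fun hx => ?_⟩
  · obtain ⟨hx, hv⟩ := Finset.mem_inter.1 hx
    obtain ⟨p, -, rfl⟩ := Finset.mem_image.1 hx
    exact (hval p).1 (Finset.mem_filter.1 hv).2
  · obtain ⟨p, -, rfl⟩ := Finset.mem_image.1 (ht hx)
    exact Finset.mem_inter.2 ⟨ht hx, Finset.mem_filter.2 ⟨Finset.mem_univ _, (hval p).2 hx⟩⟩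

/-! ### Random graphs, planted cliques and counting of vertex sets -/

open StackProg

/-- On a finite vertex set this makes every function of the graph measurable and integrable. -/
instance SimpleGraph.instMeasurableSingletonClass {V : Type*} [Countable V] :
    MeasurableSingletonClass (SimpleGraph V) where
  measurableSet_singleton G := by
    have h := (SimpleGraph.measurable_edgeSet (V := V)) (measurableSet_singleton G.edgeSet)
    have : (SimpleGraph.edgeSet ⁻¹' {G.edgeSet} : Set (SimpleGraph V)) = {G} := by
      ext H
      simp
    rwa [this] at h

-- The event is a cylinder of the product measure; each coordinate in `F` contributes the factor
-- `p`, or `0` if it lies outside `u`.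
open ProbabilityTheory in
theorem setBernoulli_superset_le {ι : Type*} (u : Set ι) (p : unitInterval) (F : Finset ι) :
    setBernoulli u p {s | ↑F ⊆ s} ≤ (unitInterval.toNNReal p : ENNReal) ^ F.card := by
  rw [setBernoulli_apply']
  have h : ((fun q : ι → Prop => {i | q i}) ⁻¹' {s | ↑F ⊆ s}) =
      Set.pi (F : Set ι) fun _ => {True} := by
    ext q
    simp [Set.subset_def, Set.mem_pi]
  rw [h, Measure.infinitePi_pi _ (fun _ _ => measurableSet_singleton _)]
  refine Finset.prod_le_pow_card _ _ _ fun i _ => ?_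
  by_cases hi : i ∈ u
  · simp [hi]
  · simp [hi]

theorem binomialRandom_superset_le {V : Type*} [Countable V] (p : unitInterval)
    (F : Finset (Sym2 V)) :
    SimpleGraph.binomialRandom V p {G | ↑F ⊆ G.edgeSet} ≤
      (unitInterval.toNNReal p : ENNReal) ^ F.card := by
  rw [SimpleGraph.binomialRandom_apply']
  refine le_trans (measure_mono ?_) (setBernoulli_superset_le _ p F)
  rintro _ ⟨G, hG, rfl⟩
  exact hG

/-- The vertices of `D` are adjacent to those of `B`. -/
def CompleteBetween {V : Type*} (G : SimpleGraph V) (D B : Finset V) : Prop :=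
  ∀ v ∈ B, ∀ u ∈ D, G.Adj v u

/-- For disjoint sets the pairs are distinct potential edges, each present with probability `p`. If
the sets share a vertex, the event would force a loop and is empty. -/
theorem binomialRandom_completeBetween_le {V : Type*} [Countable V]
    (p : unitInterval) (D B : Finset V) :
    SimpleGraph.binomialRandom V p {G | CompleteBetween G D B} ≤
      (unitInterval.toNNReal p : ENNReal) ^ (D.card * B.card) := by
  classical
  by_cases hDB : Disjoint D B
  · have hcard : ((D ×ˢ B).image fun q => s(q.1, q.2)).card = D.card * B.card := by
      rw [Finset.card_image_of_injOn, Finset.card_product]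
      rintro ⟨u, v⟩ h1 ⟨u', v'⟩ h2 h
      obtain ⟨hu, hv⟩ := Finset.mem_product.1 (Finset.mem_coe.1 h1)
      obtain ⟨hu', hv'⟩ := Finset.mem_product.1 (Finset.mem_coe.1 h2)
      rcases Sym2.eq_iff.1 h with ⟨h3, h4⟩ | ⟨h3, h4⟩
      · exact Prod.ext h3 h4
      · dsimp only at h3 hu hv'
        exact absurd (h3 ▸ hv') (Finset.disjoint_left.1 hDB hu)
    rw [← hcard]
    refine le_trans (measure_mono fun G hG => ?_) (binomialRandom_superset_le p _)
    intro e he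
    obtain ⟨⟨u, v⟩, hq, rfl⟩ := Finset.mem_image.1 (Finset.mem_coe.1 he)
    obtain ⟨hu, hv⟩ := Finset.mem_product.1 hq
    exact (hG v hv u hu).symm
  · obtain ⟨u, hu, hu'⟩ := Finset.not_disjoint_iff.1 hDB
    have : {G : SimpleGraph V | CompleteBetween G D B} = ∅ := by
      ext G
      simp only [Set.mem_ofPred_eq, Set.mem_empty_iff_false, iff_false]
      exact fun h => G.loopless.irrefl u (h u hu' u hu)
    rw [this]
    simp

/-- The union bound for complete bipartite pairs of size `a` in a random graph. -/
theorem binomialRandom_exists_completeBetween_le (N a : ℕ) :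
    (SimpleGraph.binomialRandom (Fin N) edgeHalf).real
      {G | ∃ D B : Finset (Fin N), D.card = a ∧ B.card = a ∧ CompleteBetween G D B} ≤
      (N : ℝ) ^ (2 * a) * (1 / 2) ^ (a * a) := by
  have h1 : {G : SimpleGraph (Fin N) | ∃ D B : Finset (Fin N), D.card = a ∧ B.card = a ∧
      CompleteBetween G D B} = ⋃ q ∈ (Finset.univ : Finset (Fin N)).powersetCard a ×ˢ
        (Finset.univ : Finset (Fin N)).powersetCard a, {G | CompleteBetween G q.1 q.2} := by
    ext G
    simp only [Set.mem_ofPred_eq, Set.mem_iUnion, Finset.mem_product, Finset.mem_powersetCard,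
      Finset.subset_univ, true_and, Prod.exists, exists_prop, and_assoc]
  rw [h1]
  refine (measureReal_biUnion_finset_le _ _).trans ?_
  have h2 : ∀ q ∈ (Finset.univ : Finset (Fin N)).powersetCard a ×ˢ
      (Finset.univ : Finset (Fin N)).powersetCard a,
      (SimpleGraph.binomialRandom (Fin N) edgeHalf).real {G | CompleteBetween G q.1 q.2} ≤
        (1 / 2) ^ (a * a) := by
    intro q hq
    obtain ⟨hD, hB⟩ := Finset.mem_product.1 hq
    have h3 := binomialRandom_completeBetween_le edgeHalf q.1 q.2
    rw [(Finset.mem_powersetCard.1 hD).2, (Finset.mem_powersetCard.1 hB).2] at h3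
    refine (ENNReal.toReal_mono (by simp) h3).trans_eq ?_
    have h4 : ((unitInterval.toNNReal edgeHalf : ENNReal)).toReal = 1 / 2 := rfl
    rw [ENNReal.toReal_pow, h4]
  refine (Finset.sum_le_card_nsmul _ _ _ h2).trans ?_
  rw [nsmul_eq_mul, Finset.card_product, Finset.card_powersetCard, Finset.card_univ,
    Fintype.card_fin]
  gcongr
  rw [two_mul, pow_add]
  exact_mod_cast Nat.mul_le_mul (Nat.choose_le_pow N a) (Nat.choose_le_pow N a)

/-- A function with values in `[0, 1]` that vanishes off `{G | P G}` has integral at most the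
measure of that set. -/
theorem integral_le_measureReal {Ω : Type*} [Finite Ω] [MeasurableSpace Ω]
    [MeasurableSingletonClass Ω] (μ : Measure Ω) [IsFiniteMeasure μ] {f : Ω → ℝ} {P : Ω → Prop}
    (h1 : ∀ ω, f ω ≤ 1) (h0 : ∀ ω, ¬ P ω → f ω = 0) :
    ∫ ω, f ω ∂μ ≤ μ.real {ω | P ω} := by
  rw [← integral_indicator_one (Set.toFinite _).measurableSet]
  refine integral_mono Integrable.of_finite Integrable.of_finite fun ω => ?_
  by_cases hω : P ω
  · simpa [Set.indicator, hω] using h1 ω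
  · simp [Set.indicator, hω, h0 ω hω]

theorem integral_plantedRandom {N κ : ℕ} (f : SimpleGraph (Fin N) → ℝ) :
    ∫ G, f G ∂(plantedRandom (Fin N) edgeHalf κ) = ((N.choose κ : ℕ) : ℝ)⁻¹ *
      ∑ S ∈ Finset.powersetCard κ (Finset.univ : Finset (Fin N)),
        ∫ G, f (plantClique G S) ∂(SimpleGraph.binomialRandom (Fin N) edgeHalf) := by
  rw [plantedRandom, integral_smul_measure, integral_finsetSum_measure
    (fun _ _ => Integrable.of_finite)]
  simp only [Finset.card_powersetCard, Finset.card_univ, Fintype.card_fin, ENNReal.toReal_inv,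
    ENNReal.toReal_natCast, smul_eq_mul]
  congr 1
  refine Finset.sum_congr rfl fun S _ => ?_
  exact integral_map (measurable_of_finite _).aemeasurable
    (measurable_of_finite _).aestronglyMeasurable

/-- A function that is `1` on all graphs with a clique planted at a set outside `bad` has a large
integral if few sets are in `bad`. -/
theorem two_thirds_le_integral_plantedRandom {N κ : ℕ} (hκ : κ ≤ N)
    {f : SimpleGraph (Fin N) → ℝ} (h0 : ∀ G, 0 ≤ f G)
    (bad : Finset (Finset (Fin N))) (hbad : (bad.card : ℝ) ≤ 1 / 3 * (N.choose κ : ℕ))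
    (h1 : ∀ S : Finset (Fin N), S.card = κ → S ∉ bad → ∀ G, f (plantClique G S) = 1) :
    2 / 3 ≤ ∫ G, f G ∂(plantedRandom (Fin N) edgeHalf κ) := by
  classical
  rw [integral_plantedRandom]
  have hpos : (0 : ℝ) < (N.choose κ : ℕ) := by exact_mod_cast Nat.choose_pos hκ
  rw [inv_mul_eq_div, le_div_iff₀ hpos]
  set P := Finset.powersetCard κ (Finset.univ : Finset (Fin N)) with hP
  have hPcard : P.card = N.choose κ := by simp [hP]
  have h2 : ((P \ bad).card : ℝ) ≤ ∑ S ∈ P, ∫ G, f (plantClique G S)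
      ∂(SimpleGraph.binomialRandom (Fin N) edgeHalf) := by
    refine le_trans ?_ (Finset.sum_le_sum_of_subset_of_nonneg (Finset.sdiff_subset (t := bad))
      fun S _ _ => integral_nonneg fun G => h0 _)
    rw [Finset.card_eq_sum_ones, Nat.cast_sum]
    refine Finset.sum_le_sum fun S hS => ?_
    obtain ⟨hS, hSb⟩ := Finset.mem_sdiff.1 hS
    simp only [h1 S (Finset.mem_powersetCard.1 hS).2 hSb]
    simp
  have h3 : P.card ≤ (P \ bad).card + bad.card := by
    have := Finset.le_card_sdiff bad P
    omega
  have h4 : (P.card : ℝ) ≤ (P \ bad).card + bad.card := by exact_mod_cast h3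
  rw [hPcard] at h4
  linarith

theorem descFactorial_mul_pow_le {n N : ℕ} (h : n ≤ N) (κ : ℕ) :
    n.descFactorial κ * N ^ κ ≤ N.descFactorial κ * n ^ κ := by
  induction κ with
  | zero => simp
  | succ κ ih =>
    have h1 : (n - κ) * N ≤ (N - κ) * n := by
      rw [Nat.sub_mul, Nat.sub_mul, mul_comm N n]
      exact Nat.sub_le_sub_left (Nat.mul_le_mul_left κ h) _
    calc n.descFactorial (κ + 1) * N ^ (κ + 1)
        = ((n - κ) * N) * (n.descFactorial κ * N ^ κ) := by
          rw [Nat.descFactorial_succ, pow_succ]; ring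
      _ ≤ ((N - κ) * n) * (N.descFactorial κ * n ^ κ) := Nat.mul_le_mul h1 ih
      _ = N.descFactorial (κ + 1) * n ^ (κ + 1) := by
          rw [Nat.descFactorial_succ, pow_succ]; ring

/-- In probabilistic terms, a uniform `κ`-set lies inside a given `n`-set with probability at most
`(n / N) ^ κ`: sampling without replacement is no better than with it. -/
theorem choose_mul_pow_le {n N : ℕ} (h : n ≤ N) (κ : ℕ) :
    n.choose κ * N ^ κ ≤ N.choose κ * n ^ κ := by
  have h1 := descFactorial_mul_pow_le h κ
  rw [Nat.descFactorial_eq_factorial_mul_choose, Nat.descFactorial_eq_factorial_mul_choose,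
    mul_assoc, mul_assoc] at h1
  exact Nat.le_of_mul_le_mul_left h1 κ.factorial_pos

/-- The number of `κ`-sets that avoid a set with at least `c * N` elements. -/
theorem card_filter_disjoint_le {N : ℕ} (hN : 0 < N) (κ : ℕ) {c : ℝ} (R : Finset (Fin N))
    (hR : c * N ≤ R.card) :
    ((((Finset.univ : Finset (Fin N)).powersetCard κ).filter (Disjoint R ·)).card : ℝ) ≤
      Real.exp (-(c * κ)) * (N.choose κ : ℕ) := by
  classical
  have h1 : (((Finset.univ : Finset (Fin N)).powersetCard κ).filter (Disjoint R ·)).card =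
      (N - R.card).choose κ := by
    have : ((Finset.univ : Finset (Fin N)).powersetCard κ).filter (Disjoint R ·) =
        Rᶜ.powersetCard κ := by
      ext S
      simp only [Finset.mem_filter, Finset.mem_powersetCard, Finset.subset_univ, true_and,
        Finset.subset_compl_iff_disjoint_left, and_comm]
    rw [this, Finset.card_powersetCard, Finset.card_compl, Fintype.card_fin]
  have hRN : R.card ≤ N := by simpa using Finset.card_le_univ R
  have hN' : (0 : ℝ) < N := by exact_mod_cast hN
  have h2 : ((N - R.card).choose κ : ℝ) * (N : ℝ) ^ κ ≤
      (N.choose κ : ℕ) * ((N : ℝ) - R.card) ^ κ := by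
    rw [← Nat.cast_sub hRN]
    exact_mod_cast choose_mul_pow_le (Nat.sub_le N R.card) κ
  rw [h1, ← mul_le_mul_iff_left₀ (pow_pos hN' κ)]
  refine h2.trans ?_
  rw [mul_comm (Real.exp _), mul_assoc]
  refine mul_le_mul_of_nonneg_left ?_ (Nat.cast_nonneg _)
  rw [show -(c * (κ : ℝ)) = (κ : ℝ) * (-c) by ring, Real.exp_nat_mul, ← mul_pow]
  refine pow_le_pow_left₀ (by rw [sub_nonneg]; exact_mod_cast hRN) ?_ κ
  -- The proportion of sets avoiding `R` is at most `(1 - R.card / N) ^ κ`, hence at most `(1 - c) ^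
  -- κ` and `exp (-c * κ)`.
  have h3 : 1 - c ≤ Real.exp (-c) := by linarith [Real.add_one_le_exp (-c)]
  nlinarith

/-- The number of `κ`-sets that avoid some set of a family of sets with at least `c * N`
elements. -/
theorem card_filter_exists_disjoint_le {ι : Type*} {N : ℕ} (hN : 0 < N) (κ : ℕ) {c : ℝ}
    (I : Finset ι) (R : ι → Finset (Fin N)) (hR : ∀ i ∈ I, c * N ≤ (R i).card) :
    ((((Finset.univ : Finset (Fin N)).powersetCard κ).filter
      (fun S => ∃ i ∈ I, Disjoint (R i) S)).card : ℝ) ≤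
      I.card * Real.exp (-(c * κ)) * (N.choose κ : ℕ) := by
  classical
  have h1 : ((Finset.univ : Finset (Fin N)).powersetCard κ).filter
      (fun S => ∃ i ∈ I, Disjoint (R i) S) =
      I.biUnion fun i => ((Finset.univ : Finset (Fin N)).powersetCard κ).filter
        (Disjoint (R i) ·) := by
    ext S
    simp only [Finset.mem_filter, Finset.mem_biUnion]
    grind
  rw [h1]
  calc _ ≤ ((∑ i ∈ I, (((Finset.univ : Finset (Fin N)).powersetCard κ).filter
        (Disjoint (R i) ·)).card : ℕ) : ℝ) := by exact_mod_cast Finset.card_biUnion_le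
    _ ≤ ∑ i ∈ I, Real.exp (-(c * κ)) * (N.choose κ : ℕ) := by
      rw [Nat.cast_sum]
      exact Finset.sum_le_sum fun i hi => card_filter_disjoint_le hN κ _ (hR i hi)
    _ = _ := by rw [Finset.sum_const, nsmul_eq_mul, mul_assoc]

/-- The vertices in `[lo, hi)` in a given residue class. -/
def residueSet (N lo hi q c : ℕ) : Finset (Fin N) :=
  Finset.univ.filter fun u => lo ≤ u.val ∧ u.val < hi ∧ u.val % q = c

theorem le_card_residueSet {N lo hi q c : ℕ} (hhi : hi ≤ N) (hc : c < q) :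
    ((hi : ℝ) - lo) / q - 1 ≤ (residueSet N lo hi q c).card := by
  have h1 : (residueSet N lo hi q c).card =
      ((Finset.Ico lo hi).filter (· ≡ c [MOD q])).card := by
    rw [← Finset.card_map Fin.valEmbedding]
    congr 1
    ext u
    simp only [residueSet, Finset.mem_map, Finset.mem_filter, Finset.mem_univ, true_and,
      Finset.mem_Ico, Fin.valEmbedding_apply, Nat.ModEq, Nat.mod_eq_of_lt hc]
    constructor
    · rintro ⟨v, hv, rfl⟩
      tauto
    · rintro ⟨⟨h2, h3⟩, h4⟩
      exact ⟨⟨u, by omega⟩, ⟨h2, h3, h4⟩, rfl⟩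
  have hq : (0 : ℝ) < q := by exact_mod_cast (Nat.zero_le c).trans_lt hc
  have h2 := Nat.Ico_filter_modEq_card (a := lo) (b := hi) (r := q) (by omega) c
  rw [h1]
  have h3 : ((((Finset.Ico lo hi).filter (· ≡ c [MOD q])).card : ℤ) : ℝ) = 
      ((max (⌈((hi : ℚ) - c) / q⌉ - ⌈((lo : ℚ) - c) / q⌉) 0 : ℤ) : ℝ) := by rw [h2]
  rw [Int.cast_natCast] at h3
  rw [h3]
  have h4 : ((⌈((hi : ℚ) - c) / q⌉ - ⌈((lo : ℚ) - c) / q⌉ : ℤ) : ℚ) ≥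
      ((hi : ℚ) - lo) / q - 1 := by
    have h5 := Int.le_ceil (((hi : ℚ) - c) / q)
    have h6 := Int.ceil_lt_add_one (((lo : ℚ) - c) / q)
    have h7 : ((hi : ℚ) - lo) / q = ((hi : ℚ) - c) / q - ((lo : ℚ) - c) / q := by ring
    push_cast
    linarith
  have h5 : (((hi : ℚ) - lo) / q - 1 : ℚ) ≤
      ((max (⌈((hi : ℚ) - c) / q⌉ - ⌈((lo : ℚ) - c) / q⌉) 0 : ℤ) : ℚ) :=
    h4.le.trans (by exact_mod_cast le_max_left _ _)
  have h6 := (Rat.cast_le (K := ℝ)).2 h5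
  rw [Rat.cast_intCast] at h6
  refine le_trans (le_of_eq ?_) h6
  push_cast
  rfl

/-! ### The dimensions of the class for random and for planted graphs -/

open StackProg

/-- The hypothesis says that the most significant digit is a one; incrementing preserves this, which
bounds the number of digits from above. -/
theorem two_pow_length_binSucc_le (x : List Bool) (hx : x = [] ∨ 2 ^ x.length ≤ 2 * binVal x) :
    2 ^ (binSucc x).length ≤ 2 * binVal (binSucc x) := by
  induction x with
  | nil => simp [binSucc, binVal]
  | cons c x ih =>
    rw [binVal_binSucc]
    replace hx := hx.resolve_left (List.cons_ne_nil _ _)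
    cases c with
    | false =>
      rw [show (binSucc (false :: x)).length = (false :: x).length from rfl]
      omega
    | true =>
      rw [List.length_cons, pow_succ, binVal] at hx
      simp only [Bool.toNat_true] at hx
      have h1 : x = [] ∨ 2 ^ x.length ≤ 2 * binVal x := by
        rcases x with _ | ⟨d, x⟩
        · exact Or.inl rfl
        · right
          rw [List.length_cons, pow_succ] at hx ⊢
          omega
      have h2 := ih h1
      rw [binVal_binSucc] at h2
      rw [binSucc, List.length_cons, pow_succ, binVal]
      simp only [Bool.toNat_true]
      omega

theorem two_pow_binLength_le {n : ℕ} (hn : 0 < n) : 2 ^ binLength n ≤ 2 * n := by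
  have key : ∀ k, (binSucc^[k] [] = [] ∨
      2 ^ (binSucc^[k] []).length ≤ 2 * binVal (binSucc^[k] [])) := by
    intro k
    induction k with
    | zero => exact Or.inl rfl
    | succ k ih =>
      rw [Function.iterate_succ_apply']
      exact Or.inr (two_pow_length_binSucc_le _ ih)
  rcases key n with h | h
  · have := binVal_iterate_binSucc n
    rw [h] at this
    simp [binVal] at this
    omega
  · rwa [binVal_iterate_binSucc] at h

/-- The dimension of the reduction is small if there is no large complete bipartite pair. -/
theorem ldim_reductionClass_le {N l a : ℕ} (hN : 0 < N) (ha : 1 ≤ a) {G : SimpleGraph (Fin N)}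
    (hG : ¬ ∃ D B : Finset (Fin N), D.card = a ∧ B.card = a ∧ CompleteBetween G D B) :
    (reductionClass l hN G).ldim ≤ a + (l + 1) * Nat.clog 2 a := by
  classical
  refine littlestoneDim_le_add fun D hD => ?_
  refine (card_filter_toClass_le (b := a) ha (fun D hD => ?_) D hD).trans ?_
  -- More than `a` common neighbours of `D` would contain a set `B` of size `a`, a forbidden pair.
  · by_contra! h
    obtain ⟨B, hB, hBa⟩ := Finset.exists_subset_card_eq h.le
    exact hG ⟨D, B, hD, hBa, fun v hv => (Finset.mem_filter.1 (hB hv)).2⟩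
  · rw [mul_comm, pow_mul]
    exact Nat.pow_le_pow_left (Nat.le_pow_clog one_lt_two a) _

/-- The residue classes that a clique has to meet. -/
def cliqueTarget (N l m : ℕ) : ℕ × ℕ ⊕ ℕ × ℕ → Finset (Fin N)
  | .inl (j, b) => residueSet N 0 (N / 2) (codeLength N * (l + 1)) (b + codeLength N * j)
  | .inr (j, k) => residueSet N (N / 2) N ((l + 1) * 2 ^ m) (j + (l + 1) * k)

/-- The labels of the residue classes that a clique has to meet. -/
def cliqueTargetIndex (l m : ℕ) : Finset (ℕ × ℕ ⊕ ℕ × ℕ) :=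
  (Finset.range (l + 1) ×ˢ Finset.range m).disjSum (Finset.range (l + 1) ×ˢ Finset.range (2 ^ m))

theorem card_cliqueTargetIndex (l m : ℕ) :
    (cliqueTargetIndex l m).card = (l + 1) * m + (l + 1) * 2 ^ m := by
  simp [cliqueTargetIndex]

/-- Mixed radix: one residue modulo `p * q` prescribes two digits, so every requirement on the
clique amounts to meeting a single residue class. -/
theorem add_mul_mod_mul {a b p q u : ℕ} (ha : a < p) (h : u % (p * q) = a + p * b) :
    u % p = a ∧ (b < q → u / p % q = b) := by
  rw [Nat.mod_mul] at h
  have h1 : u % p = a := by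
    have := congrArg (· % p) h
    simpa [Nat.add_mul_mod_self_left, Nat.mod_eq_of_lt ha] using this
  refine ⟨h1, fun _ => ?_⟩
  rw [h1] at h
  exact Nat.eq_of_mul_eq_mul_left (by omega) (Nat.add_left_cancel h)

/-- A planted clique that meets all target classes yields a large VC dimension. -/
theorem le_vcDim_reductionClass_plantClique {N l m : ℕ} (hN : 0 < N) (hm : m ≤ codeLength N)
    (G : SimpleGraph (Fin N)) (S : Finset (Fin N))
    (hS : ∀ i ∈ cliqueTargetIndex l m, ¬ Disjoint (cliqueTarget N l m i) S) :
    (l + 1) * m ≤ (reductionClass l hN (plantClique G S)).vcDim := by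
  refine le_vcDim_reductionClass S (fun u hu v hv huv => ?_) (fun j hj b hb => ?_)
    (fun j hj k hk => ?_)
  · exact Or.inr ((SimpleGraph.fromRel_adj _ _ _).2 ⟨huv, Or.inl ⟨hu, hv⟩⟩)
  · have h := hS (.inl (j, b)) (by simp [cliqueTargetIndex, hj, hb])
    obtain ⟨u, hu, huS⟩ := Finset.not_disjoint_iff.1 h
    obtain ⟨-, -, hu2, hu3⟩ := Finset.mem_filter.1 hu
    -- Bit positions are residues modulo `codeLength N`, so `m ≤ codeLength N` is needed for `b` to
    -- be one.
    have h4 := add_mul_mod_mul (hb.trans_le hm) hu3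
    exact ⟨u, huS, hu2, h4.2 hj, h4.1⟩
  · have h := hS (.inr (j, k)) (by simp [cliqueTargetIndex, hj, hk])
    obtain ⟨u, hu, huS⟩ := Finset.not_disjoint_iff.1 h
    obtain ⟨-, hu1, -, hu3⟩ := Finset.mem_filter.1 hu
    have h4 := add_mul_mod_mul hj hu3
    exact ⟨u, huS, hu1, h4.1, h4.2 hk⟩

/-- Each half contains at least `(N - 1) / 2` vertices and the moduli are at most `Q`; the rounding
loss of `1` is absorbed by `4 * Q + 2 ≤ N`. -/
theorem le_card_cliqueTarget {N l m : ℕ} {Q : ℝ} (hm : m ≤ codeLength N)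
    (hQ1 : (codeLength N : ℝ) * (l + 1) ≤ Q) (hQ2 : (l + 1 : ℝ) * 2 ^ m ≤ Q)
    (hQN : 4 * Q + 2 ≤ N) (i) (hi : i ∈ cliqueTargetIndex l m) :
    1 / (4 * Q) * N ≤ (cliqueTarget N l m i).card := by
  have hN2 : ((N : ℝ) - 1) / 2 ≤ ((N / 2 : ℕ) : ℝ) := by
    have : N ≤ 2 * (N / 2) + 1 := by omega
    have : (N : ℝ) ≤ 2 * ((N / 2 : ℕ) : ℝ) + 1 := by exact_mod_cast this
    linarith
  have hN3 : ((N / 2 : ℕ) : ℝ) ≤ N / 2 := by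
    have : 2 * (N / 2) ≤ N := by omega
    have : 2 * ((N / 2 : ℕ) : ℝ) ≤ (N : ℝ) := by exact_mod_cast this
    linarith
  have key : ∀ q : ℕ, 0 < q → (q : ℝ) ≤ Q → ∀ d : ℝ, ((N : ℝ) - 1) / 2 ≤ d →
      1 / (4 * Q) * N ≤ d / q - 1 := by
    intro q hq hqQ d hd
    have hq' : (0 : ℝ) < q := by exact_mod_cast hq
    have hQ0 : 0 < Q := hq'.trans_le hqQ
    have hd0 : 0 ≤ d := by linarith
    have h1 : ((N : ℝ) - 1) / 2 / Q ≤ d / q := by gcongr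
    have h2 : 1 / (4 * Q) * N ≤ ((N : ℝ) - 1) / 2 / Q - 1 := by
      rw [div_div, div_mul_eq_mul_div, one_mul, le_sub_iff_add_le, div_add_one (by positivity),
        div_le_div_iff₀ (by positivity) (by positivity)]
      nlinarith
    linarith
  rcases i with ⟨j, b⟩ | ⟨j, k⟩
  · have hjb : j < l + 1 ∧ b < m := by simpa [cliqueTargetIndex] using hi
    have hlt : b + codeLength N * j < codeLength N * (l + 1) := by
      have : codeLength N * j + codeLength N ≤ codeLength N * (l + 1) := by
        rw [← Nat.mul_succ]
        exact Nat.mul_le_mul_left _ hjb.1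
      omega
    refine le_trans ?_ (le_card_residueSet (Nat.div_le_self N 2) hlt)
    exact key _ (by omega) (by exact_mod_cast hQ1) _ (by simpa using hN2)
  · have hjk : j < l + 1 ∧ k < 2 ^ m := by simpa [cliqueTargetIndex] using hi
    have hlt : j + (l + 1) * k < (l + 1) * 2 ^ m := by
      have : (l + 1) * k + (l + 1) ≤ (l + 1) * 2 ^ m := by
        rw [← Nat.mul_succ]
        exact Nat.mul_le_mul_left _ hjk.2
      omega
    refine le_trans ?_ (le_card_residueSet le_rfl hlt)
    exact key _ (by omega) (by exact_mod_cast hQ2) _ (by linarith)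

/-- The sets of vertices that miss some target class. -/
def missingSets (N κ l m : ℕ) : Finset (Finset (Fin N)) :=
  ((Finset.univ : Finset (Fin N)).powersetCard κ).filter
    (fun S => ∃ i ∈ cliqueTargetIndex l m, Disjoint (cliqueTarget N l m i) S)

/-- Union bound over at most `2 * (l + 1) * 2 ^ m ≤ 2 * Q` targets, each of density at least `1 / (4
* Q)`. -/
theorem card_missingSets_le {N κ l m : ℕ} {Q : ℝ} (hN : 0 < N) (hm : m ≤ codeLength N)
    (hQ1 : (codeLength N : ℝ) * (l + 1) ≤ Q) (hQ2 : (l + 1 : ℝ) * 2 ^ m ≤ Q)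
    (hQN : 4 * Q + 2 ≤ N) (hexp : 2 * Q * Real.exp (-(1 / (4 * Q) * κ)) ≤ 1 / 3) :
    ((missingSets N κ l m).card : ℝ) ≤ 1 / 3 * (N.choose κ : ℕ) := by
  refine (card_filter_exists_disjoint_le hN κ _ _
    (le_card_cliqueTarget hm hQ1 hQ2 hQN)).trans ?_
  refine mul_le_mul_of_nonneg_right (le_trans ?_ hexp) (Nat.cast_nonneg _)
  refine mul_le_mul_of_nonneg_right ?_ (Real.exp_pos _).le
  rw [card_cliqueTargetIndex]
  have h1 : ((l + 1 : ℝ)) * m ≤ (l + 1) * 2 ^ m := by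
    gcongr
    exact_mod_cast Nat.lt_two_pow_self.le
  push_cast
  linarith

/-! ### Choice of the parameters -/

/-- The parameters of the reduction are good at `N`. -/
structure GoodParameters (δ r : ℝ) (l m N : ℕ) (Q : ℝ) : Prop where
  pos : 0 < N
  le_codeLength : m ≤ codeLength N
  lt_mul : 2 * (codeLength N : ℝ) * r < (l + 1) * m
  codeLength_mul_le : (codeLength N : ℝ) * (l + 1) ≤ Q
  mul_two_pow_le : (l + 1 : ℝ) * 2 ^ m ≤ Q
  four_mul_add_le : 4 * Q + 2 ≤ N
  exp_le : 2 * Q * Real.exp (-(1 / (4 * Q) * ⌈(N : ℝ) ^ δ⌉₊)) ≤ 1 / 3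
  add_clog_le : codeLength N + 2 + (l + 1) * Nat.clog 2 (codeLength N + 2) ≤ 2 * codeLength N

theorem tendsto_codeLength : Tendsto codeLength atTop atTop := by
  refine tendsto_atTop.2 fun b => ?_
  filter_upwards [eventually_ge_atTop (2 ^ b)] with N hN
  have h1 := lt_two_pow_binLength (N * (N + 1))
  have h2 : N ≤ N * (N + 1) := Nat.le_mul_of_pos_right N (by omega)
  exact ((Nat.pow_lt_pow_iff_right one_lt_two).1 ((hN.trans h2).trans_lt h1)).le

/-- There is no leading zero, so `2 ^ codeLength N ≤ 2 * N * (N + 1) ≤ N ^ 4`. -/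
theorem codeLength_le_mul_log {N : ℕ} (hN : 2 ≤ N) :
    (codeLength N : ℝ) * Real.log 2 ≤ 4 * Real.log N := by
  have h1 : 2 ^ codeLength N ≤ N ^ 4 := by
    refine (two_pow_binLength_le (by positivity)).trans ?_
    calc 2 * (N * (N + 1)) ≤ N * (N * (N * N)) := by
          refine Nat.mul_le_mul hN (Nat.mul_le_mul_left _ ?_)
          nlinarith
      _ = N ^ 4 := by ring
  have h2 : ((2 : ℝ)) ^ codeLength N ≤ (N : ℝ) ^ 4 := by exact_mod_cast h1
  have h3 := Real.log_le_log (by positivity) h2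
  rwa [Real.log_pow, Real.log_pow] at h3

/-- In terms of `k = Nat.log 2 (L + 1)` a linear function of `k` has to stay below `2 ^ k`. -/
theorem eventually_add_clog_le (l : ℕ) :
    ∀ᶠ L : ℕ in atTop, L + 2 + (l + 1) * Nat.clog 2 (L + 2) ≤ 2 * L := by
  have h1 : Tendsto (fun k : ℕ => ((l + 1 : ℕ) : ℝ) * (k : ℝ) ^ 1 / 2 ^ k) atTop (nhds 0) := by
    have := (tendsto_pow_const_div_const_pow_of_one_lt 1 (one_lt_two (α := ℝ))).const_mul
      (((l + 1 : ℕ) : ℝ))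
    simpa [mul_div_assoc] using this
  have h2 : ∀ᶠ k : ℕ in atTop, 2 * (l + 1) * (k + 1) + 4 ≤ 2 ^ k := by
    have h3 := h1.eventually (gt_mem_nhds (show (0 : ℝ) < 1 / 8 by norm_num))
    filter_upwards [h3, eventually_ge_atTop 1] with k hk hk1
    rw [div_lt_iff₀ (by positivity), pow_one] at hk
    have h4 : 8 * ((l + 1) * k) < 2 ^ k := by
      have : 8 * (((l + 1 : ℕ) : ℝ) * k) < 2 ^ k := by linarith
      exact_mod_cast this
    have h5 : l + 1 ≤ (l + 1) * k := Nat.le_mul_of_pos_right _ hk1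
    have h6 : 2 * (l + 1) * (k + 1) = 2 * ((l + 1) * k) + 2 * (l + 1) := by ring
    omega
  have h7 : Tendsto (fun L : ℕ => Nat.log 2 (L + 1)) atTop atTop := by
    refine tendsto_atTop.2 fun b => ?_
    filter_upwards [eventually_ge_atTop (2 ^ b)] with L hL
    exact Nat.le_log_of_pow_le one_lt_two (by omega)
  filter_upwards [h7.eventually h2] with L hL
  have h8 : 2 ^ Nat.log 2 (L + 1) ≤ L + 1 := Nat.pow_log_le_self 2 (by omega)
  have h9 : Nat.clog 2 (L + 2) ≤ Nat.log 2 (L + 1) + 1 := by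
    refine Nat.clog_le_of_le_pow ?_
    exact Nat.lt_pow_succ_log_self one_lt_two (L + 1)
  have h10 := Nat.mul_le_mul_left (l + 1) h9
  have h11 : 2 * (l + 1) * (Nat.log 2 (L + 1) + 1) =
    2 * ((l + 1) * (Nat.log 2 (L + 1) + 1)) := by ring
  omega

open StackProg

/-- Here `m * log 2` is at least `(δ / 4) * log N` and `codeLength N * log 2` is at most `4 * log
N`; comparing `2 * r * 4` with `(l + 1) * δ / 4` gives the constant `32`. -/
theorem eventually_goodParameters {δ r : ℝ} (hδ : 0 < δ) (hδ1 : δ < 1) (hr : 1 ≤ r) {l : ℕ}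
    (hl : 32 * r < (l + 1) * δ) :
    ∀ᶠ N : ℕ in atTop, GoodParameters δ r l (Nat.log 2 ⌊(N : ℝ) ^ (δ / 2)⌋₊) N
      ((l + 1) * (N : ℝ) ^ (δ / 2)) := by
  have hl0 : (0 : ℝ) < l + 1 := by positivity
  have hlog2 : 0 < Real.log 2 := Real.log_pos one_lt_two
  have hcast := tendsto_natCast_atTop_atTop (R := ℝ)
  have hx : Tendsto (fun N : ℕ => (N : ℝ) ^ (δ / 2)) atTop atTop :=
    (tendsto_rpow_atTop (half_pos hδ)).comp hcast
  have e1 : ∀ᶠ N : ℕ in atTop, 4 * (l : ℝ) + 6 ≤ (N : ℝ) ^ (1 - δ / 2) :=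
    ((tendsto_rpow_atTop (by linarith)).comp hcast).eventually_ge_atTop _
  have e2 : ∀ᶠ N : ℕ in atTop, 4 * Real.log 2 / δ ≤ Real.log N :=
    (Real.tendsto_log_atTop.comp hcast).eventually_ge_atTop _
  have e3 : ∀ᶠ N : ℕ in atTop, Real.log N ≤ Real.log 2 / 4 * (N : ℝ) ^ (δ / 2) := by
    have h := ((isLittleO_log_rpow_atTop (half_pos hδ)).comp_tendsto hcast).bound
      (show 0 < Real.log 2 / 4 by positivity)
    filter_upwards [h] with N hN
    simp only [Function.comp_apply, Real.norm_eq_abs] at hN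
    rw [abs_of_nonneg (Real.rpow_nonneg (Nat.cast_nonneg N) _)] at hN
    exact (le_abs_self _).trans hN
  have e4 : ∀ᶠ N : ℕ in atTop, (N : ℝ) ^ (δ / 2) *
      Real.exp (-(1 / (4 * (l + 1))) * (N : ℝ) ^ (δ / 2)) ≤ 1 / 3 / (2 * (l + 1)) := by
    have h := (tendsto_rpow_mul_exp_neg_mul_atTop_nhds_zero 1 (1 / (4 * ((l : ℝ) + 1)))
      (by positivity)).comp hx
    filter_upwards [h.eventually (ge_mem_nhds
      (show (0 : ℝ) < 1 / 3 / (2 * (l + 1)) by positivity))] with N hN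
    simpa using hN
  filter_upwards [e1, e2, e3, e4, eventually_ge_atTop 2, hx.eventually_ge_atTop 1,
    tendsto_codeLength.eventually (eventually_add_clog_le l)] with N h1 h2 h3 h4 hN h5 h6
  have hN0 : (0 : ℝ) < N := by positivity
  set x := (N : ℝ) ^ (δ / 2) with hxdef
  set m := Nat.log 2 ⌊x⌋₊ with hm
  have hx0 : 0 < x := zero_lt_one.trans_le h5
  have hfl : ⌊x⌋₊ ≠ 0 := (Nat.floor_pos.2 h5).ne'
  have hmx : ((2 : ℝ)) ^ m ≤ x := by
    have h7 : ((2 ^ m : ℕ) : ℝ) ≤ (⌊x⌋₊ : ℝ) := by exact_mod_cast Nat.pow_log_le_self 2 hfl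
    push_cast at h7
    exact h7.trans (Nat.floor_le hx0.le)
  have hxN : x ≤ N := by
    calc x ≤ (N : ℝ) ^ (1 : ℝ) :=
          Real.rpow_le_rpow_of_exponent_le (by exact_mod_cast (by omega : 1 ≤ N)) (by linarith)
      _ = N := Real.rpow_one _
  have hmL : m ≤ codeLength N := by
    have h7 : ((2 ^ m : ℕ) : ℝ) ≤ N := by
      push_cast
      exact hmx.trans hxN
    have h8 : 2 ^ m ≤ N := by exact_mod_cast h7
    have h9 := lt_two_pow_binLength (N * (N + 1))
    have h10 : N ≤ N * (N + 1) := Nat.le_mul_of_pos_right N (by omega)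
    exact ((Nat.pow_lt_pow_iff_right one_lt_two).1 ((h8.trans h10).trans_lt h9)).le
  have hL := codeLength_le_mul_log hN
  -- Floor and logarithm together lose at most one bit of `(δ / 2) * log N`; by `h2` this costs at
  -- most half of it.
  have hmlog : δ / 4 * Real.log N ≤ m * Real.log 2 := by
    have h7 : x < 2 ^ (m + 1) := by
      have := (Nat.floor_lt hx0.le).1 (Nat.lt_pow_succ_log_self one_lt_two ⌊x⌋₊)
      exact_mod_cast this
    have h8 := Real.log_le_log hx0 h7.le
    rw [hxdef, Real.log_rpow hN0, Real.log_pow] at h8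
    push_cast at h8
    rw [div_le_iff₀ hδ] at h2
    linarith
  have hlogN : 0 < Real.log N := Real.log_pos (by exact_mod_cast hN)
  refine ⟨by omega, hmL, ?_, ?_, ?_, ?_, ?_, h6⟩
  · refine lt_of_mul_lt_mul_right ?_ hlog2.le
    calc 2 * (codeLength N : ℝ) * r * Real.log 2
        = 2 * r * (codeLength N * Real.log 2) := by ring
      _ ≤ 2 * r * (4 * Real.log N) := by gcongr
      _ = 32 * r * (Real.log N / 4) := by ring
      _ < (l + 1) * δ * (Real.log N / 4) := by gcongr
      _ = (l + 1) * (δ / 4 * Real.log N) := by ring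
      _ ≤ (l + 1) * (m * Real.log 2) := by gcongr
      _ = (l + 1) * m * Real.log 2 := by ring
  · rw [mul_comm]
    refine mul_le_mul_of_nonneg_left ?_ hl0.le
    refine le_of_mul_le_mul_right ?_ hlog2
    linarith
  · exact mul_le_mul_of_nonneg_left hmx hl0.le
  · have h7 : (N : ℝ) = x * (N : ℝ) ^ (1 - δ / 2) := by
      rw [hxdef, ← Real.rpow_add hN0]
      simp
    calc 4 * ((l + 1) * x) + 2 ≤ x * (4 * l + 6) := by linarith
      _ ≤ x * (N : ℝ) ^ (1 - δ / 2) := by gcongr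
      _ = N := h7.symm
  -- The clique has at least `x ^ 2` vertices while `Q = (l + 1) * x`, so the exponent is at least
  -- `x / (4 * (l + 1))`, which beats the factor `x` in front.
  · have h7 : x * x ≤ (⌈(N : ℝ) ^ δ⌉₊ : ℝ) := by
      refine le_trans (le_of_eq ?_) (Nat.le_ceil _)
      rw [hxdef, ← Real.rpow_add hN0, add_halves]
    have h8 : Real.exp (-(1 / (4 * ((l + 1) * x)) * (⌈(N : ℝ) ^ δ⌉₊ : ℝ))) ≤
        Real.exp (-(1 / (4 * (l + 1))) * x) := by
      refine Real.exp_le_exp.2 ?_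
      rw [neg_mul, neg_le_neg_iff]
      calc 1 / (4 * ((l : ℝ) + 1)) * x = 1 / (4 * ((l + 1) * x)) * (x * x) := by
            field_simp
        _ ≤ _ := by gcongr
    calc _ ≤ 2 * ((l + 1) * x) * Real.exp (-(1 / (4 * (l + 1))) * x) := by gcongr
      _ = 2 * (l + 1) * (x * Real.exp (-(1 / (4 * (l + 1))) * x)) := by ring
      _ ≤ 2 * (l + 1) * (1 / 3 / (2 * (l + 1))) := by gcongr
      _ = 1 / 3 := by field_simp

/-! ### Running time of the reduction -/

/-- The length of the table that is computed from a graph with `N` vertices. -/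
def reductionLength (l N : ℕ) : ℕ := N ^ (l + 1) * (N + N ^ (l + 1) + 1)

theorem reductionLength_le {l N : ℕ} (hN : 2 ≤ N) : reductionLength l N ≤ N ^ (2 * l + 4) := by
  have h1 : N ^ 1 ≤ N ^ (l + 1) := Nat.pow_le_pow_right (by omega) (by omega)
  have h2 : N + N ^ (l + 1) + 1 ≤ N ^ 2 * N ^ (l + 1) := by
    have h3 : 4 ≤ N ^ 2 := by nlinarith
    have h4 := Nat.mul_le_mul_right (N ^ (l + 1)) h3
    rw [pow_one] at h1
    omega
  calc N ^ (l + 1) * (N + N ^ (l + 1) + 1) ≤ N ^ (l + 1) * (N ^ 2 * N ^ (l + 1)) := by gcongr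
    _ = N ^ (2 * l + 4) := by ring

theorem self_le_reductionLength (l N : ℕ) : N ≤ reductionLength l N := by
  rcases Nat.eq_zero_or_pos N with rfl | hN
  · simp
  · have h1 : N ^ 1 ≤ N ^ (l + 1) := Nat.pow_le_pow_right hN (by omega)
    calc N = N ^ 1 * 1 := by ring
      _ ≤ _ := Nat.mul_le_mul h1 (by omega)

/-- For constant `l` the table length is a polynomial in `N`, so its logarithm is `O(log N)`; the
polynomial overhead adds only a constant to the exponent. -/
theorem isPowLittleOLog_reductionTime {T : ℕ → ℕ} (hT : IsPowLittleOLog T) (l : ℕ) :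
    IsPowLittleOLog fun N =>
      Turing.FinTM2.reductionTime l N (T (reductionLength l N)) := by
  obtain ⟨g, hg, hTg⟩ := hT
  have hlen : Tendsto (reductionLength l) atTop atTop :=
    tendsto_atTop_mono (self_le_reductionLength l) tendsto_id
  -- The overhead is at most `N ^ (12 * l + 28)`; one more factor `N` turns the sum of the two times
  -- into a product. The absolute value covers a negative `g`.
  refine ⟨fun N => (12 * l + 29 : ℕ) + (2 * l + 4 : ℕ) * |g (reductionLength l N)|, ?_, ?_⟩
  · refine IsLittleO.add ?_ ?_
    · exact isLittleO_const_left.2 (Or.inr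
        (tendsto_norm_atTop_atTop.comp (Real.tendsto_log_atTop.comp tendsto_natCast_atTop_atTop)))
    · refine IsLittleO.const_mul_left ?_ _
      refine ((hg.comp_tendsto hlen).norm_left).trans_isBigO ?_
      refine IsBigO.of_bound ((2 * l + 4 : ℕ) : ℝ) ?_
      filter_upwards [eventually_ge_atTop 2] with N hN
      have h1 : (1 : ℝ) ≤ (reductionLength l N : ℝ) := by
        exact_mod_cast (by omega : 1 ≤ N).trans (self_le_reductionLength l N)
      have h2 : (1 : ℝ) ≤ (N : ℝ) := by exact_mod_cast (by omega : 1 ≤ N)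
      simp only [Function.comp_apply, Real.norm_eq_abs]
      rw [abs_of_nonneg (Real.log_nonneg h1), abs_of_nonneg (Real.log_nonneg h2), ← Real.log_pow]
      exact Real.log_le_log (by linarith) (by exact_mod_cast reductionLength_le hN)
  · filter_upwards [hlen.eventually hTg, eventually_ge_atTop (200 * (l + 1) + 2)] with N hN hN2
    have hN1 : (1 : ℝ) ≤ (N : ℝ) := by exact_mod_cast (by omega : 1 ≤ N)
    have hN0 : (0 : ℝ) < N := by linarith
    set n := reductionLength l N with hn
    have hn1 : (1 : ℝ) ≤ (n : ℝ) := by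
      exact_mod_cast (by omega : 1 ≤ N).trans (self_le_reductionLength l N)
    have h1 : (T n : ℝ) ≤ (N : ℝ) ^ (((2 * l + 4 : ℕ) : ℝ) * |g n|) := by
      calc (T n : ℝ) ≤ (n : ℝ) ^ g n := hN
        _ ≤ (n : ℝ) ^ |g n| := Real.rpow_le_rpow_of_exponent_le hn1 (le_abs_self _)
        _ ≤ ((N : ℝ) ^ (2 * l + 4)) ^ |g n| := by
          refine Real.rpow_le_rpow (by linarith) ?_ (abs_nonneg _)
          exact_mod_cast reductionLength_le (by omega)
        _ = _ := by rw [Real.rpow_mul hN0.le, Real.rpow_natCast]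
    have h2 : 200 * (l + 1) * ((N + 1) ^ (2 * l + 4) + 1) ^ 3 ≤ N ^ (12 * l + 28) := by
      have h3 : N + 1 ≤ N ^ 2 := by nlinarith
      have h4 : (N + 1) ^ (2 * l + 4) + 1 ≤ N ^ (4 * l + 9) := by
        have h5 : (N + 1) ^ (2 * l + 4) ≤ N ^ (4 * l + 8) := by
          calc (N + 1) ^ (2 * l + 4) ≤ (N ^ 2) ^ (2 * l + 4) := by gcongr
            _ = N ^ (4 * l + 8) := by rw [← pow_mul]; ring_nf
        have h6 : 1 ≤ N ^ (4 * l + 8) := Nat.one_le_pow _ _ (by omega)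
        rw [show N ^ (4 * l + 9) = N ^ (4 * l + 8) * N from pow_succ _ _]
        nlinarith
      calc _ ≤ N * (N ^ (4 * l + 9)) ^ 3 := by
            gcongr
            omega
        _ = N ^ (12 * l + 28) := by rw [← pow_mul, ← pow_succ']; ring_nf
    have h3 : ((200 * (l + 1) * ((N + 1) ^ (2 * l + 4) + 1) ^ 3 : ℕ) : ℝ) ≤
        (N : ℝ) ^ (12 * l + 28) := by exact_mod_cast h2
    set y := (N : ℝ) ^ (((2 * l + 4 : ℕ) : ℝ) * |g n|) with hy
    have hy1 : 1 ≤ y := Real.one_le_rpow hN1 (by positivity)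
    have hz1 : 1 ≤ (N : ℝ) ^ (12 * l + 28) := one_le_pow₀ hN1
    have hN2' : (2 : ℝ) ≤ N := by exact_mod_cast (by omega : 2 ≤ N)
    rw [Turing.FinTM2.reductionTime, Nat.cast_add, Real.rpow_add hN0, Real.rpow_natCast, ← hy,
      show 12 * l + 29 = 12 * l + 28 + 1 from rfl, pow_succ]
    set z := (N : ℝ) ^ (12 * l + 28)
    calc _ ≤ z + y := add_le_add h3 h1
      _ ≤ z * 2 * y := by nlinarith
      _ ≤ z * N * y := by gcongr

/-! ### The decision procedure and the conclusion -/

open StackProg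

theorem ProbTM2.acceptProb_eq_one {α : Type} (M : ProbTM2 α) (w : List α) (t : ℕ)
    (h : ∀ coins : List Bool, coins.length = t →
      (M.run w coins).l = none ∧ (M.run w coins).var ∈ M.accepting) :
    M.acceptProb w t = 1 := by
  have h1 : ∀ coins : Fin t → Bool, (M.run w (List.ofFn coins)).l = none ∧
      (M.run w (List.ofFn coins)).var ∈ M.accepting := fun coins => h _ List.length_ofFn
  rw [ProbTM2.acceptProb, Nat.card_congr (Equiv.subtypeUnivEquiv h1), Nat.card_eq_fintype_card]
  simp

theorem ProbTM2.acceptProb_eq_zero {α : Type} (M : ProbTM2 α) (w : List α) (t : ℕ)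
    (h : ∀ coins : List Bool, coins.length = t → (M.run w coins).var ∉ M.accepting) :
    M.acceptProb w t = 0 := by
  have h1 : IsEmpty {coins : Fin t → Bool // (M.run w (List.ofFn coins)).l = none ∧
      (M.run w (List.ofFn coins)).var ∈ M.accepting} :=
    ⟨fun c => h _ List.length_ofFn c.2.2⟩
  rw [ProbTM2.acceptProb, Nat.card_of_isEmpty]
  simp

theorem ProbTM2.acceptProb_nonneg {α : Type} (M : ProbTM2 α) (w : List α) (t : ℕ) :
    0 ≤ M.acceptProb w t := by
  unfold ProbTM2.acceptProb
  positivity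

theorem ProbTM2.acceptProb_le_one {α : Type} (M : ProbTM2 α) (w : List α) (t : ℕ) :
    M.acceptProb w t ≤ 1 := by
  rw [ProbTM2.acceptProb, div_le_one (by positivity)]
  have h := Nat.card_le_card_of_injective (Subtype.val : {coins : Fin t → Bool //
    (M.run w (List.ofFn coins)).l = none ∧ (M.run w (List.ofFn coins)).var ∈ M.accepting} → _)
    Subtype.val_injective
  rw [Nat.card_eq_fintype_card (α := Fin t → Bool)] at h
  simp only [Fintype.card_pi, Fintype.card_bool, Finset.prod_const, Finset.card_univ,
    Fintype.card_fin] at h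
  exact_mod_cast h

theorem ConceptMatrix.ldim_le_numPoints (C : ConceptMatrix) : C.ldim ≤ C.numPoints :=
  (littlestoneDim_le_card C.toClass).trans_eq (Fintype.card_fin _)

theorem ConceptMatrix.vcDim_le_ldim (C : ConceptMatrix) : C.vcDim ≤ C.ldim :=
  vcDim_le_littlestoneDim C.toClass

theorem length_encode_reductionClass (l : ℕ) {N : ℕ} (hN : 0 < N) (G : SimpleGraph (Fin N)) :
    (reductionClass l hN G).encode.length = reductionLength l N := by
  rw [encode_reductionClass, length_encodeRows_of_forall (n := N + N ^ (l + 1)),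
    length_reductionRows, reductionLength]
  intro x hx
  obtain ⟨i, hi, rfl⟩ := List.getElem_of_mem hx
  have hi2 : i < N ^ (l + 1) := by rwa [length_reductionRows] at hi
  rw [getElem_reductionRows G l hi2, List.length_append, length_getElem_andPower,
    length_unitRow (by omega)]

section Decision

variable {f : ConceptMatrix → ℕ}
  (M : Turing.TM2ComputableInTime ConceptMatrix.encode Computability.encodeNat f)

/-- The decision procedure for planted cliques that is obtained from a machine for `f`. -/
def decisionMachine (l : ℕ) : ProbTM2 (Option Bool) :=
  Turing.FinTM2.reductionMachine l M.tm M.inputAlphabet M.outputAlphabet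

/-- The running time of the decision procedure. -/
def decisionTime (l N : ℕ) : ℕ :=
  Turing.FinTM2.reductionTime l N (M.time (reductionLength l N))

theorem decisionMachine_run {l N : ℕ} (hN : 0 < N) (G : SimpleGraph (Fin N))
    (hf : f (reductionClass l hN G) ≤ N + N ^ (l + 1)) (coins : List Bool)
    (hc : coins.length = decisionTime M l N) :
    ((decisionMachine M l).run (encodeGraph G) coins).l = none ∧
    (((decisionMachine M l).run (encodeGraph G) coins).var ∈ (decisionMachine M l).accepting ↔
      2 * codeLength N < f (reductionClass l hN G)) := by
  rw [encodeGraph_eq_encodeRows]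
  have h := M.outputsFun (reductionClass l hN G)
  rw [length_encode_reductionClass, encode_reductionClass] at h
  exact Turing.FinTM2.reductionMachine_run _ _ _ _ hN (length_adjacencyRows G)
    (length_of_mem_adjacencyRows G) h hf le_rfl coins hc

theorem decisionMachine_haltsWithin (hf : ∀ C, f C ≤ C.ldim) (l N : ℕ)
    (G : SimpleGraph (Fin N)) :
    (decisionMachine M l).HaltsWithin (encodeGraph G) (decisionTime M l N) := by
  intro coins
  rcases Nat.eq_zero_or_pos N with rfl | hN
  -- The graph without vertices is the empty input, on which the machine halts at once without
  -- building a class.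
  · rw [encodeGraph_eq_encodeRows]
    refine Turing.FinTM2.reductionMachine_run_nil _ _ _ _ (t := decisionTime M l 0) ?_ _ List.length_ofFn
    rw [decisionTime, Turing.FinTM2.reductionTime]
    have : 0 < 200 * (l + 1) * ((0 + 1) ^ (2 * l + 4) + 1) ^ 3 := by positivity
    omega
  · exact (decisionMachine_run M hN G ((hf _).trans (ConceptMatrix.ldim_le_numPoints _)) _
      List.length_ofFn).1

/-- The decision procedure rejects most random graphs. -/
theorem integral_binomialRandom_le (hf : ∀ C, f C ≤ C.ldim) {δ r Q : ℝ} {l m N : ℕ}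
    (hg : GoodParameters δ r l m N Q) :
    ∫ G, (decisionMachine M l).acceptProb (encodeGraph G) (decisionTime M l N)
      ∂(SimpleGraph.binomialRandom (Fin N) edgeHalf) ≤ 1 / 3 := by
  -- With `N ^ 2 ≤ 2 ^ codeLength N` this choice makes `N ^ 2 / 2 ^ a` at most `1 / 4`, and the
  -- union bound is the `a`-th power of that.
  set a := codeLength N + 2 with ha
  refine (integral_le_measureReal _ (P := fun G => ∃ D B : Finset (Fin N),
    D.card = a ∧ B.card = a ∧ CompleteBetween G D B)
    (fun G => ProbTM2.acceptProb_le_one _ _ _) fun G hG => ?_).trans ?_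
  · refine ProbTM2.acceptProb_eq_zero _ _ _ fun coins hc => ?_
    rw [(decisionMachine_run M hg.pos G ((hf _).trans (ConceptMatrix.ldim_le_numPoints _)) _
      hc).2, not_lt]
    exact ((hf _).trans (ldim_reductionClass_le hg.pos (by omega) hG)).trans hg.add_clog_le
  · refine (binomialRandom_exists_completeBetween_le N a).trans ?_
    have h1 : N ^ 2 ≤ 2 ^ codeLength N := by
      have := lt_two_pow_binLength (N * (N + 1))
      change _ < 2 ^ codeLength N at this
      nlinarith
    have h2 : (N : ℝ) ^ 2 ≤ 2 ^ codeLength N := by exact_mod_cast h1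
    have h3 : (N : ℝ) ^ 2 * (1 / 2) ^ a ≤ 1 / 4 := by
      rw [ha, pow_add, one_div, inv_pow, ← mul_assoc, ← div_eq_mul_inv]
      have : (N : ℝ) ^ 2 / 2 ^ codeLength N ≤ 1 := div_le_one_of_le₀ h2 (by positivity)
      linarith
    rw [pow_mul, pow_mul, ← mul_pow]
    calc ((N : ℝ) ^ 2 * (1 / 2) ^ a) ^ a ≤ ((N : ℝ) ^ 2 * (1 / 2) ^ a) ^ 1 :=
          pow_le_pow_of_le_one (by positivity) (h3.trans (by norm_num)) (by omega)
      _ ≤ 1 / 3 := by linarith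

/-- The decision procedure accepts most graphs with a planted clique. -/
theorem le_integral_plantedRandom (hf : ∀ C, f C ≤ C.ldim) {δ r Q : ℝ} (hδ : δ < 1) (hr : 0 < r)
    (hf' : ∀ C : ConceptMatrix, (C.vcDim : ℝ) / r ≤ f C) {l m N : ℕ}
    (hg : GoodParameters δ r l m N Q) :
    2 / 3 ≤ ∫ G, (decisionMachine M l).acceptProb (encodeGraph G) (decisionTime M l N)
      ∂(plantedRandom (Fin N) edgeHalf ⌈(N : ℝ) ^ δ⌉₊) := by
  have hN1 : (1 : ℝ) ≤ N := by exact_mod_cast hg.pos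
  refine two_thirds_le_integral_plantedRandom ?_ (fun G => ProbTM2.acceptProb_nonneg _ _ _)
    (missingSets N ⌈(N : ℝ) ^ δ⌉₊ l m) (card_missingSets_le hg.pos hg.le_codeLength
      hg.codeLength_mul_le hg.mul_two_pow_le hg.four_mul_add_le hg.exp_le) fun S hS hSm G => ?_
  · refine Nat.ceil_le.2 ?_
    calc (N : ℝ) ^ δ ≤ (N : ℝ) ^ (1 : ℝ) := Real.rpow_le_rpow_of_exponent_le hN1 hδ.le
      _ = N := Real.rpow_one _
  · refine ProbTM2.acceptProb_eq_one _ _ _ fun coins hc => ?_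
    obtain ⟨h1, h2⟩ := decisionMachine_run M hg.pos (plantClique G S)
      ((hf _).trans (ConceptMatrix.ldim_le_numPoints _)) coins hc
    refine ⟨h1, h2.2 ?_⟩
    have h3 := le_vcDim_reductionClass_plantClique hg.pos hg.le_codeLength G S (l := l)
      fun i hi hd => hSm (Finset.mem_filter.2
        ⟨Finset.mem_powersetCard.2 ⟨Finset.subset_univ _, hS⟩, i, hi, hd⟩)
    have h4 : ((l : ℝ) + 1) * m ≤ ((reductionClass l hg.pos (plantClique G S)).vcDim : ℝ) := by
      exact_mod_cast h3
    have h5 := (div_le_iff₀ hr).1 (hf' (reductionClass l hg.pos (plantClique G S)))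
    -- The VC dimension is at most `r` times the output and exceeds `2 * codeLength N * r`, so the
    -- output exceeds the threshold.
    have h6 := hg.lt_mul.trans_le (h4.trans h5)
    have h7 := lt_of_mul_lt_mul_right h6 hr.le
    exact_mod_cast h7

end Decision

/-- No parameter between the two dimensions can be approximated. -/
theorem not_approximable_of_le_of_le (hSPC : StrongishPlantedCliqueHypothesis) {r : ℝ}
    (hr : 1 ≤ r) {opt : ConceptMatrix → ℕ} (h1 : ∀ C : ConceptMatrix, C.vcDim ≤ opt C)
    (h2 : ∀ C : ConceptMatrix, opt C ≤ C.ldim) : ¬ ApproximableInPowLittleOLog opt r := by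
  rintro ⟨f, M, hM, hf⟩
  obtain ⟨δ, hδ, hδ1, hno⟩ := hSPC
  have hr0 : 0 < r := by linarith
  have hf1 : ∀ C, f C ≤ C.ldim := fun C => le_trans (by exact_mod_cast (hf C).2) (h2 C)
  have hf2 : ∀ C : ConceptMatrix, (C.vcDim : ℝ) / r ≤ f C := fun C => by
    refine le_trans ?_ (hf C).1
    gcongr
    exact_mod_cast h1 C
  -- The number of blocks depends only on `r` and `δ`, so the reduction stays polynomial.
  obtain ⟨l, hl⟩ := exists_nat_gt (32 * r / δ)
  rw [div_lt_iff₀ hδ] at hl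
  refine hno ⟨decisionMachine M l, decisionTime M l, isPowLittleOLog_reductionTime hM l,
    fun N G => decisionMachine_haltsWithin M hf1 l N G, ?_⟩
  filter_upwards [eventually_goodParameters hδ hδ1 hr (l := l) (by linarith)] with N hg
  exact ⟨le_integral_plantedRandom M hf1 hδ1 hr0 hf2 hg, integral_binomialRandom_le M hf1 hg⟩

theorem mainTheorem6 (hSPC : StrongishPlantedCliqueHypothesis) (r : ℝ) (hr : 1 ≤ r) :
    ¬ ApproximableInPowLittleOLog ConceptMatrix.vcDim r ∧
      ¬ ApproximableInPowLittleOLog ConceptMatrix.ldim r :=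
  ⟨not_approximable_of_le_of_le hSPC hr (fun _ => le_rfl) ConceptMatrix.vcDim_le_ldim,
    not_approximable_of_le_of_le hSPC hr ConceptMatrix.vcDim_le_ldim fun _ => le_rfl⟩

end
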